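/- Fix a finite field $\mathbb F$. Algorithms are probabilistic programs (one fixed program for all input lengths) that manipulate pointer structures (cons cells with leaves $\mathrm{nil}$ or elements of $\mathbb F$), with unit-cost cons-cell operations, unit-cost arithmetic and equality tests in $\mathbb F$, fair coin flips and draws of uniform elements of $\mathbb F$. A time bound holds for all inputs of the given size and all coin outcomes. Vectors are given as lists of entries and matrices as lists of rows; numbers $n$ are given in unary. We write $f=\tilde O(g)$ if there are constants $C,k$ with $f(n)\le C\,g(n)(\log n)^k$ for all sufficiently large $n$. A *trapdoored matrix family with two-sided multiplication* over $\mathbb F$ is a sequence of distributions $\mathcal D_n$ over pairs $(M,C)$ with $M\in\mathbb F^{n\times n}$ and $C$ a string (the trapdoor, describing circuits for $M$) such that: - (efficient sampling) one program samples from $\mathcal D_n$ on input $1^n$ in time $\tilde O(n^2)$; - (efficient two-sided multiplication) two programs compute, from $C$ and a vector $v\in\mathbb F^n$, exactly $Mv$ and $v^{\mathsf T}M$, respectively, in time $\tilde O(n)$, for every $(M,C)$ in the support of $\mathcal D_n$ and every $v$; - (indistinguishability) for every probabilistic polynomial-time algorithm $\mathcal A$ and every sequence of advice strings $z_n$ of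 size polynomial in $n$, the quantity $\bigl|\Pr_{M\sim\mathbb F^{n\times n}}[\mathcal A(z_n,M)=1]-\Pr_{(M,C)\sim\mathcal D_n}[\mathcal A(z_n,M)=1]\bigr|$ vanishes faster than every inverse polynomial in $n$. **Theorem.** Assume that such a family over $\mathbb F$ is given and let $\varepsilon>0$. Let $\mathcal M$ be an algorithm (possibly randomized) that on every input $(A,b)\in\mathbb F^{n\times n}\times\mathbb F^n$ runs in time $T(n)$, where $n^2=\tilde O(T(n))$, and suppose that for all sufficiently large $n$ $$\Pr_{A\sim GL_n(\mathbb F),\ b\sim\mathbb F^n}\bigl[A\cdot\mathcal M(A,b)=b\bigr]\ge\varepsilon,$$ where the probability is also over the coins of $\mathcal M$. Then for every constant $c\in\mathbb N$ there is a randomized algorithm $\mathcal W$ running in time $\tilde O(T(n))$ on every input $(A,b)\in\mathbb F^{n\times n}\times\mathbb F^n$ such that, for all sufficiently large $n$, for **every** $A\in GL_n(\mathbb F)$ and **every** $b\in\mathbb F^n$, $\mathcal W(A,b)$ outputs the unique solution $x=A^{-1}b$ of $Ax=b$ with probability at least $1-n^{-c}$. Moreover $\mathcal W$ verifies its answer: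 for every $n$, every $A\in GL_n(\mathbb F)$ and every $b\in\mathbb F^n$, every output that can occur is either $A^{-1}b$ or the symbol $\mathrm{nil}$ (failure). -/

import Mathlib

open Filter Asymptotics

open scoped Matrix

/-! ### The machine model: a probabilistic WHILE language on binary trees

Programs compute on binary trees (cons cells) whose leaves are `nil` or elements of the fixed finite
field `F`.  Allocating or following a pointer, an operation of `F`, a comparison of two field
elements, a fair coin flip and the drawing of a uniform field element cost one step each.
A program is a finite text; it is the same for all input lengths. -/

/-- Tree-shaped data with leaves in `F`. -/
inductive TreeData (F : Type*) where
  | nil : TreeData F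
  | atom (a : F) : TreeData F
  | pair (l r : TreeData F) : TreeData F

namespace TreeData

variable {F : Type*}

/-- Number of nodes. -/
def size : TreeData F → ℕ
  | nil => 1
  | atom _ => 1
  | pair l r => l.size + r.size + 1

/-- The left component of a pair. -/
def hd : TreeData F → TreeData F
  | pair l _ => l
  | _ => nil

/-- The right component of a pair. -/
def tl : TreeData F → TreeData F
  | pair _ r => r
  | _ => nil

/-- The value used for "true"; `nil` is used for "false". -/
def tt : TreeData F := pair nil nil

/-- Truth values as data. -/
def ofBool (b : Bool) : TreeData F := if b then tt else nil

/-- In tests everything except `nil` counts as true. -/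
def IsTrue (d : TreeData F) : Prop := d ≠ nil

/-- The field element stored in a leaf (zero if there is none). -/
def val [Zero F] : TreeData F → F
  | atom a => a
  | _ => 0

/-- Is it a pair? -/
def isPair : TreeData F → Bool
  | pair _ _ => true
  | _ => false

/-- Is it a field element? -/
def isAtom : TreeData F → Bool
  | atom _ => true
  | _ => false

/-- Are both arguments field elements, and equal? -/
def sameAtom [DecidableEq F] : TreeData F → TreeData F → Bool
  | atom a, atom b => decide (a = b)
  | _, _ => false

/-- A list as a right-nested chain of pairs. -/
def ofList : List (TreeData F) → TreeData F
  | [] => nil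
  | d :: l => pair d (ofList l)

/-- The number `n` in unary. -/
def encNat (n : ℕ) : TreeData F := ofList (List.replicate n nil)

/-- A vector as the list of its entries. -/
def encVec {n : ℕ} (v : Fin n → F) : TreeData F := ofList (List.ofFn fun i => atom (v i))

/-- A matrix as the list of its rows. -/
def encMat {n : ℕ} (A : Matrix (Fin n) (Fin n) F) : TreeData F :=
  ofList (List.ofFn fun i => encVec (A i))

end TreeData

/-- Expressions over the program variables `X₀, X₁, …`. -/
inductive TreeExpr (F : Type*) where
  | var (x : ℕ) : TreeExpr F
  | nil : TreeExpr F
  | const (a : F) : TreeExpr F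
  | cons (e₁ e₂ : TreeExpr F) : TreeExpr F
  | hd (e : TreeExpr F) : TreeExpr F
  | tl (e : TreeExpr F) : TreeExpr F
  | isPair (e : TreeExpr F) : TreeExpr F
  | isAtom (e : TreeExpr F) : TreeExpr F
  | eq (e₁ e₂ : TreeExpr F) : TreeExpr F
  | add (e₁ e₂ : TreeExpr F) : TreeExpr F
  | sub (e₁ e₂ : TreeExpr F) : TreeExpr F
  | mul (e₁ e₂ : TreeExpr F) : TreeExpr F
  | inv (e : TreeExpr F) : TreeExpr F

/-- Contents of the variables. -/
abbrev TreeStore (F : Type*) := ℕ → TreeData F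

namespace TreeExpr

variable {F : Type*}

/-- Value of an expression. -/
def eval [Field F] [DecidableEq F] (s : TreeStore F) : TreeExpr F → TreeData F
  | var x => s x
  | nil => .nil
  | const a => .atom a
  | cons e₁ e₂ => .pair (e₁.eval s) (e₂.eval s)
  | hd e => (e.eval s).hd
  | tl e => (e.eval s).tl
  | isPair e => .ofBool (e.eval s).isPair
  | isAtom e => .ofBool (e.eval s).isAtom
  | eq e₁ e₂ => .ofBool ((e₁.eval s).sameAtom (e₂.eval s))
  | add e₁ e₂ => .atom ((e₁.eval s).val + (e₂.eval s).val)
  | sub e₁ e₂ => .atom ((e₁.eval s).val - (e₂.eval s).val)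
  | mul e₁ e₂ => .atom ((e₁.eval s).val * (e₂.eval s).val)
  | inv e => .atom ((e.eval s).val)⁻¹

/-- Number of steps needed to evaluate an expression: the number of its nodes. -/
def cost : TreeExpr F → ℕ
  | var _ => 1
  | nil => 1
  | const _ => 1
  | cons e₁ e₂ => e₁.cost + e₂.cost + 1
  | hd e => e.cost + 1
  | tl e => e.cost + 1
  | isPair e => e.cost + 1
  | isAtom e => e.cost + 1
  | eq e₁ e₂ => e₁.cost + e₂.cost + 1
  | add e₁ e₂ => e₁.cost + e₂.cost + 1
  | sub e₁ e₂ => e₁.cost + e₂.cost + 1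
  | mul e₁ e₂ => e₁.cost + e₂.cost + 1
  | inv e => e.cost + 1

end TreeExpr

/-- Programs. -/
inductive TreeProg (F : Type*) where
  | assign (x : ℕ) (e : TreeExpr F) : TreeProg F
  /-- store a fair coin flip -/
  | flip (x : ℕ) : TreeProg F
  /-- store a uniform element of `F` -/
  | rand (x : ℕ) : TreeProg F
  | seq (c₁ c₂ : TreeProg F) : TreeProg F
  | ite (e : TreeExpr F) (c₁ c₂ : TreeProg F) : TreeProg F
  | loop (e : TreeExpr F) (c : TreeProg F) : TreeProg F

namespace TreeProg

variable {F : Type*} [Field F] [Fintype F] [DecidableEq F]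

/-- `Runs c s t μ`: started with the variable contents `s`, the program `c` halts within `t` steps,
whatever the outcomes of its coins, and `μ` is the distribution of the final variable contents. -/
inductive Runs : TreeProg F → TreeStore F → ℕ → PMF (TreeStore F) → Prop
  | assign {x : ℕ} {e : TreeExpr F} {s : TreeStore F} {t : ℕ} (ht : e.cost + 1 ≤ t) :
      Runs (assign x e) s t (PMF.pure (Function.update s x (e.eval s)))
  | flip {x : ℕ} {s : TreeStore F} {t : ℕ} (ht : 1 ≤ t) :
      Runs (flip x) s t
        ((PMF.uniformOfFintype Bool).map fun b => Function.update s x (.ofBool b))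
  | rand {x : ℕ} {s : TreeStore F} {t : ℕ} (ht : 1 ≤ t) :
      Runs (rand x) s t
        ((PMF.uniformOfFintype F).map fun a => Function.update s x (.atom a))
  | seq {c₁ c₂ : TreeProg F} {s : TreeStore F} {t t₁ t₂ : ℕ} {μ : PMF (TreeStore F)}
      {ν : TreeStore F → PMF (TreeStore F)} (h₁ : Runs c₁ s t₁ μ)
      (h₂ : ∀ s' ∈ μ.support, Runs c₂ s' t₂ (ν s')) (ht : t₁ + t₂ ≤ t) :
      Runs (seq c₁ c₂) s t (μ.bind ν)
  | ite_true {e : TreeExpr F} {c₁ c₂ : TreeProg F} {s : TreeStore F} {t t₁ : ℕ}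
      {μ : PMF (TreeStore F)} (he : (e.eval s).IsTrue) (h : Runs c₁ s t₁ μ)
      (ht : e.cost + t₁ + 1 ≤ t) : Runs (ite e c₁ c₂) s t μ
  | ite_false {e : TreeExpr F} {c₁ c₂ : TreeProg F} {s : TreeStore F} {t t₁ : ℕ}
      {μ : PMF (TreeStore F)} (he : ¬ (e.eval s).IsTrue) (h : Runs c₂ s t₁ μ)
      (ht : e.cost + t₁ + 1 ≤ t) : Runs (ite e c₁ c₂) s t μ
  | loop_true {e : TreeExpr F} {c : TreeProg F} {s : TreeStore F} {t t₁ t₂ : ℕ}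
      {μ : PMF (TreeStore F)} {ν : TreeStore F → PMF (TreeStore F)} (he : (e.eval s).IsTrue)
      (h₁ : Runs c s t₁ μ) (h₂ : ∀ s' ∈ μ.support, Runs (loop e c) s' t₂ (ν s'))
      (ht : e.cost + t₁ + t₂ + 1 ≤ t) : Runs (loop e c) s t (μ.bind ν)
  | loop_false {e : TreeExpr F} {c : TreeProg F} {s : TreeStore F} {t : ℕ}
      (he : ¬ (e.eval s).IsTrue) (ht : e.cost + 1 ≤ t) : Runs (loop e c) s t (PMF.pure s)

/-- The distribution of the final contents is determined by the program and its input. -/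
theorem Runs.unique {c : TreeProg F} {s : TreeStore F} {t : ℕ} {μ : PMF (TreeStore F)}
    (h : Runs c s t μ) : ∀ {t' : ℕ} {μ' : PMF (TreeStore F)}, Runs c s t' μ' → μ = μ' := by
  have key : ∀ (μ : PMF (TreeStore F)) {f g : TreeStore F → PMF (TreeStore F)},
      (∀ a ∈ μ.support, f a = g a) → μ.bind f = μ.bind g := by
    intro μ f g hfg
    ext b
    simp only [PMF.bind_apply]
    refine tsum_congr fun a => ?_
    by_cases ha : μ a = 0
    · simp [ha]
    · rw [hfg a ha]
  induction h with
  | assign => intro _ _ h'; cases h'; rfl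
  | flip => intro _ _ h'; cases h'; rfl
  | rand => intro _ _ h'; cases h'; rfl
  | seq h₁ h₂ ht ih₁ ih₂ =>
    intro _ _ h'
    cases h' with
    | seq k₁ k₂ _ =>
      cases ih₁ k₁
      exact key _ fun a ha => ih₂ a ha (k₂ a ha)
  | ite_true he h ht ih =>
    intro _ _ h'
    cases h' with
    | ite_true _ k _ => exact ih k
    | ite_false k _ _ => exact absurd he k
  | ite_false he h ht ih =>
    intro _ _ h'
    cases h' with
    | ite_true k _ _ => exact absurd k he
    | ite_false _ k _ => exact ih k
  | loop_true he h₁ h₂ ht ih₁ ih₂ =>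
    intro _ _ h'
    cases h' with
    | loop_true _ k₁ k₂ _ =>
      cases ih₁ k₁
      exact key _ fun a ha => ih₂ a ha (k₂ a ha)
    | loop_false k _ => exact absurd he k
  | loop_false he ht =>
    intro _ _ h'
    cases h' with
    | loop_true k _ _ _ => exact absurd k he
    | loop_false => rfl

/-- The input is put into `X₀`; all other variables start as `nil`. -/
def initStore (d : TreeData F) : TreeStore F := fun x => if x = 0 then d else .nil

/-- `RunsOn c d t μ`: on input `d` the program `c` always halts within `t` steps, and `μ` is the
distribution of its output (the final content of `X₀`). -/
def RunsOn (c : TreeProg F) (d : TreeData F) (t : ℕ) (μ : PMF (TreeData F)) : Prop :=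
  ∃ ν : PMF (TreeStore F), Runs c (initStore d) t ν ∧ μ = ν.map fun s => s 0

end TreeProg

/-! ### Asymptotics and probabilities -/

/-- `f = Õ(g)`: up to constants and powers of `log n`, `f n` is at most `g n` for all large `n`. -/
def SoftO (f g : ℕ → ℕ) : Prop :=
  ∃ C k : ℕ, ∀ᶠ n in atTop, f n ≤ C * g n * Nat.log 2 n ^ k

/-- Polynomially bounded. -/
def PolyBounded (f : ℕ → ℕ) : Prop := ∃ C k : ℕ, ∀ n, f n ≤ C * n ^ k + C

/-- Probability of an event. -/
noncomputable def prob {α : Type*} (μ : PMF α) (S : Set α) : ℝ := (μ.toOuterMeasure S).toReal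

/-! ### Trapdoored matrices -/

/-- A family of trapdoored square matrices over `F` with multiplication from both sides: for every
`n` a distribution over pairs of a matrix `M` and a trapdoor (the description of circuits for `M`),
sampled by the program `sample` on input `1ⁿ`; from the trapdoor alone, the program `mulVec`
computes `v ↦ M v` and the program `vecMul` computes `v ↦ vᵀ M`, correctly for every pair that can
be sampled and for every vector. -/
structure TrapdooredFamily (F : Type*) [Field F] [Fintype F] [DecidableEq F] where
  dist : (n : ℕ) → PMF (Matrix (Fin n) (Fin n) F × TreeData F)
  sample : TreeProg F
  mulVec : TreeProg F
  vecMul : TreeProg F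
  sampleTime : ℕ → ℕ
  mulTime : ℕ → ℕ
  sample_runs : ∀ n, sample.RunsOn (.encNat n) (sampleTime n)
    ((dist n).map fun z => .pair (.encMat z.1) z.2)
  mulVec_runs : ∀ n, ∀ z ∈ (dist n).support, ∀ v : Fin n → F,
    mulVec.RunsOn (.pair z.2 (.encVec v)) (mulTime n) (PMF.pure (.encVec (z.1 *ᵥ v)))
  vecMul_runs : ∀ n, ∀ z ∈ (dist n).support, ∀ v : Fin n → F,
    vecMul.RunsOn (.pair z.2 (.encVec v)) (mulTime n) (PMF.pure (.encVec (v ᵥ* z.1)))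

namespace TrapdooredFamily

variable {F : Type*} [Field F] [Fintype F] [DecidableEq F]

/-- Sampling takes time nearly linear in the number `n²` of entries of the matrix. -/
def EfficientlySamplable (D : TrapdooredFamily F) : Prop := SoftO D.sampleTime fun n => n ^ 2

/-- Given the trapdoor, multiplication by a vector (from either side) takes nearly linear time. -/
def EfficientMul (D : TrapdooredFamily F) : Prop := SoftO D.mulTime fun n => n

/-- No probabilistic polynomial-time algorithm `P`, even with advice `z n` of polynomial size,
distinguishes the matrices of the family from uniformly random matrices: its advantage vanishes
faster than every inverse polynomial. -/
def Indistinguishable (D : TrapdooredFamily F) : Prop :=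
  ∀ (P : TreeProg F) (z : ℕ → TreeData F) (t : ℕ → ℕ)
    (out : (n : ℕ) → Matrix (Fin n) (Fin n) F → PMF (TreeData F)),
    PolyBounded (fun n => (z n).size) → PolyBounded t →
    (∀ n X, P.RunsOn (.pair (z n) (.encMat X)) (t n) (out n X)) →
    SuperpolynomialDecay atTop (fun n : ℕ => (n : ℝ)) fun n =>
      |prob ((PMF.uniformOfFintype (Matrix (Fin n) (Fin n) F)).bind (out n)) {.atom 1}
        - prob ((D.dist n).bind fun z => out n z.1) {.atom 1}|

end TrapdooredFamily

/-! ### Linear systems -/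

/-- For uniform `A ∈ GLₙ(F)` and uniform `b ∈ Fⁿ`, the probability (also over the coins of the
algorithm with output distributions `out`) that the output is a vector `x` with `A x = b`. -/
noncomputable def averageSuccess {F : Type*} [Field F] [Fintype F] [DecidableEq F] {n : ℕ}
    (out : Matrix (Fin n) (Fin n) F → (Fin n → F) → PMF (TreeData F)) : ℝ :=
  prob
    ((PMF.uniformOfFintype (Matrix.GeneralLinearGroup (Fin n) F × (Fin n → F))).bind fun z =>
      (out z.1.1 z.2).map fun d => (z, d))
    {w | ∃ x : Fin n → F, w.2 = .encVec x ∧ w.1.1.1 *ᵥ x = w.1.2}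

/-! ### Distributions -/

/-! The reduction hides a worst-case system behind a random one. Let A be invertible, X a matrix, y
a vector, and Y = A X. If Y x' = b + A y, then X x' - y solves the system with matrix A and
right-hand side b. The map (X, y) ↦ (A X, b + A y) is a bijection, so for uniform X and y the given
algorithm sees a uniform system. A uniform matrix is invertible with probability at least 1/4
(`quarter_le_card_GL_div`), hence one attempt succeeds with probability at least ε/4
(`le_core_uniform`).

Forming A X for a uniform X is a full matrix product. If X comes from the trapdoored family instead,
each row of A is multiplied by X through the trapdoor in nearly linear time. Sampling, the products,
the multiplication by X and the check of the answer then take Õ(n²) steps besides the run of the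
algorithm. The success probability cannot drop by a constant for infinitely many n: otherwise the
experiment "attempt to solve (A, b) with this X" would distinguish the family from uniform matrices.
Taking as advice the pair (A, b) on which the attempt does worst makes the bound hold for every pair
at once (`eventually_le_core`).

The distinguisher must be polynomial, whereas T need not be. Therefore the algorithm runs under a
clock that allows (n + 1)³ - 1 rounds of loops in total. A clocked program is polynomial whatever it
does (`clocked_runs_poly`). It also follows the original with constant slowdown, and by a coupling
argument it can run out of time only if T(n) + 1 ≥ (n + 1)³ (`clocked_runs`). A timeout is counted
as success: in that case Gaussian elimination fits into the time bound and solves the system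
(`gauss_runs`, `trial_runs`).

All answers are verified, so failures are recognised. Repeating the attempt O(log n) times with
fresh randomness brings the failure probability below n^{-c} (`one_sub_le_prob_attempts`).

The machine model is concrete, so every ingredient has to be written as a program with a time bound:
procedure calls, folds over lists, vector arithmetic, elimination, the clock and the counter of the
repetitions. -/

theorem PMF.bind_congr_support {α β : Type*} (μ : PMF α) {f g : α → PMF β}
    (h : ∀ a ∈ μ.support, f a = g a) : μ.bind f = μ.bind g := by
  ext b
  simp only [PMF.bind_apply]
  refine tsum_congr fun a => ?_
  by_cases ha : μ a = 0
  · simp [ha]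
  · rw [h a ha]

/-! ### Variables of expressions and programs -/

namespace TreeExpr

variable {F : Type*}

/-- All variables of the expression have numbers below this bound. -/
def bd : TreeExpr F → ℕ
  | var x => x + 1
  | nil => 0
  | const _ => 0
  | cons e₁ e₂ => max e₁.bd e₂.bd
  | hd e => e.bd
  | tl e => e.bd
  | isPair e => e.bd
  | isAtom e => e.bd
  | eq e₁ e₂ => max e₁.bd e₂.bd
  | add e₁ e₂ => max e₁.bd e₂.bd
  | sub e₁ e₂ => max e₁.bd e₂.bd
  | mul e₁ e₂ => max e₁.bd e₂.bd
  | inv e => e.bd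

/-- Increase the numbers of all variables by `k`. -/
def shift (k : ℕ) : TreeExpr F → TreeExpr F
  | var x => var (k + x)
  | nil => nil
  | const a => const a
  | cons e₁ e₂ => cons (e₁.shift k) (e₂.shift k)
  | hd e => hd (e.shift k)
  | tl e => tl (e.shift k)
  | isPair e => isPair (e.shift k)
  | isAtom e => isAtom (e.shift k)
  | eq e₁ e₂ => eq (e₁.shift k) (e₂.shift k)
  | add e₁ e₂ => add (e₁.shift k) (e₂.shift k)
  | sub e₁ e₂ => sub (e₁.shift k) (e₂.shift k)
  | mul e₁ e₂ => mul (e₁.shift k) (e₂.shift k)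
  | inv e => inv (e.shift k)

theorem cost_shift (k : ℕ) (e : TreeExpr F) : (e.shift k).cost = e.cost := by
  induction e <;> simp_all [shift, cost]

variable [Field F] [DecidableEq F]

theorem eval_shift (k : ℕ) (s : TreeStore F) (e : TreeExpr F) :
    (e.shift k).eval s = e.eval fun x => s (k + x) := by
  induction e <;> simp_all [shift, eval]

theorem eval_congr {s s' : TreeStore F} (e : TreeExpr F) (h : ∀ x < e.bd, s x = s' x) :
    e.eval s = e.eval s' := by
  induction e with
  | var x => exact h x (Nat.lt_succ_self x)
  | nil => rfl
  | const a => rfl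
  | hd e ih => simp only [eval, ih h]
  | tl e ih => simp only [eval, ih h]
  | isPair e ih => simp only [eval, ih h]
  | isAtom e ih => simp only [eval, ih h]
  | inv e ih => simp only [eval, ih h]
  | cons e₁ e₂ ih₁ ih₂ | eq e₁ e₂ ih₁ ih₂ | add e₁ e₂ ih₁ ih₂ | sub e₁ e₂ ih₁ ih₂
  | mul e₁ e₂ ih₁ ih₂ =>
    simp only [eval, ih₁ fun x hx => h x (lt_max_of_lt_left hx),
      ih₂ fun x hx => h x (lt_max_of_lt_right hx)]

end TreeExpr

namespace TreeProg

variable {F : Type*}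

/-- All variables of the program have numbers below this bound. -/
def bd : TreeProg F → ℕ
  | assign x e => max (x + 1) e.bd
  | flip x => x + 1
  | rand x => x + 1
  | seq c₁ c₂ => max c₁.bd c₂.bd
  | ite e c₁ c₂ => max e.bd (max c₁.bd c₂.bd)
  | loop e c => max e.bd c.bd

/-- Increase the numbers of all variables by `k`. -/
def shift (k : ℕ) : TreeProg F → TreeProg F
  | assign x e => assign (k + x) (e.shift k)
  | flip x => flip (k + x)
  | rand x => rand (k + x)
  | seq c₁ c₂ => seq (c₁.shift k) (c₂.shift k)
  | ite e c₁ c₂ => ite (e.shift k) (c₁.shift k) (c₂.shift k)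
  | loop e c => loop (e.shift k) (c.shift k)

variable [Field F] [Fintype F] [DecidableEq F]

/-! ### Determinism, sequencing and framing of runs -/

theorem Runs.mono {c : TreeProg F} {s : TreeStore F} {t t' : ℕ} {μ : PMF (TreeStore F)}
    (h : Runs c s t μ) (htt : t ≤ t') : Runs c s t' μ := by
  cases h with
  | assign ht => exact .assign (ht.trans htt)
  | flip ht => exact .flip (ht.trans htt)
  | rand ht => exact .rand (ht.trans htt)
  | seq h₁ h₂ ht => exact .seq h₁ h₂ (ht.trans htt)
  | ite_true he h ht => exact .ite_true he h (ht.trans htt)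
  | ite_false he h ht => exact .ite_false he h (ht.trans htt)
  | loop_true he h₁ h₂ ht => exact .loop_true he h₁ h₂ (ht.trans htt)
  | loop_false he ht => exact .loop_false he (ht.trans htt)

theorem Runs.of_eq {c : TreeProg F} {s : TreeStore F} {t : ℕ} {μ μ' : PMF (TreeStore F)}
    (h : Runs c s t μ) (e : μ = μ') : Runs c s t μ' := e ▸ h

theorem Runs.one_le {c : TreeProg F} {s : TreeStore F} {t : ℕ} {μ : PMF (TreeStore F)}
    (h : Runs c s t μ) : 1 ≤ t := by
  induction h with
  | seq h₁ h₂ ht ih₁ ih₂ => omega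
  | _ => omega

/-- The distribution of the final contents of the variables, as a function of the initial ones. -/
noncomputable def store (c : TreeProg F) (s : TreeStore F) : PMF (TreeStore F) :=
  open Classical in if h : ∃ μ, ∃ t, Runs c s t μ then h.choose else PMF.pure s

theorem Runs.eq_store {c : TreeProg F} {s : TreeStore F} {t : ℕ} {μ : PMF (TreeStore F)}
    (h : Runs c s t μ) : c.store s = μ := by
  have hex : ∃ μ, ∃ t, Runs c s t μ := ⟨μ, t, h⟩
  rw [store, dif_pos hex]
  obtain ⟨t', h'⟩ := hex.choose_spec
  exact h'.unique h

theorem Runs.run_store {c : TreeProg F} {s : TreeStore F} {t : ℕ} {μ : PMF (TreeStore F)}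
    (h : Runs c s t μ) : Runs c s t (c.store s) := by rwa [h.eq_store]

/-- The rule for `seq` wants a continuation defined on stores, while it is natural to index it by
the random outcome `a`. As `f` need not be injective, `c₂.store` serves as continuation; by
uniqueness of the final distribution it agrees with `ν a` at `f a`. -/
theorem Runs.seq_map {α : Type*} {c₁ c₂ : TreeProg F} {s : TreeStore F} {t₁ t₂ : ℕ} {μ : PMF α}
    {f : α → TreeStore F} {ν : α → PMF (TreeStore F)} (h₁ : Runs c₁ s t₁ (μ.map f))
    (h₂ : ∀ a ∈ μ.support, Runs c₂ (f a) t₂ (ν a)) :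
    Runs (.seq c₁ c₂) s (t₁ + t₂) (μ.bind ν) := by
  refine (Runs.seq (ν := c₂.store) h₁ (fun s' hs' => ?_) le_rfl).of_eq ?_
  · obtain ⟨a, ha, rfl⟩ := (PMF.mem_support_map_iff _ _ _).1 hs'
    exact (h₂ a ha).run_store
  · rw [PMF.bind_map]
    exact PMF.bind_congr_support _ fun a ha => (h₂ a ha).eq_store

theorem Runs.seq_pure {c₁ c₂ : TreeProg F} {s s' : TreeStore F} {t₁ t₂ : ℕ}
    {ν : PMF (TreeStore F)} (h₁ : Runs c₁ s t₁ (PMF.pure s')) (h₂ : Runs c₂ s' t₂ ν) :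
    Runs (.seq c₁ c₂) s (t₁ + t₂) ν := by
  refine (Runs.seq (ν := fun _ => ν) h₁ (fun a ha => ?_) le_rfl).of_eq (PMF.pure_bind _ _)
  rw [PMF.support_pure, Set.mem_singleton_iff] at ha
  rwa [ha]

theorem Runs.loop_map {α : Type*} {e : TreeExpr F} {c : TreeProg F} {s : TreeStore F} {t₁ t₂ : ℕ}
    {μ : PMF α} {f : α → TreeStore F} {ν : α → PMF (TreeStore F)} (he : (e.eval s).IsTrue)
    (h₁ : Runs c s t₁ (μ.map f)) (h₂ : ∀ a ∈ μ.support, Runs (.loop e c) (f a) t₂ (ν a)) :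
    Runs (.loop e c) s (e.cost + t₁ + t₂ + 1) (μ.bind ν) := by
  refine (Runs.loop_true (ν := (loop e c).store) he h₁ (fun s' hs' => ?_) le_rfl).of_eq ?_
  · obtain ⟨a, ha, rfl⟩ := (PMF.mem_support_map_iff _ _ _).1 hs'
    exact (h₂ a ha).run_store
  · rw [PMF.bind_map]
    exact PMF.bind_congr_support _ fun a ha => (h₂ a ha).eq_store

/-- Variables that do not occur in the program keep their values. -/
theorem Runs.frame {c : TreeProg F} {s : TreeStore F} {t : ℕ} {μ : PMF (TreeStore F)}
    (h : Runs c s t μ) : ∀ a ∈ μ.support, ∀ x, c.bd ≤ x → a x = s x := by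
  induction h with
  | @assign x e s t ht =>
    intro a ha y hy
    rw [PMF.support_pure, Set.mem_singleton_iff] at ha
    subst ha
    have : x + 1 ≤ y := (le_max_left _ _).trans hy
    exact Function.update_of_ne (by omega) _ _
  | @flip x s t ht =>
    intro a ha y hy
    obtain ⟨b, -, rfl⟩ := (PMF.mem_support_map_iff _ _ _).1 ha
    have : x + 1 ≤ y := hy
    exact Function.update_of_ne (by omega) _ _
  | @rand x s t ht =>
    intro a ha y hy
    obtain ⟨b, -, rfl⟩ := (PMF.mem_support_map_iff _ _ _).1 ha
    have : x + 1 ≤ y := hy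
    exact Function.update_of_ne (by omega) _ _
  | seq h₁ h₂ ht ih₁ ih₂ =>
    intro a ha y hy
    obtain ⟨b, hb, hab⟩ := (PMF.mem_support_bind_iff _ _ _).1 ha
    rw [ih₂ b hb a hab y ((le_max_right _ _).trans hy),
      ih₁ b hb y ((le_max_left _ _).trans hy)]
  | ite_true he h ht ih =>
    intro a ha y hy
    exact ih a ha y ((le_max_left _ _).trans ((le_max_right _ _).trans hy))
  | ite_false he h ht ih =>
    intro a ha y hy
    exact ih a ha y ((le_max_right _ _).trans ((le_max_right _ _).trans hy))
  | loop_true he h₁ h₂ ht ih₁ ih₂ =>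
    intro a ha y hy
    obtain ⟨b, hb, hab⟩ := (PMF.mem_support_bind_iff _ _ _).1 ha
    rw [ih₂ b hb a hab y hy, ih₁ b hb y ((le_max_right _ _).trans hy)]
  | loop_false he ht =>
    intro a ha y hy
    rw [PMF.support_pure, Set.mem_singleton_iff] at ha
    rw [ha]

/-- The store `s` with the variables from `k` on replaced by the contents of `a`. -/
def graft (k : ℕ) (s a : TreeStore F) : TreeStore F := fun y => if y < k then s y else a (y - k)

omit [Field F] [Fintype F] [DecidableEq F] in
theorem graft_add (k : ℕ) (s a : TreeStore F) : (fun x => graft k s a (k + x)) = a := by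
  funext x
  simp [graft]

omit [Field F] [Fintype F] [DecidableEq F] in
theorem graft_graft (k : ℕ) (s a b : TreeStore F) : graft k (graft k s a) b = graft k s b := by
  funext y
  simp only [graft]
  split <;> simp_all

omit [Field F] [Fintype F] [DecidableEq F] in
theorem graft_self (k : ℕ) (s : TreeStore F) : graft k s (fun x => s (k + x)) = s := by
  funext y
  simp only [graft]
  split
  · rfl
  · congr 1; omega

omit [Field F] [Fintype F] [DecidableEq F] in
theorem graft_update (k : ℕ) (s a : TreeStore F) (x : ℕ) (v : TreeData F) :
    graft k s (Function.update a x v) = Function.update (graft k s a) (k + x) v := by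
  funext y
  simp only [graft, Function.update_apply]
  by_cases h : y < k
  · rw [if_pos h, if_pos h, if_neg (by omega)]
  · rw [if_neg h, if_neg h]
    by_cases h' : y = k + x
    · rw [if_pos h', if_pos (by omega)]
    · rw [if_neg h', if_neg (by omega)]

/-- The renamed program sees only the variables from `k` on, so it simulates the original there and
leaves the part below `k` alone. This gives procedures a private workspace. -/
theorem Runs.shift (k : ℕ) {c : TreeProg F} {s : TreeStore F} {t : ℕ} {μ : PMF (TreeStore F)}
    (h : Runs c s t μ) : ∀ s' : TreeStore F, (fun x => s' (k + x)) = s →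
      Runs (c.shift k) s' t (μ.map (graft k s')) := by
  induction h with
  | @assign x e s t ht =>
    rintro s' rfl
    refine (Runs.assign (by rwa [TreeExpr.cost_shift])).of_eq ?_
    rw [PMF.pure_map, graft_update, graft_self, TreeExpr.eval_shift]
  | @flip x s t ht =>
    rintro s' rfl
    refine (Runs.flip ht).of_eq ?_
    rw [PMF.map_comp]
    congr 1
    funext b
    simp only [Function.comp, graft_update, graft_self]
  | @rand x s t ht =>
    rintro s' rfl
    refine (Runs.rand ht).of_eq ?_
    rw [PMF.map_comp]
    congr 1
    funext b
    simp only [Function.comp, graft_update, graft_self]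
  | seq h₁ h₂ ht ih₁ ih₂ =>
    intro s' hs
    refine ((Runs.seq_map (ih₁ s' hs) fun a ha => ih₂ a ha _ (graft_add k s' a)).mono ht).of_eq ?_
    rw [PMF.map_bind]
    simp only [funext (graft_graft k s' _)]
  | @ite_true e c₁ c₂ s t t₁ μ he h ht ih =>
    rintro s' rfl
    exact Runs.ite_true (by rwa [TreeExpr.eval_shift]) (ih s' rfl) (by rwa [TreeExpr.cost_shift])
  | @ite_false e c₁ c₂ s t t₁ μ he h ht ih =>
    rintro s' rfl
    exact Runs.ite_false (by rwa [TreeExpr.eval_shift]) (ih s' rfl) (by rwa [TreeExpr.cost_shift])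
  | loop_true he h₁ h₂ ht ih₁ ih₂ =>
    rintro s' rfl
    refine ((Runs.loop_map (by rwa [TreeExpr.eval_shift]) (ih₁ s' rfl)
      fun a ha => ih₂ a ha _ (graft_add k s' a)).mono (by rwa [TreeExpr.cost_shift])).of_eq ?_
    rw [PMF.map_bind]
    simp only [funext (graft_graft k s' _)]
  | loop_false he ht =>
    rintro s' rfl
    refine (Runs.loop_false (by rwa [TreeExpr.eval_shift])
      (by rwa [TreeExpr.cost_shift])).of_eq ?_
    rw [PMF.pure_map, graft_self]

/-! ### Procedures -/

/-- Make the variables `k, …, k + N` empty. -/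
def clear (k : ℕ) : ℕ → TreeProg F
  | 0 => assign k .nil
  | N + 1 => seq (clear k N) (assign (k + N + 1) .nil)

theorem clear_runs (k N : ℕ) (s : TreeStore F) : Runs (clear k N) s (2 * (N + 1))
    (PMF.pure fun y => if k ≤ y ∧ y ≤ k + N then .nil else s y) := by
  induction N with
  | zero =>
    refine (Runs.assign le_rfl).of_eq ?_
    congr 1
    funext y
    simp only [Function.update_apply, TreeExpr.eval]
    congr 1
    exact propext (by omega)
  | succ N ih =>
    refine ((ih.seq_pure (Runs.assign le_rfl)).mono (by simp [TreeExpr.cost]; omega)).of_eq ?_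
    congr 1
    funext y
    simp only [Function.update_apply, TreeExpr.eval]
    by_cases h : y = k + N + 1
    · rw [if_pos h, if_pos (by omega)]
    · rw [if_neg h]
      congr 1
      exact propext (by omega)

/-- Run `c` as a procedure on the value of `e`, in variables from `k` on, and store its output
in the variable `dst`. -/
def call (c : TreeProg F) (k dst : ℕ) (e : TreeExpr F) : TreeProg F :=
  seq (assign k e) (seq (c.shift k) (seq (assign dst (.var k)) (clear k c.bd)))

/-- The workspace must be empty at the start because `RunsOn` speaks of `initStore`. Clearing it
afterwards restores this condition, so that calls can be repeated, in particular inside loops.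
Variables beyond the cleared block do not occur in `c` and stay empty by `Runs.frame`. -/
theorem call_runs {c : TreeProg F} {k dst : ℕ} {e : TreeExpr F} {s : TreeStore F} {t : ℕ}
    {μ : PMF (TreeData F)} (h : c.RunsOn (e.eval s) t μ) (hs : ∀ y, k ≤ y → s y = .nil)
    (hd : dst < k) :
    Runs (call c k dst e) s (t + (e.cost + 2 * c.bd + 5)) (μ.map (Function.update s dst)) := by
  obtain ⟨ν, hν, rfl⟩ := h
  have h1 : Runs (assign k e) s (e.cost + 1) _ := .assign le_rfl
  have h2 := hν.shift k (Function.update s k (e.eval s)) (by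
    funext x
    by_cases hx : x = 0
    · simp [hx, initStore]
    · rw [Function.update_of_ne (by omega), hs _ (by omega), initStore, if_neg hx])
  refine ((h1.seq_pure (h2.seq_map (t₂ := 2 + 2 * (c.bd + 1))
    (ν := fun a => PMF.pure (Function.update s dst (a 0))) fun a ha => ?_)).mono
      (by omega)).of_eq ?_
  · have h3 : Runs (assign dst (.var k)) (graft k (Function.update s k (e.eval s)) a) 2 _ :=
      .assign le_rfl
    refine (h3.seq_pure (clear_runs k c.bd _)).of_eq ?_
    congr 1
    funext y
    have hfr := hν.frame a ha
    simp only [Function.update_apply, TreeExpr.eval, graft]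
    by_cases h1 : k ≤ y ∧ y ≤ k + c.bd
    · rw [if_pos h1, if_neg (by omega), hs y h1.1]
    · rw [if_neg h1]
      by_cases h2 : y = dst
      · simp [h2]
      · rw [if_neg h2, if_neg h2]
        by_cases h3 : y < k
        · rw [if_pos h3, if_neg (by omega)]
        · rw [if_neg h3, hfr _ (by omega), initStore, if_neg (by omega), hs y (by omega)]
  · rw [PMF.map_comp]
    rfl

theorem RunsOn.mono {c : TreeProg F} {d : TreeData F} {t t' : ℕ} {μ : PMF (TreeData F)}
    (h : c.RunsOn d t μ) (htt : t ≤ t') : c.RunsOn d t' μ := by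
  obtain ⟨ν, hν, rfl⟩ := h
  exact ⟨ν, hν.mono htt, rfl⟩

theorem RunsOn.of_eq {c : TreeProg F} {d : TreeData F} {t : ℕ} {μ μ' : PMF (TreeData F)}
    (h : c.RunsOn d t μ) (e : μ = μ') : c.RunsOn d t μ' := e ▸ h

/-- The distribution of the output, as a function of the input. -/
noncomputable def output (c : TreeProg F) (d : TreeData F) : PMF (TreeData F) :=
  (c.store (initStore d)).map fun s => s 0

theorem RunsOn.eq_output {c : TreeProg F} {d : TreeData F} {t : ℕ} {μ : PMF (TreeData F)}
    (h : c.RunsOn d t μ) : c.output d = μ := by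
  obtain ⟨ν, hν, rfl⟩ := h
  rw [output, hν.eq_store]

theorem RunsOn.run_output {c : TreeProg F} {d : TreeData F} {t : ℕ} {μ : PMF (TreeData F)}
    (h : c.RunsOn d t μ) : c.RunsOn d t (c.output d) := by rwa [h.eq_output]

/-- The program that outputs the value of an expression in its input `X₀`. -/
def expr (e : TreeExpr F) : TreeProg F := assign 0 e

theorem expr_runs {e : TreeExpr F} {d d' : TreeData F} (he : e.eval (initStore d) = d') :
    (expr e).RunsOn d (e.cost + 1) (PMF.pure d') :=
  ⟨_, .assign le_rfl, by simp [PMF.pure_map, he]⟩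

theorem rand_runs (d : TreeData F) :
    (rand 0).RunsOn d 1 ((PMF.uniformOfFintype F).map TreeData.atom) :=
  ⟨_, .rand le_rfl, by simp [PMF.map_comp, Function.comp_def]⟩

omit [Field F] [Fintype F] [DecidableEq F] in
theorem update_initStore (d d' : TreeData F) :
    Function.update (initStore d) 0 d' = initStore d' := by
  funext y
  by_cases h : y = 0 <;> simp [initStore, h]

/-- First `c₁`, then `c₂`. -/
def comp (c₁ c₂ : TreeProg F) : TreeProg F :=
  seq (call c₁ 1 0 (.var 0)) (call c₂ 1 0 (.var 0))

/-- The additional cost of `comp`. -/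
def compK (c₁ c₂ : TreeProg F) : ℕ := 2 * c₁.bd + 2 * c₂.bd + 12

theorem comp_runs {c₁ c₂ : TreeProg F} {d : TreeData F} {t₁ t₂ : ℕ}
    {μ : PMF (TreeData F)} {ν : TreeData F → PMF (TreeData F)} (h₁ : c₁.RunsOn d t₁ μ)
    (h₂ : ∀ a ∈ μ.support, c₂.RunsOn a t₂ (ν a)) :
    (comp c₁ c₂).RunsOn d (t₁ + t₂ + compK c₁ c₂) (μ.bind ν) := by
  unfold compK
  have hnil : ∀ (d : TreeData F) y, 1 ≤ y → initStore d y = .nil := fun d y hy => by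
    simp [initStore, show y ≠ 0 by omega]
  have k₁ := call_runs (k := 1) (dst := 0) (e := .var 0) (s := initStore d) h₁ (hnil d) one_pos
  rw [funext (update_initStore d)] at k₁
  refine ⟨_, (k₁.seq_map fun a ha => call_runs (k := 1) (dst := 0) (e := .var 0)
    (s := initStore a) (h₂ a ha) (hnil a) one_pos).mono (by simp [TreeExpr.cost]; omega), ?_⟩
  rw [PMF.map_bind]
  congr 1
  funext a
  simp only [PMF.map_comp, Function.comp_def]
  exact (PMF.map_id _).symm

/-- Apply `c` to the value of `e` and put the result in front of the input. -/
def push (c : TreeProg F) (e : TreeExpr F) : TreeProg F :=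
  seq (call c 2 1 e) (assign 0 (.cons (.var 1) (.var 0)))

/-- The additional cost of `push`. -/
def pushK (c : TreeProg F) (e : TreeExpr F) : ℕ := e.cost + 2 * c.bd + 9

theorem push_runs {c : TreeProg F} {e : TreeExpr F} {d d' : TreeData F} {t : ℕ}
    {μ : PMF (TreeData F)} (he : e.eval (initStore d) = d') (h : c.RunsOn d' t μ) :
    (push c e).RunsOn d (t + pushK c e) (μ.map fun r => .pair r d) := by
  subst he
  unfold pushK
  have k₁ := call_runs (k := 2) (dst := 1) h (fun y hy => by
    simp [initStore, show y ≠ 0 by omega]) (by omega)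
  refine ⟨_, (k₁.seq_map fun a ha => Runs.assign le_rfl).mono (by simp [TreeExpr.cost]; omega), ?_⟩
  rw [PMF.map_bind]
  simp [PMF.pure_map, TreeExpr.eval, initStore]
  rfl

/-- Case distinction. -/
def cond (e : TreeExpr F) (c₁ c₂ : TreeProg F) : TreeProg F := ite e c₁ c₂

theorem cond_true {e : TreeExpr F} {c₁ : TreeProg F} (c₂ : TreeProg F) {d : TreeData F} {t : ℕ}
    {μ : PMF (TreeData F)} (he : e.eval (initStore d) ≠ .nil) (h : c₁.RunsOn d t μ) :
    (cond e c₁ c₂).RunsOn d (t + e.cost + 1) μ := by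
  obtain ⟨ν, hν, rfl⟩ := h
  exact ⟨ν, .ite_true he hν (by omega), rfl⟩

theorem cond_false {e : TreeExpr F} (c₁ : TreeProg F) {c₂ : TreeProg F} {d : TreeData F} {t : ℕ}
    {μ : PMF (TreeData F)} (he : e.eval (initStore d) = .nil) (h : c₂.RunsOn d t μ) :
    (cond e c₁ c₂).RunsOn d (t + e.cost + 1) μ := by
  obtain ⟨ν, hν, rfl⟩ := h
  exact ⟨ν, .ite_false (by simp [TreeData.IsTrue, he]) hν (by omega), rfl⟩

/-- Left fold of a random function. -/
noncomputable def foldDist (f : TreeData F → TreeData F → PMF (TreeData F)) :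
    TreeData F → List (TreeData F) → PMF (TreeData F)
  | acc, [] => PMF.pure acc
  | acc, e :: l => (f acc e).bind fun a => foldDist f a l

/-- On the input `(acc, l)`: for every element `e` of the list `l`, replace `acc` by the output
of `c` on `(acc, e)`. -/
def fold (c : TreeProg F) : TreeProg F :=
  seq (assign 1 (.tl (.var 0))) (seq (assign 0 (.hd (.var 0)))
    (loop (.var 1) (seq (call c 2 0 (.cons (.var 0) (.hd (.var 1)))) (assign 1 (.tl (.var 1))))))

/-- The additional cost of `fold`, and of each round. -/
def foldK (c : TreeProg F) : ℕ := 2 * c.bd + 20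

/-- The invariant `I` links the remaining list to the accumulator, so the body has to be analysed
only on inputs that can occur. A single time bound `t` serves all rounds. -/
theorem fold_runs {c : TreeProg F} {f : TreeData F → TreeData F → PMF (TreeData F)}
    {t : ℕ} (I : List (TreeData F) → TreeData F → Prop)
    (hI : ∀ e l acc, I (e :: l) acc → c.RunsOn (.pair acc e) t (f acc e) ∧
      ∀ a ∈ (f acc e).support, I l a) (l : List (TreeData F)) (acc : TreeData F) (h : I l acc) :
    (fold c).RunsOn (.pair acc (.ofList l)) (l.length * (t + foldK c) + foldK c)
      (foldDist f acc l) := by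
  unfold foldK
  let st : TreeData F → TreeData F → TreeStore F :=
    fun a b y => if y = 0 then a else if y = 1 then b else .nil
  have hst0 : ∀ a b v, Function.update (st a b) 0 v = st v b := fun a b v => by
    funext y
    by_cases hy : y = 0 <;> simp [st, hy]
  have hst1 : ∀ a b v, Function.update (st a b) 1 v = st a v := fun a b v => by
    funext y
    by_cases hy : y = 1
    · simp [st, hy]
    · simp [st, hy]
  have key : ∀ l acc, I l acc → Runs (loop (.var 1) (seq (call c 2 0
      (.cons (.var 0) (.hd (.var 1)))) (assign 1 (.tl (.var 1))))) (st acc (.ofList l))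
      (l.length * (t + (2 * c.bd + 20)) + 2) ((foldDist f acc l).map fun a => st a .nil) := by
    intro l
    induction l with
    | nil =>
      intro acc h
      refine (Runs.loop_false ?_ ?_).of_eq ?_
      · simp [TreeExpr.eval, st, TreeData.ofList, TreeData.IsTrue]
      · simp [TreeExpr.cost]
      · simp [foldDist, PMF.pure_map, TreeData.ofList]
    | cons e l ih =>
      intro acc h
      obtain ⟨h1, h2⟩ := hI e l acc h
      have k₁ : Runs (call c 2 0 (.cons (.var 0) (.hd (.var 1)))) (st acc (.ofList (e :: l))) _ _ :=
        call_runs (k := 2) (dst := 0) (μ := f acc e) (t := t)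
        (by simpa [TreeExpr.eval, st, TreeData.ofList, TreeData.hd] using h1)
        (fun y hy => by simp [st, show y ≠ 0 by omega, show y ≠ 1 by omega]) (by omega)
      have k₂ := k₁.seq_map (t₂ := 3)
        (c₂ := assign 1 (.tl (.var 1))) (ν := fun a => PMF.pure (st a (.ofList l))) fun a ha =>
          (Runs.assign (by simp [TreeExpr.cost])).of_eq (by
            rw [hst0, hst1]
            simp [TreeExpr.eval, st, TreeData.ofList, TreeData.tl])
      refine ((Runs.loop_map (by simp [TreeExpr.eval, st, TreeData.ofList, TreeData.IsTrue])
        k₂ fun a ha => ih a (h2 a ha)).mono ?_).of_eq ?_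
      · simp [TreeExpr.cost]
        ring_nf
        omega
      · rw [foldDist, PMF.map_bind]
  have h1 : Runs (assign 1 (.tl (.var 0))) (initStore (.pair acc (.ofList l))) 3
      (PMF.pure (st (.pair acc (.ofList l)) (.ofList l))) :=
    (Runs.assign (by simp [TreeExpr.cost])).of_eq (by
      congr 1
      funext y
      by_cases hy : y = 1
      · simp [hy, st, TreeExpr.eval, initStore, TreeData.tl]
      · simp [hy, st, initStore])
  have h2 : Runs (assign 0 (.hd (.var 0))) (st (.pair acc (.ofList l)) (.ofList l)) 3
      (PMF.pure (st acc (.ofList l))) :=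
    (Runs.assign (by simp [TreeExpr.cost])).of_eq (by
      rw [hst0]
      simp [TreeExpr.eval, st, TreeData.hd])
  refine ⟨_, (h1.seq_pure (h2.seq_pure (key l acc h))).mono (by omega), ?_⟩
  simp only [PMF.map_comp, Function.comp_def, st, if_true]
  exact (PMF.map_id _).symm

end TreeProg

/-! ### Trees read as vectors, with default entry zero -/

namespace TreeData

variable {F : Type*}

@[simp] theorem hd_pair (a b : TreeData F) : (pair a b).hd = a := rfl

@[simp] theorem tl_pair (a b : TreeData F) : (pair a b).tl = b := rfl

theorem encVec_succ {n : ℕ} (v : Fin (n + 1) → F) :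
    encVec v = pair (atom (v 0)) (encVec fun i => v i.succ) := by
  simp [encVec, List.ofFn_succ, ofList]

variable [Field F]

@[simp] theorem val_atom (a : F) : (atom a).val = a := rfl

@[simp] theorem val_nil : (nil : TreeData F).val = 0 := rfl

/-- The `i`-th entry of a list of field elements (zero if there is none). -/
def get (i : ℕ) (d : TreeData F) : F := (tl^[i] d).hd.val

/-- A tree read as a vector. -/
def dec (n : ℕ) (d : TreeData F) : Fin n → F := fun i => d.get i

theorem get_zero (d : TreeData F) : d.get 0 = d.hd.val := rfl

theorem get_succ (i : ℕ) (d : TreeData F) : d.get (i + 1) = d.tl.get i := rfl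

theorem dec_encVec {n : ℕ} (v : Fin n → F) : dec n (encVec v) = v := by
  induction n with
  | zero => exact Subsingleton.elim _ _
  | succ n ih =>
    funext i
    refine Fin.cases ?_ (fun j => ?_) i
    · rw [encVec_succ]; rfl
    · rw [encVec_succ]
      exact congrFun (ih fun i => v i.succ) j

theorem get_nil (i : ℕ) : get i (nil : TreeData F) = 0 := by
  induction i with
  | zero => rfl
  | succ i ih => rwa [get_succ]

theorem dec_nil (n : ℕ) : dec n (nil : TreeData F) = 0 := funext fun i => get_nil i

end TreeData

/-! ### Bounds with unspecified constants -/

/-- These bounds are shaped so that constants are found by unification. In many running-time lemmas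
below the constant is left as a metavariable, and the nested term built from these lemmas along the
structure of the program determines it. -/
theorem Nat.le_const_mul {m : ℕ} (hm : 1 ≤ m) (a : ℕ) : a ≤ a * m := Nat.le_mul_of_pos_right a hm

theorem Nat.add_le_const_mul {m a b A B : ℕ} (ha : a ≤ A * m) (hb : b ≤ B * m) :
    a + b ≤ (A + B) * m := by
  rw [add_mul]
  exact add_le_add ha hb

theorem Nat.mul_le_const_mul {m k a b A B : ℕ} (ha : a ≤ A * m) (hb : b ≤ B * k) :
    a * b ≤ (A * B) * (m * k) := by
  rw [mul_mul_mul_comm]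
  exact Nat.mul_le_mul ha hb

theorem Nat.const_mul_le_const_mul {m a A : ℕ} (K : ℕ) (ha : a ≤ A * m) :
    K * a ≤ (K * A) * m := by
  rw [mul_assoc]
  exact Nat.mul_le_mul_left K ha

theorem Nat.mul_le_const_mul_left {m a A : ℕ} (k : ℕ) (ha : a ≤ A * m) :
    k * a ≤ A * (k * m) := by
  rw [mul_left_comm]
  exact Nat.mul_le_mul_left k ha

namespace TreeProg

open TreeData

variable {F : Type*} [Field F] [Fintype F] [DecidableEq F]

omit [Field F] [Fintype F] [DecidableEq F] in
@[simp] theorem initStore_zero (d : TreeData F) : initStore d 0 = d := rfl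

attribute [simp] TreeExpr.eval

/-! ### Combinators for deterministic programs -/

theorem comp_pure {c₁ c₂ : TreeProg F} {d d' : TreeData F} {t₁ t₂ : ℕ}
    {ν : PMF (TreeData F)} (h₁ : c₁.RunsOn d t₁ (PMF.pure d')) (h₂ : c₂.RunsOn d' t₂ ν) :
    (comp c₁ c₂).RunsOn d (t₁ + t₂ + compK c₁ c₂) ν := by
  refine (comp_runs (ν := fun _ => ν) h₁ (t₂ := t₂) fun a ha => ?_).of_eq (PMF.pure_bind _ _)
  rw [PMF.support_pure, Set.mem_singleton_iff] at ha
  rwa [ha]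

/-- Run `c` on the value of `e`. -/
def pre (e : TreeExpr F) (c : TreeProg F) : TreeProg F := comp (expr e) c

/-- The additional cost of `pre`. -/
def preK (e : TreeExpr F) (c : TreeProg F) : ℕ := e.cost + 1 + compK (expr e) c

theorem pre_runs {e : TreeExpr F} {c : TreeProg F} {d d' : TreeData F} {t : ℕ}
    {μ : PMF (TreeData F)} (he : e.eval (initStore d) = d') (h : c.RunsOn d' t μ) :
    (pre e c).RunsOn d (t + preK e c) μ :=
  (comp_pure (expr_runs he) h).mono (by unfold preK; omega)

/-- Run `c` and output the value of `e` on its result. -/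
def post (c : TreeProg F) (e : TreeExpr F) : TreeProg F := comp c (expr e)

/-- The additional cost of `post`. -/
def postK (c : TreeProg F) (e : TreeExpr F) : ℕ := e.cost + 1 + compK c (expr e)

theorem post_runs {c : TreeProg F} {e : TreeExpr F} {d : TreeData F} {t : ℕ}
    {μ : PMF (TreeData F)} (h : c.RunsOn d t μ) :
    (post c e).RunsOn d (t + postK c e) (μ.map fun a => e.eval (initStore a)) :=
  ((comp_runs h fun _ _ => expr_runs rfl).mono (by unfold postK; omega)).of_eq rfl

theorem post_pure {c : TreeProg F} {e : TreeExpr F} {d d' d'' : TreeData F} {t : ℕ}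
    (h : c.RunsOn d t (PMF.pure d')) (he : e.eval (initStore d') = d'') :
    (post c e).RunsOn d (t + postK c e) (PMF.pure d'') :=
  (post_runs h).of_eq (by rw [PMF.pure_map, he])

/-- Apply `c` to the value of `e`, put the result in front of the input, and go on with `c'`. -/
def bnd (c : TreeProg F) (e : TreeExpr F) (c' : TreeProg F) : TreeProg F := comp (push c e) c'

/-- The additional cost of `bnd`. -/
def bndK (c : TreeProg F) (e : TreeExpr F) (c' : TreeProg F) : ℕ :=
  pushK c e + compK (push c e) c'

theorem bnd_runs {c : TreeProg F} {e : TreeExpr F} {c' : TreeProg F} {d d' : TreeData F}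
    {t₁ t₂ : ℕ} {μ : PMF (TreeData F)} {ν : TreeData F → PMF (TreeData F)}
    (he : e.eval (initStore d) = d') (h : c.RunsOn d' t₁ μ)
    (k : ∀ r ∈ μ.support, c'.RunsOn (.pair r d) t₂ (ν r)) :
    (bnd c e c').RunsOn d (t₁ + t₂ + bndK c e c') (μ.bind ν) := by
  refine ((comp_runs (push_runs he h) (t₂ := t₂) (ν := fun a => ν a.hd) fun a ha => ?_).mono
    (by unfold bndK; omega)).of_eq ?_
  · obtain ⟨r, hr, rfl⟩ := (PMF.mem_support_map_iff _ _ _).1 ha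
    exact k r hr
  · rw [PMF.bind_map]
    rfl

theorem bnd_pure {c : TreeProg F} {e : TreeExpr F} {c' : TreeProg F} {d d' r : TreeData F}
    {t₁ t₂ : ℕ} {ν : PMF (TreeData F)} (he : e.eval (initStore d) = d')
    (h₁ : c.RunsOn d' t₁ (PMF.pure r)) (h₂ : c'.RunsOn (.pair r d) t₂ ν) :
    (bnd c e c').RunsOn d (t₁ + t₂ + bndK c e c') ν := by
  refine (bnd_runs (ν := fun _ => ν) he h₁ (t₂ := t₂) fun a ha => ?_).of_eq (PMF.pure_bind _ _)
  rw [PMF.support_pure, Set.mem_singleton_iff] at ha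
  rwa [ha]

theorem fold_pure {c : TreeProg F} {f : TreeData F → TreeData F → TreeData F}
    {t : ℕ} (I : List (TreeData F) → TreeData F → Prop)
    (hI : ∀ e l acc, I (e :: l) acc →
      c.RunsOn (.pair acc e) t (PMF.pure (f acc e)) ∧ I l (f acc e))
    (l : List (TreeData F)) (acc : TreeData F) (h : I l acc) :
    (fold c).RunsOn (.pair acc (.ofList l)) (l.length * (t + foldK c) + foldK c)
      (PMF.pure (l.foldl f acc)) := by
  refine (fold_runs (f := fun a e => PMF.pure (f a e)) I (fun e l acc h => ⟨(hI e l acc h).1, ?_⟩)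
    l acc h).of_eq ?_
  · intro a ha
    rw [PMF.support_pure, Set.mem_singleton_iff] at ha
    rw [ha]
    exact (hI e l acc h).2
  · clear h
    induction l generalizing acc with
    | nil => rfl
    | cons e l ih => simp [foldDist, ih]

/-- The function computed by a fold with a body without calls. -/
def foldE (e : TreeExpr F) (l : List (TreeData F)) (acc : TreeData F) : TreeData F :=
  l.foldl (fun a x => e.eval (initStore (.pair a x))) acc

omit [Fintype F] in
@[simp] theorem foldE_nil (e : TreeExpr F) (acc : TreeData F) : foldE e [] acc = acc := rfl

omit [Fintype F] in
theorem foldE_cons (e : TreeExpr F) (x : TreeData F) (l : List (TreeData F)) (acc : TreeData F) :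
    foldE e (x :: l) acc = foldE e l (e.eval (initStore (.pair acc x))) := rfl

theorem fold_expr {e : TreeExpr F} {l : List (TreeData F)} {acc d : TreeData F}
    (hd : foldE e l acc = d) : (fold (expr e)).RunsOn (.pair acc (.ofList l))
      ((e.cost + 1 + foldK (expr e)) * (l.length + 1)) (PMF.pure d) :=
  ((fold_pure (c := expr e) (fun _ _ => True) (fun _ _ _ _ => ⟨expr_runs rfl, trivial⟩) l acc
    trivial).mono (by ring_nf; omega)).of_eq (by rw [← hd]; rfl)

/-! ### Lists and vectors -/

/-- Reverse a list. -/
def rev : TreeProg F :=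
  pre (.cons .nil (.var 0)) (fold (expr (.cons (.tl (.var 0)) (.hd (.var 0)))))

omit [Fintype F] in
theorem foldE_rev (l o : List (TreeData F)) :
    foldE (.cons (.tl (.var 0)) (.hd (.var 0))) l (.ofList o) = .ofList (l.reverse ++ o) := by
  induction l generalizing o with
  | nil => rfl
  | cons e l ih =>
    rw [foldE_cons]
    exact (ih (e :: o)).trans (by simp)

theorem rev_runs : ∃ K, ∀ l : List (TreeData F),
    rev.RunsOn (.ofList l) (K * (l.length + 1)) (PMF.pure (.ofList l.reverse)) := by
  refine ⟨?_, fun l => (pre_runs rfl (fold_expr ((foldE_rev l []).trans (by simp)))).mono ?_⟩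
  rotate_left
  exact Nat.add_le_const_mul le_rfl (Nat.le_const_mul (Nat.le_add_left _ _) _)

/-- On the input `(ctx, l)`: the list of the outputs of `p` on `(ctx, e)` for the elements `e`
of `l`. -/
def mapL (p : TreeProg F) : TreeProg F :=
  comp (pre (.cons (.cons (.hd (.var 0)) .nil) (.tl (.var 0)))
    (post (fold (bnd p (.cons (.hd (.hd (.var 0))) (.tl (.var 0)))
      (expr (.cons (.hd (.hd (.tl (.var 0)))) (.cons (.hd (.var 0)) (.tl (.hd (.tl (.var 0)))))))))
      (.tl (.var 0)))) rev

/-- The accumulator carries the context `ctx` along with the list of outputs. Since outputs are put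
in front, the list comes out reversed and a final `rev` is needed. -/
theorem mapL_runs (p : TreeProg F) : ∃ K, ∀ {ctx : TreeData F} {t : ℕ}
    {g : TreeData F → TreeData F} {l : List (TreeData F)},
    (∀ e ∈ l, p.RunsOn (.pair ctx e) t (PMF.pure (g e))) →
    (mapL p).RunsOn (.pair ctx (.ofList l)) (K * ((l.length + 1) * (t + 1)))
      (PMF.pure (.ofList (l.map g))) := by
  obtain ⟨K, hK⟩ := rev_runs (F := F)
  refine ⟨?_, fun {ctx t g l} h => ?_⟩
  rotate_left
  · let f : TreeData F → TreeData F → TreeData F := fun acc e => .pair ctx (.pair (g e) acc.tl)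
    have hfold : ∀ (l o : List (TreeData F)), l.foldl f (.pair ctx (.ofList o))
        = .pair ctx (.ofList ((l.map g).reverse ++ o)) := by
      intro l
      induction l with
      | nil => intro o; rfl
      | cons e l ih =>
        intro o
        exact (ih (g e :: o)).trans (by simp)
    have k := fold_pure (f := f) (c := bnd p (.cons (.hd (.hd (.var 0))) (.tl (.var 0)))
        (expr (.cons (.hd (.hd (.tl (.var 0)))) (.cons (.hd (.var 0)) (.tl (.hd (.tl (.var 0))))))))
      (fun l acc => acc.hd = ctx ∧ ∀ e ∈ l, p.RunsOn (.pair ctx e) t (PMF.pure (g e)))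
      (fun e l acc hacc => ⟨bnd_pure (d' := .pair ctx e) (by simp [hacc.1])
          (hacc.2 e (by simp)) (expr_runs (by simp [f, hacc.1])), rfl,
        fun e he => hacc.2 e (List.mem_cons_of_mem _ he)⟩) l
      (.pair ctx .nil) ⟨rfl, h⟩
    rw [show l.foldl f (.pair ctx .nil) = _ from hfold l []] at k
    refine ((comp_pure (pre_runs rfl (post_pure k rfl)) ((hK _).of_eq ?_)).mono ?_)
    · simp
    · have h1 : 1 ≤ l.length + 1 := by omega
      have h2 : 1 ≤ t + 1 := by omega
      have h3 : 1 ≤ (l.length + 1) * (t + 1) := Nat.mul_pos h1 h2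
      have h4 : l.length + 1 ≤ (l.length + 1) * (t + 1) := by nlinarith
      have h5 : l.length ≤ 1 * (l.length + 1) := by omega
      have h6 : t ≤ 1 * (t + 1) := by omega
      simp only [List.append_nil, List.length_reverse, List.length_map]
      exact Nat.add_le_const_mul (Nat.add_le_const_mul (Nat.add_le_const_mul
        (Nat.add_le_const_mul (Nat.add_le_const_mul (Nat.mul_le_const_mul h5
          (Nat.add_le_const_mul (Nat.add_le_const_mul (Nat.add_le_const_mul h6
            (Nat.le_const_mul h2 _)) (Nat.le_const_mul h2 _)) (Nat.le_const_mul h2 _)))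
          (Nat.le_const_mul h3 _)) (Nat.le_const_mul h3 _))
        (Nat.le_const_mul h3 _)) (Nat.mul_le_mul_left K h4))
        (Nat.le_const_mul h3 _)

/-- On the input `(r, v)`: the sum of the products of the entries of `r` and `v`. -/
def dot : TreeProg F :=
  pre (.cons (.cons (.tl (.var 0)) (.const 0)) (.hd (.var 0)))
    (post (fold (expr (.cons (.tl (.hd (.hd (.var 0)))) (.add (.tl (.hd (.var 0)))
      (.mul (.tl (.var 0)) (.hd (.hd (.hd (.var 0))))))))) (.tl (.var 0)))

/-- The fold runs over the proper vector `r` and consumes `v` one entry at a time. A list `v` that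
is too short contributes zeros, which permits the truncated unit vectors used in the elimination. -/
theorem dot_runs : ∃ K, ∀ {n : ℕ} (r : Fin n → F) (v : TreeData F),
    dot.RunsOn (.pair (encVec r) v) (K * (n + 1)) (PMF.pure (.atom (r ⬝ᵥ dec n v))) := by
  have key : ∀ (n : ℕ) (r : Fin n → F) (v : TreeData F) (s : F),
      ∃ v', foldE (.cons (.tl (.hd (.hd (.var 0)))) (.add (.tl (.hd (.var 0)))
      (.mul (.tl (.var 0)) (.hd (.hd (.hd (.var 0))))))) (List.ofFn fun i => atom (r i))
      (.pair v (.atom s)) = .pair v' (.atom (s + r ⬝ᵥ dec n v)) := by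
    intro n
    induction n with
    | zero => intro r v s; exact ⟨v, by simp [dotProduct]⟩
    | succ n ih =>
      intro r v s
      obtain ⟨v', h⟩ := ih (fun i => r i.succ) v.tl (s + r 0 * v.hd.val)
      refine ⟨v', ?_⟩
      rw [List.ofFn_succ, foldE_cons]
      refine Eq.trans ?_ (h.trans ?_)
      · simp
      · simp [dotProduct, Fin.sum_univ_succ, dec, get_succ, get_zero, add_assoc]
  refine ⟨?_, fun {n} r v => ?_⟩
  rotate_left
  · obtain ⟨v', h⟩ := key n r v 0
    refine (pre_runs rfl (post_pure (fold_expr h) (d'' := .atom (r ⬝ᵥ dec n v)) (by simp))).mono ?_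
    rw [List.length_ofFn]
    exact Nat.add_le_const_mul (Nat.add_le_const_mul le_rfl (Nat.le_const_mul (Nat.le_add_left _ _) _))
      (Nat.le_const_mul (Nat.le_add_left _ _) _)

/-- On the input `(c, (p, (v, sp)))`: the vector `v - c p` with as many entries as `sp`. -/
def axpy : TreeProg F :=
  comp (pre (.cons (.cons (.hd (.var 0)) (.cons (.hd (.tl (.var 0)))
      (.cons (.hd (.tl (.tl (.var 0)))) .nil))) (.tl (.tl (.tl (.var 0)))))
    (post (fold (expr (.cons (.hd (.hd (.var 0))) (.cons (.tl (.hd (.tl (.hd (.var 0)))))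
      (.cons (.tl (.hd (.tl (.tl (.hd (.var 0)))))) (.cons (.sub (.hd (.hd (.tl (.tl (.hd (.var 0))))))
        (.mul (.hd (.hd (.var 0))) (.hd (.hd (.tl (.hd (.var 0))))))) (.tl (.tl (.tl (.hd (.var 0)))))))))))
      (.tl (.tl (.tl (.var 0)))))) rev

/-- The list `sp` is only a template for the length: `p` and `v` may be shorter than `n`, but the
output is a full encoding with `n` entries. With `c = 0` or empty arguments this also pads a vector
or creates the zero vector. -/
theorem axpy_runs : ∃ K, ∀ {n : ℕ} (c p v : TreeData F) (sp : List (TreeData F)), sp.length = n →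
    axpy.RunsOn (.pair c (.pair p (.pair v (.ofList sp)))) (K * (n + 1))
      (PMF.pure (encVec (dec n v - c.val • dec n p))) := by
  obtain ⟨K, hK⟩ := rev_runs (F := F)
  have key : ∀ (sp : List (TreeData F)) (c p v : TreeData F) (o : List (TreeData F)),
      ∃ p' v', foldE (.cons (.hd (.hd (.var 0))) (.cons (.tl (.hd (.tl (.hd (.var 0)))))
      (.cons (.tl (.hd (.tl (.tl (.hd (.var 0)))))) (.cons (.sub (.hd (.hd (.tl (.tl (.hd (.var 0))))))
        (.mul (.hd (.hd (.var 0))) (.hd (.hd (.tl (.hd (.var 0)))))))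
        (.tl (.tl (.tl (.hd (.var 0))))))))) sp
        (.pair c (.pair p (.pair v (.ofList o)))) = .pair c (.pair p' (.pair v' (.ofList
          ((List.ofFn fun i : Fin sp.length => atom (v.get i - c.val * p.get i)).reverse ++ o)))) := by
    intro sp
    induction sp with
    | nil => intro c p v o; exact ⟨p, v, by simp⟩
    | cons e sp ih =>
      intro c p v o
      obtain ⟨p', v', h⟩ := ih c p.tl v.tl (atom (v.hd.val - c.val * p.hd.val) :: o)
      refine ⟨p', v', ?_⟩
      rw [foldE_cons]
      refine Eq.trans ?_ (h.trans ?_)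
      · simp [ofList]
      · simp [List.ofFn_succ, get_succ, get_zero]
  refine ⟨?_, fun {n} c p v sp hn => ?_⟩
  rotate_left
  · obtain ⟨p', v', h⟩ := key sp c p v []
    refine ((comp_pure (pre_runs rfl (post_pure (fold_expr h) rfl)) ((hK _).of_eq
      (μ' := PMF.pure (encVec (dec n v - c.val • dec n p))) ?_)).mono ?_)
    · subst hn
      simp [encVec, dec]
    · simp only [List.append_nil, List.length_reverse, List.length_ofFn, hn]
      exact Nat.add_le_const_mul (Nat.add_le_const_mul (Nat.add_le_const_mul (Nat.add_le_const_mul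
        le_rfl (Nat.le_const_mul (Nat.le_add_left _ _) _)) (Nat.le_const_mul (Nat.le_add_left _ _) _)) le_rfl)
        (Nat.le_const_mul (Nat.le_add_left _ _) _)

/-- The pair with its components exchanged. -/
def swapE : TreeExpr F := .cons (.tl (.var 0)) (.hd (.var 0))

/-- On the input `(A, v)`: the product of a matrix and a vector. -/
def matVec : TreeProg F := pre swapE (mapL (pre swapE dot))

theorem matVec_runs : ∃ K, ∀ {n : ℕ} (A : Matrix (Fin n) (Fin n) F) (v : TreeData F),
    matVec.RunsOn (.pair (encMat A) v) (K * (n + 1) ^ 2)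
      (PMF.pure (encVec (A *ᵥ dec n v))) := by
  obtain ⟨K₁, h₁⟩ := dot_runs (F := F)
  obtain ⟨K₂, h₂⟩ := mapL_runs (F := F) (pre swapE dot)
  refine ⟨?_, fun {n} A v => ?_⟩
  rotate_left
  · have k := h₂ (ctx := v) (g := fun e => .atom (dec n e ⬝ᵥ dec n v))
      (l := List.ofFn fun i => encVec (A i)) (t := K₁ * (n + 1) + preK swapE dot) (fun e he => by
        obtain ⟨i, rfl⟩ := List.mem_ofFn.1 he
        refine (pre_runs rfl (h₁ (A i) v)).of_eq ?_
        rw [dec_encVec])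
    refine ((pre_runs (d' := .pair v (encMat A)) rfl k).mono ?_).of_eq ?_
    · have h1 : 1 ≤ (n + 1) ^ 2 := Nat.one_le_pow _ _ (Nat.succ_pos n)
      have h2 : 1 ≤ n + 1 := Nat.le_add_left _ _
      rw [List.length_ofFn]
      rw [sq] at h1 ⊢
      exact Nat.add_le_const_mul (Nat.const_mul_le_const_mul K₂ (Nat.mul_le_const_mul_left _
        (Nat.add_le_const_mul (Nat.add_le_const_mul le_rfl
          (Nat.le_const_mul h2 _)) (Nat.le_const_mul h2 _)))) (Nat.le_const_mul h1 _)
    · simp only [List.map_ofFn, Function.comp_def, dec_encVec]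
      rfl

/-- On the input `(a, X)`: the product of a row vector and a matrix. -/
def vecMat : TreeProg F :=
  bnd axpy (.cons (.const 0) (.cons .nil (.cons .nil (.hd (.var 0)))))
    (pre (.cons (.cons (.hd (.tl (.var 0))) (.hd (.var 0))) (.tl (.tl (.var 0))))
      (post (fold (bnd axpy (.cons (.sub (.const 0) (.hd (.hd (.hd (.var 0)))))
        (.cons (.tl (.var 0)) (.cons (.tl (.hd (.var 0))) (.tl (.var 0)))))
        (expr (.cons (.tl (.hd (.hd (.tl (.var 0))))) (.hd (.var 0)))))) (.tl (.var 0))))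

/-- The product is the combination of the rows of `X` with the entries of `a` as coefficients. It is
accumulated by `axpy`, which subtracts, hence the negated coefficients; the zero vector at the start
comes from `axpy` on empty lists. -/
theorem vecMat_runs : ∃ K, ∀ {n : ℕ} (a : Fin n → F) (X : Matrix (Fin n) (Fin n) F),
    vecMat.RunsOn (.pair (encVec a) (encMat X)) (K * (n + 1) ^ 2)
      (PMF.pure (encVec (a ᵥ* X))) := by
  obtain ⟨K, hK⟩ := axpy_runs (F := F)
  refine ⟨?_, fun {n} a X => ?_⟩
  rotate_left
  · let f : TreeData F → TreeData F → TreeData F := fun acc e =>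
      .pair acc.hd.tl (encVec (dec n acc.tl - (0 - acc.hd.hd.val) • dec n e))
    have hf : ∀ (m : ℕ) (rows : Fin m → Fin n → F) (c : TreeData F) (u : Fin n → F),
        ∃ c', (List.ofFn fun j => encVec (rows j)).foldl f (.pair c (encVec u))
          = .pair c' (encVec (u + ∑ j, dec m c j • rows j)) := by
      intro m
      induction m with
      | zero => intro rows c u; exact ⟨c, by simp⟩
      | succ m ih =>
        intro rows c u
        obtain ⟨c', h⟩ := ih (fun j => rows j.succ) c.tl (u + c.hd.val • rows 0)
        refine ⟨c', ?_⟩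
        rw [List.ofFn_succ, List.foldl_cons]
        refine Eq.trans ?_ (h.trans ?_)
        · simp [f, dec_encVec]
        · simp [Fin.sum_univ_succ, dec, get_succ, get_zero, add_assoc]
    obtain ⟨c', hc'⟩ := hf n X (encVec a) 0
    have k := fold_pure (f := f) (t := _) (c := bnd axpy
        (.cons (.sub (.const 0) (.hd (.hd (.hd (.var 0)))))
        (.cons (.tl (.var 0)) (.cons (.tl (.hd (.var 0))) (.tl (.var 0)))))
        (expr (.cons (.tl (.hd (.hd (.tl (.var 0))))) (.hd (.var 0)))))
        (fun l _ => ∀ e ∈ l, ∃ v : Fin n → F, e = encVec v) (fun e l acc h => by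
          obtain ⟨v, rfl⟩ := h e (by simp)
          exact ⟨bnd_pure (d' := .pair (.atom (0 - acc.hd.hd.val)) (.pair (encVec v)
              (.pair acc.tl (encVec v)))) rfl
            (hK (n := n) _ _ _ (List.ofFn fun i => atom (v i)) (by simp)) (expr_runs rfl),
            fun e he => h e (List.mem_cons_of_mem _ he)⟩)
        (List.ofFn fun j => encVec (X j)) (.pair (encVec a) (encVec (0 : Fin n → F))) (fun e he => by
          obtain ⟨i, rfl⟩ := List.mem_ofFn.1 he
          exact ⟨_, rfl⟩)
    rw [hc', List.length_ofFn] at k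
    have k0 := hK (n := n) (.atom 0) .nil .nil (List.ofFn fun i => atom (a i)) (by simp)
    rw [dec_nil, smul_zero, sub_zero] at k0
    refine ((bnd_pure (d' := .pair (.atom 0) (.pair .nil (.pair .nil (encVec a)))) rfl k0
      (pre_runs (d' := .pair (.pair (encVec a) (encVec 0)) (encMat X)) rfl
        (post_pure k rfl))).mono ?_).of_eq ?_
    · have h1 : 1 ≤ (n + 1) * (n + 1) := Nat.mul_pos (Nat.succ_pos n) (Nat.succ_pos n)
      have h2 : 1 ≤ n + 1 := Nat.le_add_left _ _
      have h3 : n ≤ 1 * (n + 1) := by omega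
      have h4 : n + 1 ≤ (n + 1) * (n + 1) := by nlinarith
      rw [sq]
      exact Nat.add_le_const_mul (Nat.add_le_const_mul (Nat.mul_le_mul_left K h4)
        (Nat.add_le_const_mul (Nat.add_le_const_mul (Nat.add_le_const_mul
          (Nat.mul_le_const_mul h3 (Nat.add_le_const_mul (Nat.add_le_const_mul (Nat.add_le_const_mul
            le_rfl (Nat.le_const_mul h2 _)) (Nat.le_const_mul h2 _)) (Nat.le_const_mul h2 _))) (Nat.le_const_mul h1 _))
          (Nat.le_const_mul h1 _)) (Nat.le_const_mul h1 _))) (Nat.le_const_mul h1 _)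
    · simp only [TreeExpr.eval, initStore_zero, tl_pair, dec_encVec, zero_add]
      congr 2
      funext j
      simp [Matrix.vecMul, dotProduct]

/-- On the input `(A, X)`: the product of two matrices. -/
def matMul : TreeProg F := pre swapE (mapL (pre swapE vecMat))

theorem matMul_runs : ∃ K, ∀ {n : ℕ} (A X : Matrix (Fin n) (Fin n) F),
    matMul.RunsOn (.pair (encMat A) (encMat X)) (K * (n + 1) ^ 3)
      (PMF.pure (encMat (A * X))) := by
  obtain ⟨K₁, h₁⟩ := vecMat_runs (F := F)
  obtain ⟨K₂, h₂⟩ := mapL_runs (F := F) (pre swapE vecMat)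
  refine ⟨?_, fun {n} A X => ?_⟩
  rotate_left
  · have k := h₂ (ctx := encMat X) (g := fun e => encVec (dec n e ᵥ* X))
      (l := List.ofFn fun i => encVec (A i)) (t := K₁ * (n + 1) ^ 2 + preK swapE vecMat)
      (fun e he => by
        obtain ⟨i, rfl⟩ := List.mem_ofFn.1 he
        refine (pre_runs rfl (h₁ (A i) X)).of_eq ?_
        rw [dec_encVec])
    refine ((pre_runs (d' := .pair (encMat X) (encMat A)) rfl k).mono ?_).of_eq ?_
    · have h1 : 1 ≤ (n + 1) ^ 3 := Nat.one_le_pow _ _ (Nat.succ_pos n)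
      have h2 : 1 ≤ (n + 1) ^ 2 := Nat.one_le_pow _ _ (Nat.succ_pos n)
      rw [List.length_ofFn]
      rw [pow_succ' (n + 1) 2] at h1 ⊢
      exact Nat.add_le_const_mul (Nat.const_mul_le_const_mul K₂ (Nat.mul_le_const_mul_left _
        (Nat.add_le_const_mul (Nat.add_le_const_mul le_rfl
          (Nat.le_const_mul h2 _)) (Nat.le_const_mul h2 _)))) (Nat.le_const_mul h1 _)
    · simp only [encMat, List.map_ofFn, Function.comp_def, dec_encVec]
      rfl

/-- On the input `(u, v)`: are the two vectors equal? -/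
def vecEq : TreeProg F :=
  pre (.cons (.cons (.tl (.var 0)) (.const 1)) (.hd (.var 0)))
    (post (fold (cond (.eq (.tl (.var 0)) (.hd (.hd (.hd (.var 0)))))
      (expr (.cons (.tl (.hd (.hd (.var 0)))) (.tl (.hd (.var 0)))))
      (expr (.cons .nil .nil)))) (.tl (.var 0)))

theorem vecEq_runs : ∃ K, ∀ {n : ℕ} (u v : Fin n → F),
    vecEq.RunsOn (.pair (encVec u) (encVec v)) (K * (n + 1))
      (PMF.pure (if u = v then .atom 1 else .nil)) := by
  let f : TreeData F → TreeData F → TreeData F := fun acc e =>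
    if e.sameAtom acc.hd.hd then .pair acc.hd.tl acc.tl else .pair .nil .nil
  -- After a mismatch the list to compare with is replaced by `nil`, whose head is no field element,
  -- so every later comparison fails as well and the flag stays `nil`.
  have hnil : ∀ l : List (TreeData F), l.foldl f (.pair .nil .nil) = .pair .nil .nil := by
    intro l
    induction l with
    | nil => rfl
    | cons e l ih =>
      rw [List.foldl_cons]
      refine Eq.trans ?_ ih
      cases e <;> rfl
  have hf : ∀ (n : ℕ) (u v : Fin n → F),
      ((List.ofFn fun i => atom (u i)).foldl f (.pair (encVec v) (.atom 1))).tl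
        = if u = v then .atom 1 else .nil := by
    intro n
    induction n with
    | zero => intro u v; simp [Subsingleton.elim u v]
    | succ n ih =>
      intro u v
      rw [List.ofFn_succ, List.foldl_cons, encVec_succ]
      by_cases h : u 0 = v 0
      · have h1 : f (((atom (v 0)).pair (encVec fun i => v i.succ)).pair (atom 1)) (atom (u 0))
            = .pair (encVec fun i => v i.succ) (.atom 1) := by
          simp [f, sameAtom, h]
        rw [h1, ih]
        congr 1
        refine propext ⟨fun h' => ?_, fun h' => by rw [h']⟩
        funext i
        exact Fin.cases h (fun j => congrFun h' j) i
      · have h1 : f (((atom (v 0)).pair (encVec fun i => v i.succ)).pair (atom 1)) (atom (u 0))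
            = .pair .nil .nil := by
          simp [f, sameAtom, h]
        rw [h1, hnil, if_neg fun h' => h (by rw [h'])]
        rfl
  refine ⟨?_, fun {n} u v => ?_⟩
  rotate_left
  · have k := fold_pure (f := f) (t := 30) (c := cond (.eq (.tl (.var 0)) (.hd (.hd (.hd (.var 0)))))
      (expr (.cons (.tl (.hd (.hd (.var 0)))) (.tl (.hd (.var 0)))))
      (expr (.cons .nil .nil))) (fun _ _ => True) (fun e l acc _ => ⟨by
        by_cases h : e.sameAtom acc.hd.hd
        · refine (cond_true _ (by simp [h, ofBool, tt]) (expr_runs ?_)).mono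
            (by simp [TreeExpr.cost])
          simp [f, h]
        · refine (cond_false _ (by simp [h, ofBool]) (expr_runs ?_)).mono
            (by simp [TreeExpr.cost])
          simp [f, h], trivial⟩)
      (List.ofFn fun i => atom (u i)) (.pair (encVec v) (.atom 1)) trivial
    rw [List.length_ofFn] at k
    refine (pre_runs (d' := .pair (.pair (encVec v) (.atom 1)) (encVec u)) rfl
      (post_pure k (d'' := if u = v then .atom 1 else .nil) (by simpa using hf n u v))).mono ?_
    have h1 : 1 ≤ n + 1 := Nat.le_add_left _ _
    have h2 : n ≤ n + 1 := Nat.le_succ _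
    refine Nat.add_le_const_mul (Nat.add_le_const_mul (Nat.add_le_const_mul
      ((Nat.mul_le_mul_right _ h2).trans (le_of_eq (mul_comm _ _)))
      (Nat.le_const_mul h1 _)) (Nat.le_const_mul h1 _)) (Nat.le_const_mul h1 _)

/-- On the input `l`: a random vector with as many entries as `l`. -/
def randVec : TreeProg F :=
  pre (.cons .nil (.var 0))
    (fold (bnd (rand 0) .nil (expr (.cons (.hd (.var 0)) (.hd (.tl (.var 0)))))))

theorem uniform_prod_eq {α β : Type*} [Fintype α] [Nonempty α] [Fintype β] [Nonempty β] :
    PMF.uniformOfFintype (α × β) = (PMF.uniformOfFintype α).bind fun a =>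
      (PMF.uniformOfFintype β).map fun b => (a, b) := by
  ext ⟨a, b⟩
  rw [PMF.bind_apply, tsum_eq_single a]
  · rw [PMF.map_apply, tsum_eq_single b]
    · simp [ENNReal.mul_inv]
    · intro b' hb'
      rw [if_neg]
      simp [Ne.symm hb']
  · intro a' ha'
    rw [PMF.map_apply]
    simp [Ne.symm ha']

theorem uniform_map_equiv {α β : Type*} [Fintype α] [Nonempty α] [Fintype β] [Nonempty β]
    (e : α ≃ β) : (PMF.uniformOfFintype α).map e = PMF.uniformOfFintype β := by
  ext b
  rw [PMF.map_apply, tsum_eq_single (e.symm b)]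
  · simp [Fintype.card_congr e]
  · intro a ha
    rw [if_neg]
    rintro rfl
    simp at ha

theorem randVec_runs : ∃ K, ∀ {n : ℕ} (l : List (TreeData F)), l.length = n →
    randVec.RunsOn (.ofList l) (K * (n + 1))
      ((PMF.uniformOfFintype (Fin n → F)).map encVec) := by
  let f : TreeData F → TreeData F → PMF (TreeData F) := fun acc _ =>
    (PMF.uniformOfFintype F).map fun a => .pair (.atom a) acc
  have happ : ∀ (l : List (TreeData F)) (e acc : TreeData F),
      foldDist f acc (l ++ [e]) = (foldDist f acc l).bind fun a => f a e := by
    intro l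
    induction l with
    | nil => intro e acc; simp [foldDist]
    | cons e' l ih =>
      intro e acc
      simp only [List.cons_append, foldDist, ih, PMF.bind_bind]
  have hf : ∀ (n : ℕ) (l : List (TreeData F)), l.length = n →
      foldDist f .nil l = (PMF.uniformOfFintype (Fin n → F)).map encVec := by
    intro n
    induction n with
    | zero =>
      intro l hl
      rw [List.length_eq_zero_iff] at hl
      subst hl
      have : (encVec : (Fin 0 → F) → TreeData F) = Function.const _ .nil := by
        funext v; simp [encVec, ofList]
      rw [this, PMF.map_const]
      rfl
    | succ n ih =>
      intro l hl
      -- The entry drawn last is the first entry of the vector, so the induction removes the last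
      -- element of the template.
      obtain ⟨l', e, rfl⟩ : ∃ l' e, l = l' ++ [e] := by
        refine ⟨l.dropLast, l.getLast (by intro h; simp [h] at hl), ?_⟩
        rw [List.dropLast_append_getLast]
      rw [happ, ih l' (by simpa using hl), PMF.bind_map,
        ← uniform_map_equiv (((Equiv.prodComm _ _).trans (Fin.consEquiv fun _ : Fin (n + 1) => F))),
        PMF.map_comp, uniform_prod_eq, PMF.map_bind]
      refine congrArg _ (funext fun v => ?_)
      rw [PMF.map_comp]
      refine congrArg (fun g => PMF.map g _) (funext fun a => ?_)
      simp [encVec_succ]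
  refine ⟨?_, fun {n} l hl => ?_⟩
  rotate_left
  · refine ((pre_runs (d' := .pair .nil (.ofList l)) rfl (fold_runs (f := f) (t := _)
      (fun _ _ => True) (fun e l acc _ => ⟨(bnd_runs rfl (rand_runs _) fun r _ =>
        expr_runs rfl).of_eq ?_, fun _ _ => trivial⟩) l .nil trivial)).mono ?_).of_eq ?_
    rotate_left 2
    · exact hf n l hl
    · simp only [f, PMF.bind_map]
      rfl
    · rw [hl]
      have h1 : 1 ≤ n + 1 := Nat.le_add_left _ _
      have h2 : n ≤ n + 1 := Nat.le_succ _
      exact Nat.add_le_const_mul (Nat.add_le_const_mul 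
        ((Nat.mul_le_mul_right _ h2).trans (le_of_eq (mul_comm _ _)))
        (Nat.le_const_mul h1 _)) (Nat.le_const_mul h1 _)

end TreeProg

/-! ### Gaussian elimination -/

namespace Gauss

open TreeData

variable {F : Type*} [Field F] {n : ℕ}

/-- The first vector of the list that is not orthogonal to `r`, and the other vectors. -/
noncomputable def pivot (r : Fin n → F) (s : Option (TreeData F) × List (TreeData F))
    (v : TreeData F) : Option (TreeData F) × List (TreeData F) :=
  open Classical in
  match s.1 with
  | some p => (some p, v :: s.2)
  | none => if r ⬝ᵥ dec n v = 0 then (none, v :: s.2) else (some v, s.2)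

theorem foldl_pivot_some (r : Fin n → F) (p : TreeData F) (l o : List (TreeData F)) :
    l.foldl (pivot r) (some p, o) = (some p, l.reverse ++ o) := by
  induction l generalizing o with
  | nil => rfl
  | cons v l ih => simp [pivot, ih]

/-- The order of the remaining vectors is irrelevant for the span, so a permutation is all that has
to be recorded. -/
theorem foldl_pivot_none (r : Fin n → F) (l o : List (TreeData F)) :
    (l.foldl (pivot r) (none, o) = (none, l.reverse ++ o) ∧ ∀ v ∈ l, r ⬝ᵥ dec n v = 0) ∨
    ∃ p o', l.foldl (pivot r) (none, o) = (some p, o') ∧ r ⬝ᵥ dec n p ≠ 0 ∧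
      (p :: o').Perm (l ++ o) := by
  induction l generalizing o with
  | nil => exact .inl ⟨rfl, by simp⟩
  | cons v l ih =>
    by_cases h : r ⬝ᵥ dec n v = 0
    · have h1 : pivot r (none, o) v = (none, v :: o) := by simp [pivot, h]
      rw [List.foldl_cons, h1]
      rcases ih (v :: o) with ⟨h2, h3⟩ | ⟨p, o', h2, h3, h4⟩
      · refine .inl ⟨by simp [h2], ?_⟩
        intro u hu
        rcases List.mem_cons.1 hu with rfl | hu
        exacts [h, h3 u hu]
      · exact .inr ⟨p, o', h2, h3, h4.trans List.perm_middle⟩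
    · have h1 : pivot r (none, o) v = (some v, o) := by simp [pivot, h]
      rw [List.foldl_cons, h1, foldl_pivot_some]
      refine .inr ⟨v, _, rfl, h, ?_⟩
      exact List.Perm.cons _ ((List.reverse_perm l).append_right o)

/-- Subtract from `v` the multiple of `p` that makes the product with `r` equal to `β`. -/
def elimVec (r : Fin n → F) (p : TreeData F) (β : F) (v : TreeData F) : TreeData F :=
  encVec (dec n v - ((r ⬝ᵥ dec n v - β) * (r ⬝ᵥ dec n p)⁻¹) • dec n p)

/-- Process the equation with the coefficients `r`.  The state consists of the right hand sides
of the remaining equations, a particular solution, and a basis of the homogeneous solutions. -/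
noncomputable def step (s : TreeData F × TreeData F × List (TreeData F)) (r : Fin n → F) :
    TreeData F × TreeData F × List (TreeData F) :=
  match s.2.2.foldl (pivot r) (none, []) with
  | (none, _) => (s.1.tl, s.2.1, s.2.2)
  | (some p, o) => (s.1.tl, elimVec r p s.1.hd.val s.2.1, o.map (elimVec r p 0))

theorem step_length_le (s : TreeData F × TreeData F × List (TreeData F)) (r : Fin n → F) :
    (step s r).2.2.length ≤ s.2.2.length := by
  rcases foldl_pivot_none r s.2.2 [] with ⟨h, -⟩ | ⟨p, o, h, -, hp⟩
  · simp [step, h]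
  · have := hp.length_eq
    simp only [step, h, List.length_map, List.append_nil, List.length_cons] at this ⊢
    omega

/-- The set of vectors spanned by a list. -/
def lin (n : ℕ) (B : List (TreeData F)) : Submodule F (Fin n → F) :=
  Submodule.span F {v | ∃ d ∈ B, v = dec n d}

/-- `S` plays the role of the solution set of the equations treated so far. If `r` takes two values
on `S`, then it does not vanish on the span of the basis, so there is a pivot `p`. Projecting along
`p` onto the kernel of `r` sends `p` to zero and the other basis vectors to the new basis, which has
one element less. -/
theorem step_spec {s : TreeData F × TreeData F × List (TreeData F)} {r : Fin n → F}
    {S : Set (Fin n → F)} (hS : ∀ w ∈ S, w - dec n s.2.1 ∈ lin n s.2.2)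
    (hr : ∃ w ∈ S, ∃ w' ∈ S, r ⬝ᵥ w ≠ r ⬝ᵥ w') :
    (step s r).1 = s.1.tl ∧ (step s r).2.2.length + 1 = s.2.2.length ∧
      ∀ w ∈ S, r ⬝ᵥ w = s.1.hd.val → w - dec n (step s r).2.1 ∈ lin n (step s r).2.2 := by
  let φ : (Fin n → F) →ₗ[F] F :=
    { toFun := fun w => r ⬝ᵥ w
      map_add' := fun _ _ => dotProduct_add _ _ _
      map_smul' := fun c w => by simp [dotProduct_smul] }
  rcases foldl_pivot_none r s.2.2 [] with ⟨-, h⟩ | ⟨p, o, h, h0, hp⟩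
  · exfalso
    obtain ⟨w, hw, w', hw', hne⟩ := hr
    have hle : lin n s.2.2 ≤ LinearMap.ker φ := by
      refine Submodule.span_le.2 ?_
      rintro _ ⟨d, hd, rfl⟩
      exact h d hd
    have h1 := hle (Submodule.sub_mem _ (hS w hw) (hS w' hw'))
    rw [sub_sub_sub_cancel_right, LinearMap.mem_ker, map_sub, sub_eq_zero] at h1
    exact hne h1
  · rw [List.append_nil] at hp
    have hst : step s r = (s.1.tl, elimVec r p s.1.hd.val s.2.1, o.map (elimVec r p 0)) := by
      simp only [step, h]
    rw [hst]
    refine ⟨rfl, by simpa using hp.length_eq, fun w hw hwr => ?_⟩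
    -- The projection along `p` onto the kernel of `r`. Differences of the particular solution from
    -- vectors `w` satisfying the new equation are transformed by it too, which is `h1`.
    let Tr : (Fin n → F) →ₗ[F] (Fin n → F) :=
      LinearMap.id - (φ (dec n p))⁻¹ • φ.smulRight (dec n p)
    have hT : ∀ v, Tr v = v - (r ⬝ᵥ v * (r ⬝ᵥ dec n p)⁻¹) • dec n p := fun v => by
      simp [Tr, φ, smul_smul, mul_comm]
    have h1 : w - dec n (elimVec r p s.1.hd.val s.2.1) = Tr (w - dec n s.2.1) := by
      rw [hT, elimVec, dec_encVec, dotProduct_sub, hwr]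
      module
    have h2 : (lin n s.2.2).map Tr ≤ lin n (o.map (elimVec r p 0)) := by
      refine (Submodule.map_span_le _ _ _).2 ?_
      rintro _ ⟨d, hd, rfl⟩
      rcases List.mem_cons.1 (hp.mem_iff.2 hd) with rfl | hd
      · rw [hT, mul_inv_cancel₀ h0, one_smul, sub_self]
        exact Submodule.zero_mem _
      · refine Submodule.subset_span ⟨_, List.mem_map_of_mem hd, ?_⟩
        rw [hT, elimVec, dec_encVec, sub_zero]
    rw [h1]
    exact h2 (Submodule.mem_map_of_mem (hS w hw))

/-- The `i`-th unit vector as a list without trailing zeros. -/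
def unit : ℕ → TreeData F
  | 0 => .pair (.atom 1) .nil
  | i + 1 => .pair .nil (unit i)

theorem get_unit (i j : ℕ) : (unit i : TreeData F).get j = if i = j then 1 else 0 := by
  induction j generalizing i with
  | zero => cases i <;> simp [unit, get_zero]
  | succ j ih => cases i <;> simp [unit, get_succ, get_nil, ih]

/-- The standard basis. -/
def basis (n : ℕ) : List (TreeData F) := ((List.range n).map unit).reverse

theorem mem_lin_basis (w : Fin n → F) : w ∈ lin n (basis n) := by
  rw [pi_eq_sum_univ w]
  refine Submodule.sum_mem _ fun i _ => Submodule.smul_mem _ _ (Submodule.subset_span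
    ⟨unit i, by simpa [basis] using ⟨i.1, i.2, rfl⟩, ?_⟩)
  funext j
  simp [dec, get_unit, Fin.ext_iff]

/-- The initial state. -/
def init (b : Fin n → F) : TreeData F × TreeData F × List (TreeData F) :=
  (encVec b, .nil, basis n)

/-- After `k` equations the basis has `n - k` elements and every solution of these equations lies in
the affine space described by the state. After `n` equations the space is a single point, and it
contains `A⁻¹ b`. Only this inclusion is needed, not equality with the solution set. -/
theorem foldl_step_correct (A : Matrix.GeneralLinearGroup (Fin n) F) (b : Fin n → F) :
    dec n ((List.ofFn fun i => A.1 i).foldl step (init b)).2.1 = A⁻¹.1 *ᵥ b := by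
  have hA : A.1 * A⁻¹.1 = 1 := by
    rw [← Units.val_mul, mul_inv_cancel, Units.val_one]
  have hsol : ∀ c : Fin n → F, ∀ i, A.1 i ⬝ᵥ (A⁻¹.1 *ᵥ c) = c i := fun c i => by
    have : A.1 *ᵥ (A⁻¹.1 *ᵥ c) = c := by rw [Matrix.mulVec_mulVec, hA, Matrix.one_mulVec]
    exact congrFun this i
  have key : ∀ k ≤ n, let s := ((List.ofFn fun i => A.1 i).take k).foldl step (init b)
      s.1 = tl^[k] (encVec b) ∧ s.2.2.length + k = n ∧
      ∀ w : Fin n → F, (∀ i : Fin n, i.1 < k → A.1 i ⬝ᵥ w = b i) →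
        w - dec n s.2.1 ∈ lin n s.2.2 := by
    intro k
    induction k with
    | zero =>
      intro _
      refine ⟨rfl, by simp [init, basis], fun w _ => mem_lin_basis _⟩
    | succ k ih =>
      intro hk
      obtain ⟨h1, h2, h3⟩ := ih (by omega)
      have hl : k < (List.ofFn fun i => A.1 i).length := by simp; omega
      have htake : (List.ofFn fun i => A.1 i).take (k + 1)
          = (List.ofFn fun i => A.1 i).take k ++ [A.1 ⟨k, hk⟩] := by
        rw [List.take_succ_eq_append_getElem hl]
        simp
      simp only [htake, List.foldl_append, List.foldl_cons, List.foldl_nil]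
      set s := ((List.ofFn fun i => A.1 i).take k).foldl step (init b)
      -- Invertibility supplies two solutions of the first `k` equations on which row `k` differs:
      -- the solutions for the right-hand sides `b` and `b` plus the `k`-th unit vector.
      obtain ⟨g1, g2, g3⟩ := step_spec (r := A.1 ⟨k, hk⟩)
        (S := {w | ∀ i : Fin n, i.1 < k → A.1 i ⬝ᵥ w = b i}) h3
        ⟨A⁻¹.1 *ᵥ b, fun i _ => hsol b i, A⁻¹.1 *ᵥ (b + Pi.single ⟨k, hk⟩ 1), fun i hi => by
          rw [hsol, Pi.add_apply, Pi.single_eq_of_ne, add_zero]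
          exact fun h => by simp [h] at hi, by rw [hsol, hsol]; simp⟩
      refine ⟨?_, by omega, fun w hw => g3 w (fun i hi => hw i (by omega)) ?_⟩
      · rw [g1, h1, Function.iterate_succ_apply']
      · rw [hw ⟨k, hk⟩ (Nat.lt_succ_self k), h1]
        exact (congrFun (dec_encVec b) ⟨k, hk⟩).symm
  obtain ⟨-, h2, h3⟩ := key n le_rfl
  rw [List.take_of_length_le (by simp)] at h2 h3
  have h4 := h3 (A⁻¹.1 *ᵥ b) fun i _ => hsol b i
  have h6 : ((List.ofFn fun i => A.1 i).foldl step (init b)).2.2 = [] :=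
    List.eq_nil_of_length_eq_zero (by omega)
  rw [h6] at h4
  have h5 : lin n ([] : List (TreeData F)) = ⊥ := by simp [lin]
  rw [h5, Submodule.mem_bot, sub_eq_zero] at h4
  exact h4.symm

end Gauss

/-! ### Elimination as a program of cubic running time -/

namespace TreeProg

open TreeData

variable {F : Type*} [Field F] [Fintype F] [DecidableEq F]

/-- A fold of a deterministic procedure acting on encoded states. -/
theorem fold_state {c : TreeProg F} {σ ι : Type*} (enc : σ → TreeData F) (encE : ι → TreeData F)
    (g : σ → ι → σ) (I : σ → Prop) {t : ℕ}
    (h : ∀ s e, I s → c.RunsOn (.pair (enc s) (encE e)) t (PMF.pure (enc (g s e))) ∧ I (g s e))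
    (l : List ι) (s : σ) (hs : I s) :
    (fold c).RunsOn (.pair (enc s) (.ofList (l.map encE))) (l.length * (t + foldK c) + foldK c)
      (PMF.pure (enc (l.foldl g s))) := by
  -- The encoding `enc` need not be injective, so the body is described by its output on trees
  -- rather than by a function of states.
  have k := fold_runs (c := c) (f := fun a e => c.output (.pair a e)) (t := t)
    (fun l' acc => ∃ l : List ι, ∃ s, I s ∧ acc = enc s ∧ l' = l.map encE) (fun e' l' acc hI => by
      obtain ⟨l, s, hs, rfl, hl⟩ := hI
      obtain ⟨e, l, rfl, rfl, rfl⟩ := List.map_eq_cons_iff.1 hl.symm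
      obtain ⟨h1, h2⟩ := h s e hs
      refine ⟨h1.run_output, fun a ha => ?_⟩
      rw [h1.eq_output, PMF.support_pure, Set.mem_singleton_iff] at ha
      exact ⟨l, _, h2, ha, rfl⟩) (l.map encE) (enc s) ⟨l, s, hs, rfl, rfl⟩
  rw [List.length_map] at k
  refine k.of_eq ?_
  clear k
  induction l generalizing s with
  | nil => rfl
  | cons e l ih =>
    simp only [List.map_cons, foldDist, List.foldl_cons]
    rw [(h s e hs).1.eq_output, PMF.pure_bind]
    exact ih _ (h s e hs).2

/-- An optional tree as a tree. -/
def encOpt : Option (TreeData F) → TreeData F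
  | none => .nil
  | some p => p

/-- On the input `(r, B)`: the pivot among the elements of `B`, and the other elements. -/
def findPivot : TreeProg F :=
  pre (.cons (.cons (.hd (.var 0)) (.cons .nil .nil)) (.tl (.var 0)))
    (post (fold (cond (.hd (.tl (.hd (.var 0))))
      (expr (.cons (.hd (.hd (.var 0))) (.cons (.hd (.tl (.hd (.var 0))))
        (.cons (.tl (.var 0)) (.tl (.tl (.hd (.var 0))))))))
      (bnd dot (.cons (.hd (.hd (.var 0))) (.tl (.var 0)))
        (cond (.eq (.hd (.var 0)) (.const 0))
          (expr (.cons (.hd (.hd (.tl (.var 0)))) (.cons .nil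
            (.cons (.tl (.tl (.var 0))) (.tl (.tl (.hd (.tl (.var 0)))))))))
          (expr (.cons (.hd (.hd (.tl (.var 0)))) (.cons (.tl (.tl (.var 0)))
            (.tl (.tl (.hd (.tl (.var 0)))))))))))) (.tl (.var 0)))

theorem findPivot_runs : ∃ K, ∀ {n : ℕ} (r : Fin n → F) (B : List (TreeData F)), B.length ≤ n →
    findPivot.RunsOn (.pair (encVec r) (.ofList B)) (K * ((n + 1) * (n + 1)))
      (PMF.pure (.pair (encOpt (B.foldl (Gauss.pivot r) (none, [])).1)
        (.ofList (B.foldl (Gauss.pivot r) (none, [])).2))) := by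
  obtain ⟨K, hK⟩ := dot_runs (F := F)
  refine ⟨?_, fun {n} r B hB => ?_⟩
  rotate_left
  · have k := fold_state (t := K * (n + 1) + 40 + bndK (dot (F := F))
        (.cons (.hd (.hd (.var 0))) (.tl (.var 0))) (cond (.eq (.hd (.var 0)) (.const 0))
          (expr (.cons (.hd (.hd (.tl (.var 0)))) (.cons .nil
            (.cons (.tl (.tl (.var 0))) (.tl (.tl (.hd (.tl (.var 0)))))))))
          (expr (.cons (.hd (.hd (.tl (.var 0)))) (.cons (.tl (.tl (.var 0)))
            (.tl (.tl (.hd (.tl (.var 0))))))))))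
      (c := cond (.hd (.tl (.hd (.var 0))))
        (expr (.cons (.hd (.hd (.var 0))) (.cons (.hd (.tl (.hd (.var 0))))
          (.cons (.tl (.var 0)) (.tl (.tl (.hd (.var 0))))))))
        (bnd dot (.cons (.hd (.hd (.var 0))) (.tl (.var 0)))
          (cond (.eq (.hd (.var 0)) (.const 0))
            (expr (.cons (.hd (.hd (.tl (.var 0)))) (.cons .nil
              (.cons (.tl (.tl (.var 0))) (.tl (.tl (.hd (.tl (.var 0)))))))))
            (expr (.cons (.hd (.hd (.tl (.var 0)))) (.cons (.tl (.tl (.var 0)))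
              (.tl (.tl (.hd (.tl (.var 0)))))))))))
      (fun s : Option (TreeData F) × List (TreeData F) =>
        .pair (encVec r) (.pair (encOpt s.1) (.ofList s.2))) id (Gauss.pivot r)
      -- A missing pivot is encoded by `nil`. This is unambiguous because `nil` decodes to the zero
      -- vector, which is orthogonal to `r` and never becomes a pivot.
      (fun s => ∀ p, s.1 = some p → p ≠ .nil) (by
        rintro ⟨_ | p, o⟩ v hs
        · by_cases hv : r ⬝ᵥ dec n v = 0
          · have hst : Gauss.pivot r (none, o) v = (none, v :: o) := by simp [Gauss.pivot, hv]
            rw [hst]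
            refine ⟨(cond_false _ rfl (bnd_pure (d' := .pair (encVec r) v) rfl (hK r v)
              (cond_true _ (by simp [hv, sameAtom, ofBool, tt]) (expr_runs rfl)))).mono ?_, by simp⟩
            simp only [TreeExpr.cost]
            omega
          · have hst : Gauss.pivot r (none, o) v = (some v, o) := by simp [Gauss.pivot, hv]
            rw [hst]
            refine ⟨(cond_false _ rfl (bnd_pure (d' := .pair (encVec r) v) rfl (hK r v)
              (cond_false _ (by simp [hv, sameAtom, ofBool]) (expr_runs rfl)))).mono ?_, ?_⟩
            · simp only [TreeExpr.cost]
              omega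
            · rintro p hp rfl
              simp only [Option.some.injEq] at hp
              subst hp
              simp [dec_nil] at hv
        · have hst : Gauss.pivot r (some p, o) v = (some p, v :: o) := by simp [Gauss.pivot]
          rw [hst]
          refine ⟨(cond_true _ (by simpa [encOpt] using hs p rfl) (expr_runs rfl)).mono ?_, hs⟩
          simp only [TreeExpr.cost]
          omega) B (none, []) (by simp)
    rw [List.map_id] at k
    refine (pre_runs (d' := .pair (.pair (encVec r) (.pair .nil .nil)) (.ofList B)) rfl
      (post_pure k rfl)).mono ?_
    have h1 : 1 ≤ (n + 1) * (n + 1) := Nat.mul_pos (Nat.succ_pos n) (Nat.succ_pos n)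
    have h2 : 1 ≤ n + 1 := Nat.le_add_left _ _
    have h3 : B.length ≤ 1 * (n + 1) := by omega
    exact Nat.add_le_const_mul (Nat.add_le_const_mul (Nat.add_le_const_mul
      (Nat.mul_le_const_mul h3 (Nat.add_le_const_mul (Nat.add_le_const_mul
        (Nat.add_le_const_mul le_rfl (Nat.le_const_mul h2 _)) (Nat.le_const_mul h2 _))
        (Nat.le_const_mul h2 _))) (Nat.le_const_mul h1 _)) (Nat.le_const_mul h1 _))
      (Nat.le_const_mul h1 _)

/-- On the input `((r, (p, (δ, β))), v)`, where `δ` is the product of `r` and `p`: the elimination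
step of `Gauss.elimVec`. -/
def elim : TreeProg F :=
  bnd dot (.cons (.hd (.hd (.var 0))) (.tl (.var 0)))
    (pre (.cons (.mul (.sub (.hd (.var 0)) (.tl (.tl (.tl (.hd (.tl (.var 0)))))))
        (.inv (.hd (.tl (.tl (.hd (.tl (.var 0))))))))
      (.cons (.hd (.tl (.hd (.tl (.var 0))))) (.cons (.tl (.tl (.var 0)))
        (.hd (.hd (.tl (.var 0))))))) axpy)

theorem elim_runs : ∃ K, ∀ {n : ℕ} (r : Fin n → F) (p β v : TreeData F),
    elim.RunsOn (.pair (.pair (encVec r) (.pair p (.pair (.atom (r ⬝ᵥ dec n p)) β))) v)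
      (K * (n + 1)) (PMF.pure (Gauss.elimVec r p β.val v)) := by
  obtain ⟨K₁, h₁⟩ := dot_runs (F := F)
  obtain ⟨K₂, h₂⟩ := axpy_runs (F := F)
  refine ⟨?_, fun {n} r p β v => ?_⟩
  rotate_left
  · refine ((bnd_pure (d' := .pair (encVec r) v) rfl (h₁ r v) (pre_runs (d' := .pair
      (.atom ((r ⬝ᵥ dec n v - β.val) * (r ⬝ᵥ dec n p)⁻¹)) (.pair p (.pair v (encVec r)))) rfl
      (h₂ (n := n) _ _ _ (List.ofFn fun i => atom (r i)) (by simp)))).mono ?_).of_eq rfl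
    have h2 : 1 ≤ n + 1 := Nat.le_add_left _ _
    exact Nat.add_le_const_mul (Nat.add_le_const_mul le_rfl (Nat.add_le_const_mul le_rfl
      (Nat.le_const_mul h2 _))) (Nat.le_const_mul h2 _)

/-- On the input `((b, (x, B)), r)`: process the equation with the coefficients `r` and the
right hand side given by the first entry of `b`. -/
def gaussStep : TreeProg F :=
  bnd findPivot (.cons (.tl (.var 0)) (.tl (.tl (.hd (.var 0)))))
    (cond (.hd (.hd (.var 0)))
      (bnd dot (.cons (.tl (.tl (.var 0))) (.hd (.hd (.var 0))))
        (bnd (mapL elim) (.cons (.cons (.tl (.tl (.tl (.var 0)))) (.cons (.hd (.hd (.tl (.var 0))))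
            (.cons (.hd (.var 0)) (.const 0)))) (.tl (.hd (.tl (.var 0)))))
          (bnd elim (.cons (.cons (.tl (.tl (.tl (.tl (.var 0))))) (.cons
              (.hd (.hd (.tl (.tl (.var 0))))) (.cons (.hd (.tl (.var 0)))
              (.hd (.hd (.hd (.tl (.tl (.tl (.var 0))))))))))
              (.hd (.tl (.hd (.tl (.tl (.tl (.var 0))))))))
            (expr (.cons (.tl (.hd (.hd (.tl (.tl (.tl (.tl (.var 0))))))))
              (.cons (.hd (.var 0)) (.hd (.tl (.var 0)))))))))
      (expr (.cons (.tl (.hd (.hd (.tl (.var 0))))) (.tl (.hd (.tl (.var 0)))))))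

/-- The state of the elimination as a tree. -/
def encGauss (s : TreeData F × TreeData F × List (TreeData F)) : TreeData F :=
  .pair s.1 (.pair s.2.1 (.ofList s.2.2))

theorem gaussStep_runs : ∃ K, ∀ {n : ℕ} (r : Fin n → F)
    (s : TreeData F × TreeData F × List (TreeData F)), s.2.2.length ≤ n →
    gaussStep.RunsOn (.pair (encGauss s) (encVec r)) (K * ((n + 1) * (n + 1)))
      (PMF.pure (encGauss (Gauss.step s r))) := by
  obtain ⟨K₁, h₁⟩ := findPivot_runs (F := F)
  obtain ⟨K₂, h₂⟩ := dot_runs (F := F)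
  obtain ⟨K₃, h₃⟩ := elim_runs (F := F)
  obtain ⟨K₄, h₄⟩ := mapL_runs (F := F) elim
  -- One constant for the case without a pivot and one for the case with a pivot; each is determined
  -- in its own branch.
  refine ⟨?A + ?B, fun {n} r s hs => ?_⟩
  rotate_left 2
  · have h1 : 1 ≤ (n + 1) * (n + 1) := Nat.mul_pos (Nat.succ_pos n) (Nat.succ_pos n)
    have h2 : 1 ≤ n + 1 := Nat.le_add_left _ _
    have h3 : n + 1 ≤ (n + 1) * (n + 1) := by nlinarith
    have hf := h₁ r s.2.2 hs
    rcases Gauss.foldl_pivot_none r s.2.2 [] with ⟨h, -⟩ | ⟨p, o, h, h0, hp⟩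
    · have hst : Gauss.step s r = (s.1.tl, s.2.1, s.2.2) := by simp [Gauss.step, h]
      rw [h] at hf
      rw [hst]
      refine (bnd_pure rfl hf (cond_false _ rfl (expr_runs rfl))).mono (le_trans ?_
        (Nat.mul_le_mul_right _ (Nat.le_add_right ?A ?B)))
      exact Nat.add_le_const_mul (Nat.add_le_const_mul le_rfl (Nat.le_const_mul h1 _))
        (Nat.le_const_mul h1 _)
    · have hst : Gauss.step s r = (s.1.tl, Gauss.elimVec r p s.1.hd.val s.2.1,
          o.map (Gauss.elimVec r p 0)) := by simp [Gauss.step, h]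
      have hp0 : p ≠ .nil := by
        rintro rfl
        simp [dec_nil] at h0
      have ho : o.length + 1 ≤ 1 * (n + 1) := by
        have := hp.length_eq
        simp only [List.length_cons, List.append_nil] at this
        omega
      rw [h] at hf
      rw [hst]
      have k := h₄ (ctx := .pair (encVec r) (.pair p (.pair (.atom (r ⬝ᵥ dec n p)) (.atom 0))))
        (l := o) fun e _ => h₃ r p (.atom 0) e
      refine (bnd_pure rfl hf (cond_true _ (by exact hp0) (bnd_pure (d' := .pair (encVec r) p) rfl (h₂ r p)
        (bnd_pure (d' := .pair (.pair (encVec r) (.pair p (.pair (.atom (r ⬝ᵥ dec n p)) (.atom 0))))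
          (.ofList o)) rfl k (bnd_pure (d' := .pair (.pair (encVec r) (.pair p
            (.pair (.atom (r ⬝ᵥ dec n p)) s.1.hd))) s.2.1) rfl (h₃ r p s.1.hd s.2.1)
          (expr_runs rfl)))))).mono (le_trans ?_ (Nat.mul_le_mul_right _ (Nat.le_add_left ?B ?A)))
      have c1 : ∀ a, a ≤ a * ((n + 1) * (n + 1)) := Nat.le_const_mul h1
      exact Nat.add_le_const_mul (Nat.add_le_const_mul le_rfl (Nat.add_le_const_mul
        (Nat.add_le_const_mul (Nat.add_le_const_mul (Nat.add_le_const_mul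
          (Nat.mul_le_mul_left _ h3) (Nat.add_le_const_mul (Nat.add_le_const_mul
            (Nat.const_mul_le_const_mul _ (Nat.mul_le_const_mul ho
              (Nat.add_le_const_mul le_rfl (Nat.le_const_mul h2 _))))
            (Nat.add_le_const_mul (Nat.add_le_const_mul (Nat.mul_le_mul_left _ h3) (c1 _)) (c1 _)))
            (c1 _))) (c1 _)) (c1 _)) (c1 _))) (c1 _)

/-- On the input `(A, b)`: a solution of `A x = b` by elimination, if `A` is invertible. -/
def gauss : TreeProg F :=
  bnd (fold (expr (.cons (.cons .nil (.hd (.hd (.var 0)))) (.cons (.hd (.hd (.var 0)))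
      (.tl (.hd (.var 0))))))) (.cons (.cons (.cons (.const 1) .nil) .nil) (.hd (.var 0)))
    (bnd (fold gaussStep) (.cons (.cons (.tl (.tl (.var 0))) (.cons .nil (.tl (.hd (.var 0)))))
        (.hd (.tl (.var 0))))
      (pre (.cons (.const 0) (.cons .nil (.cons (.hd (.tl (.hd (.var 0))))
        (.tl (.tl (.tl (.var 0))))))) axpy))

omit [Fintype F] in
-- Omitting trailing zeros makes each unit vector one cons cell on top of the previous one, so the
-- whole standard basis is built in linear time, with shared tails.
theorem foldE_basis (n i : ℕ) (l o : List (TreeData F)) (hl : l.length = n) :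
    foldE (.cons (.cons .nil (.hd (.hd (.var 0)))) (.cons (.hd (.hd (.var 0)))
      (.tl (.hd (.var 0))))) l (.pair (Gauss.unit i) (.ofList o)) =
    .pair (Gauss.unit (i + n)) (.ofList (((List.range n).map fun j => Gauss.unit (i + j)).reverse
      ++ o)) := by
  induction n generalizing i l o with
  | zero =>
    rw [List.length_eq_zero_iff] at hl
    subst hl
    simp
  | succ n ih =>
    obtain ⟨e, l, rfl⟩ : ∃ e l', l = e :: l' := by
      cases l with
      | nil => simp at hl
      | cons e l => exact ⟨e, l, rfl⟩
    rw [foldE_cons]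
    refine (ih (i + 1) l (Gauss.unit i :: o) (by simpa using hl)).trans ?_
    have h1 : ∀ j, i + 1 + j = i + (j + 1) := fun j => by omega
    simp [List.range_succ_eq_map, Function.comp_def, h1]

/-- For singular `A` the output is some vector, without guarantee, but the time bound holds for
every input because a step never lengthens the basis. -/
theorem gauss_runs : ∃ K, ∀ {n : ℕ} (A : Matrix (Fin n) (Fin n) F) (b : Fin n → F), ∃ x : Fin n → F,
    gauss.RunsOn (.pair (encMat A) (encVec b)) (K * (n + 1) ^ 3) (PMF.pure (encVec x)) ∧
      ∀ A' : Matrix.GeneralLinearGroup (Fin n) F, A'.1 = A → x = A'⁻¹.1 *ᵥ b := by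
  obtain ⟨K₁, h₁⟩ := gaussStep_runs (F := F)
  obtain ⟨K₂, h₂⟩ := axpy_runs (F := F)
  refine ⟨?_, fun {n} A b => ⟨dec n ((List.ofFn fun i => A i).foldl Gauss.step (Gauss.init b)).2.1,
    ?_, ?_⟩⟩
  rotate_left
  · have hb := foldE_basis (F := F) n 0 (List.ofFn fun i => encVec (A i)) [] (by simp)
    simp only [zero_add, List.append_nil] at hb
    have k := fold_state (c := gaussStep) encGauss (encVec (n := n)) Gauss.step
      (fun s => s.2.2.length ≤ n) (fun s r hs => ⟨h₁ r s hs, (Gauss.step_length_le s r).trans hs⟩)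
      (List.ofFn fun i => A i) (Gauss.init b) (by simp [Gauss.init, Gauss.basis])
    rw [List.map_ofFn, List.length_ofFn] at k
    have k₂ := h₂ (n := n) (.atom 0) .nil ((List.ofFn fun i => A i).foldl Gauss.step
      (Gauss.init b)).2.1 (List.ofFn fun i => atom (b i)) (by simp)
    rw [dec_nil, smul_zero, sub_zero] at k₂
    refine (bnd_pure (d' := .pair (.pair (Gauss.unit 0) .nil) (encMat A)) rfl (fold_expr hb)
      (bnd_pure (d' := .pair (encGauss (Gauss.init b)) (encMat A)) rfl k (pre_runs rfl k₂))).mono ?_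
    have h1 : 1 ≤ (n + 1) ^ 3 := Nat.one_le_pow _ _ (Nat.succ_pos n)
    have h2 : 1 ≤ n + 1 := Nat.le_add_left _ _
    have h4 : 1 ≤ (n + 1) * (n + 1) := Nat.mul_pos h2 h2
    have h3 : n + 1 ≤ (n + 1) ^ 3 := by
      calc n + 1 = (n + 1) ^ 1 := (pow_one _).symm
        _ ≤ _ := Nat.pow_le_pow_right h2 (by norm_num)
    have h5 : n ≤ 1 * (n + 1) := by omega
    rw [List.length_ofFn]
    rw [show (n + 1) ^ 3 = (n + 1) * ((n + 1) * (n + 1)) by ring] at h1 h3 ⊢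
    exact Nat.add_le_const_mul (Nat.add_le_const_mul (Nat.mul_le_mul_left _ h3)
      (Nat.add_le_const_mul (Nat.add_le_const_mul (Nat.add_le_const_mul (Nat.mul_le_const_mul h5
        (Nat.add_le_const_mul le_rfl (Nat.le_const_mul h4 _))) (Nat.le_const_mul h1 _))
        (Nat.add_le_const_mul (Nat.mul_le_mul_left _ h3) (Nat.le_const_mul h1 _)))
        (Nat.le_const_mul h1 _))) (Nat.le_const_mul h1 _)
  · rintro A' rfl
    exact Gauss.foldl_step_correct A' b

end TreeProg

/-! ### Couplings -/

/-- There is a coupling of the two distributions that is supported on the relation. -/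
def PMF.Lift {α β : Type*} (R : α → β → Prop) (μ : PMF α) (ν : PMF β) : Prop :=
  ∃ ρ : PMF (α × β), ρ.map Prod.fst = μ ∧ ρ.map Prod.snd = ν ∧ ∀ p ∈ ρ.support, R p.1 p.2

namespace PMF.Lift

variable {α β γ δ : Type*} {R : α → β → Prop} {μ : PMF α} {ν : PMF β}

theorem exists_left (h : Lift R μ ν) {b : β} (hb : b ∈ ν.support) : ∃ a ∈ μ.support, R a b := by
  obtain ⟨ρ, rfl, rfl, h⟩ := h
  obtain ⟨p, hp, rfl⟩ := (PMF.mem_support_map_iff _ _ _).1 hb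
  exact ⟨p.1, (PMF.mem_support_map_iff _ _ _).2 ⟨p, hp, rfl⟩, h p hp⟩

/-- The product coupling suffices when the relation depends on the right-hand outcome only. This
handles runs whose clock has already stopped and which no longer follow the original program. -/
theorem of_right (h : ∀ a, ∀ b ∈ ν.support, R a b) : Lift R μ ν := by
  refine ⟨μ.bind fun a => ν.map (Prod.mk a), ?_, ?_, ?_⟩
  · rw [PMF.map_bind]
    refine Eq.trans (congrArg _ (funext fun a => ?_)) (PMF.bind_pure μ)
    rw [PMF.map_comp]
    exact PMF.map_const ν a
  · rw [PMF.map_bind]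
    refine Eq.trans (congrArg _ (funext fun a => ?_)) (PMF.bind_const μ ν)
    rw [PMF.map_comp]
    exact PMF.map_id ν
  · intro p hp
    obtain ⟨a, -, hp⟩ := (PMF.mem_support_bind_iff _ _ _).1 hp
    obtain ⟨b, hb, rfl⟩ := (PMF.mem_support_map_iff _ _ _).1 hp
    exact h a b hb

/-- Conditional couplings are glued: draw a pair from the first coupling, then from the coupling
chosen for this pair. -/
theorem bind {S : γ → δ → Prop} {f : α → PMF γ} {g : β → PMF δ} (h : Lift R μ ν)
    (k : ∀ a ∈ μ.support, ∀ b ∈ ν.support, R a b → Lift S (f a) (g b)) :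
    Lift S (μ.bind f) (ν.bind g) := by
  classical
  obtain ⟨ρ, rfl, rfl, h⟩ := h
  have k' : ∀ p ∈ ρ.support, Lift S (f p.1) (g p.2) := fun p hp =>
    k _ ((PMF.mem_support_map_iff _ _ _).2 ⟨p, hp, rfl⟩) _
      ((PMF.mem_support_map_iff _ _ _).2 ⟨p, hp, rfl⟩) (h p hp)
  have : Nonempty (PMF (γ × δ)) := by
    obtain ⟨p, hp⟩ := ρ.support_nonempty
    exact ⟨(k' p hp).choose⟩
  choose! σ hσ using k'
  refine ⟨ρ.bind σ, ?_, ?_, ?_⟩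
  · rw [PMF.map_bind, PMF.bind_map]
    exact PMF.bind_congr_support _ fun p hp => (hσ p hp).1
  · rw [PMF.map_bind, PMF.bind_map]
    exact PMF.bind_congr_support _ fun p hp => (hσ p hp).2.1
  · intro q hq
    obtain ⟨p, hp, hq⟩ := (PMF.mem_support_bind_iff _ _ _).1 hq
    exact (hσ p hp).2.2 q hq

theorem pure {a : α} {b : β} (h : R a b) : Lift R (PMF.pure a) (PMF.pure b) := by
  refine ⟨PMF.pure (a, b), PMF.pure_map _ _, PMF.pure_map _ _, fun p hp => ?_⟩
  rw [PMF.support_pure, Set.mem_singleton_iff] at hp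
  rwa [hp]

theorem map {S : γ → δ → Prop} {f : α → γ} {g : β → δ} (h : Lift R μ ν)
    (k : ∀ a ∈ μ.support, ∀ b ∈ ν.support, R a b → S (f a) (g b)) :
    Lift S (μ.map f) (ν.map g) :=
  h.bind fun a ha b hb hab => pure (k a ha b hb hab)

theorem map_same {S : γ → δ → Prop} {f : α → γ} {g : α → δ} (k : ∀ a, S (f a) (g a)) :
    Lift S (μ.map f) (μ.map g) := by
  refine ⟨μ.map fun a => (f a, g a), ?_, ?_, fun p hp => ?_⟩
  · rw [PMF.map_comp]; rfl
  · rw [PMF.map_comp]; rfl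
  · obtain ⟨a, -, rfl⟩ := (PMF.mem_support_map_iff _ _ _).1 hp
    exact k a

theorem measure_le (h : Lift R μ ν) {s : Set α} {t : Set β} (hst : ∀ a b, R a b → a ∈ s → b ∈ t) :
    μ.toOuterMeasure s ≤ ν.toOuterMeasure t := by
  obtain ⟨ρ, rfl, rfl, h⟩ := h
  rw [PMF.toOuterMeasure_map_apply, PMF.toOuterMeasure_map_apply]
  exact PMF.toOuterMeasure_mono _ fun p hp => hst _ _ (h p hp.2) hp.1

end PMF.Lift

namespace TreeData

variable {F : Type*}

/-- The number of entries of a list. -/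
def len : TreeData F → ℕ
  | pair _ r => r.len + 1
  | _ => 0

theorem len_ofList (l : List (TreeData F)) : (ofList l).len = l.length := by
  induction l with
  | nil => rfl
  | cons e l ih => simp [ofList, len, ih]

end TreeData

/-! ### Programs with a clock -/

namespace TreeProg

open TreeData

variable {F : Type*}

/-- One tick of the clock: count down the three-digit number in the variables `N`, `N + 1`,
`N + 2`, where the largest digit is in `N + 3`.  At the end the variable `N + 4` is cleared. -/
def tick (N : ℕ) : TreeProg F :=
  ite (.isPair (.var N)) (assign N (.tl (.var N)))
    (ite (.isPair (.var (N + 1))) (seq (assign (N + 1) (.tl (.var (N + 1))))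
        (assign N (.var (N + 3))))
      (ite (.isPair (.var (N + 2))) (seq (assign (N + 2) (.tl (.var (N + 2))))
          (seq (assign (N + 1) (.var (N + 3))) (assign N (.var (N + 3)))))
        (assign (N + 4) .nil)))

/-- Evaluate the condition of a loop; after the end of the time the condition is false. -/
def prep (N : ℕ) (e : TreeExpr F) : TreeProg F :=
  ite (.var (N + 4)) (assign (N + 5) e) (assign (N + 5) .nil)

/-- The program with a clock that ticks in every round of every loop. -/
def clk (N : ℕ) : TreeProg F → TreeProg F
  | assign x e => assign x e
  | flip x => flip x
  | rand x => rand x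
  | seq c₁ c₂ => seq (clk N c₁) (clk N c₂)
  | ite e c₁ c₂ => ite e (clk N c₁) (clk N c₂)
  | loop e c => seq (prep N e) (loop (.var (N + 5)) (seq (tick N) (seq (clk N c) (prep N e))))

/-- The slowdown caused by the clock. -/
def clkK : TreeProg F → ℕ
  | assign _ e => e.cost + 1
  | flip _ => 1
  | rand _ => 1
  | seq c₁ c₂ => clkK c₁ + clkK c₂
  | ite e c₁ c₂ => e.cost + clkK c₁ + clkK c₂ + 1
  | loop e c => 60 + 2 * e.cost + clkK c

/-- The number of ticks that are left. -/
def rem (N : ℕ) (s : TreeStore F) : ℕ :=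
  (s N).len + ((s (N + 3)).len + 1) * (s (N + 1)).len + ((s (N + 3)).len + 1) ^ 2 * (s (N + 2)).len

/-- If the clock has stopped, then no ticks are left. -/
def ClockOK (N : ℕ) (s : TreeStore F) : Prop := s (N + 4) = .nil → rem N s = 0

theorem rem_congr {N : ℕ} {s s' : TreeStore F} (h : ∀ x, N ≤ x → x ≤ N + 4 → s' x = s x) :
    rem N s' = rem N s := by
  simp [rem, h]

theorem rem_update {N x : ℕ} (hx : x + 1 ≤ N) (s : TreeStore F) (v : TreeData F) :
    rem N (Function.update s x v) = rem N s :=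
  rem_congr fun _ _ _ => Function.update_of_ne (by omega) _ _

theorem ClockOK.congr {N : ℕ} {s s' : TreeStore F} (hs : ClockOK N s)
    (h : ∀ x, N ≤ x → x ≤ N + 4 → s' x = s x) : ClockOK N s' := by
  rw [ClockOK, rem_congr h, h _ (by omega) le_rfl]
  exact hs

variable [Field F] [Fintype F] [DecidableEq F]

/-- Counting down with borrow in base `len X_{N+3} + 1`. When all digits are zero the tick stops the
clock. Thus each tick uses up at most one unit, and exactly one unit as long as the clock does not
stop. -/
theorem tick_runs (N : ℕ) (s : TreeStore F) (hs : ClockOK N s) : ∃ s',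
    Runs (tick N) s 20 (PMF.pure s') ∧ (∀ x < N, s' x = s x) ∧ ClockOK N s' ∧
    rem N s ≤ rem N s' + 1 ∧ (rem N s' + 1 ≤ rem N s ∨ s' (N + 4) = .nil) ∧ rem N s' ≤ rem N s := by
  have hd : ∀ d : TreeData F, (∃ a b, d = .pair a b) ∨ (d.isPair = false ∧ d.len = 0) := by
    intro d
    cases d with
    | pair a b => exact .inl ⟨a, b, rfl⟩
    | nil => exact .inr ⟨rfl, rfl⟩
    | atom a => exact .inr ⟨rfl, rfl⟩
  have hT : ∀ (x : ℕ) (a b : TreeData F), s x = .pair a b →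
      ((TreeExpr.isPair (.var x)).eval s).IsTrue := fun x a b h => by
    simp [h, TreeData.isPair, ofBool, IsTrue, tt]
  have hF : ∀ x : ℕ, (s x).isPair = false →
      ¬ ((TreeExpr.isPair (.var x)).eval s).IsTrue := fun x h => by
    simp [h, ofBool, IsTrue]
  rcases hd (s N) with ⟨a, b, h1⟩ | ⟨h1, k1⟩
  · refine ⟨Function.update s N b, .ite_true (hT _ _ _ h1) ((Runs.assign le_rfl).of_eq
      (by simp [h1])) (by simp [TreeExpr.cost]), fun x hx => by simp [hx.ne], ?_, ?_, .inl ?_, ?_⟩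
    · intro h
      have := hs (by simpa using h)
      simp [rem, h1, len] at this
    · simp [rem, h1, len]; omega
    · simp [rem, h1, len]
    · simp [rem, h1, len]
  rcases hd (s (N + 1)) with ⟨a, b, h2⟩ | ⟨h2, k2⟩
  · refine ⟨Function.update (Function.update s (N + 1) b) N (s (N + 3)), .ite_false (hF _ h1)
      (.ite_true (hT _ _ _ h2) (((Runs.assign le_rfl).of_eq (by simp [h2]; rfl)).seq_pure
      ((Runs.assign le_rfl).of_eq (by simp))) le_rfl) (by simp [TreeExpr.cost]), ?_, ?_⟩
    · intro x hx
      rw [Function.update_of_ne (by omega), Function.update_of_ne (by omega)]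
    have e : rem N s = rem N (Function.update (Function.update s (N + 1) b) N (s (N + 3))) + 1 := by
      simp [rem, h2, len, k1]
      ring
    refine ⟨fun h => ?_, e.le, .inl e.ge, by omega⟩
    have := hs (by simpa using h)
    omega
  rcases hd (s (N + 2)) with ⟨a, b, h3⟩ | ⟨h3, k3⟩
  · refine ⟨Function.update (Function.update (Function.update s (N + 2) b) (N + 1) (s (N + 3))) N
      (s (N + 3)), .ite_false (hF _ h1) (.ite_false (hF _ h2) (.ite_true (hT _ _ _ h3)
      (((Runs.assign le_rfl).of_eq (by simp [h3]; rfl)).seq_pure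
      (((Runs.assign le_rfl).of_eq (by simp; rfl)).seq_pure ((Runs.assign le_rfl).of_eq
      (by simp)))) le_rfl) le_rfl) (by simp [TreeExpr.cost]), ?_, ?_⟩
    · intro x hx
      rw [Function.update_of_ne (by omega), Function.update_of_ne (by omega),
        Function.update_of_ne (by omega)]
    have e : rem N s = rem N (Function.update (Function.update (Function.update s (N + 2) b) (N + 1)
        (s (N + 3))) N (s (N + 3))) + 1 := by
      simp [rem, h3, len, k1, k2]
      ring
    refine ⟨fun h => ?_, e.le, .inl e.ge, by omega⟩
    have := hs (by simpa using h)
    omega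
  · have h0 : rem N s = 0 := by simp [rem, k1, k2, k3]
    have h0' : rem N (Function.update s (N + 4) .nil) = 0 := by simp [rem, k1, k2, k3]
    refine ⟨Function.update s (N + 4) .nil, .ite_false (hF _ h1) (.ite_false (hF _ h2)
      (.ite_false (hF _ h3) ((Runs.assign le_rfl).of_eq rfl) le_rfl) le_rfl)
      (by simp [TreeExpr.cost]), fun x hx => Function.update_of_ne (by omega) _ _,
      fun _ => h0', by omega, .inr (by simp), by omega⟩

/-- The result of `prep`. -/
noncomputable def prepStore (N : ℕ) (e : TreeExpr F) (s : TreeStore F) : TreeStore F :=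
  open Classical in Function.update s (N + 5) (if s (N + 4) = .nil then .nil else e.eval s)

omit [Fintype F] in
theorem prepStore_of_ne (N : ℕ) (e : TreeExpr F) (s : TreeStore F) {x : ℕ} (hx : x ≠ N + 5) :
    prepStore N e s x = s x := Function.update_of_ne hx _ _

theorem prep_runs (N : ℕ) (e : TreeExpr F) (s : TreeStore F) :
    Runs (prep N e) s (e.cost + 4) (PMF.pure (prepStore N e s)) := by
  by_cases h : s (N + 4) = .nil
  · refine .ite_false (by simp [h, IsTrue]) ((Runs.assign le_rfl).of_eq ?_)
      (by simp [TreeExpr.cost])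
    simp [prepStore, h]
  · refine .ite_true (by simpa [IsTrue]) ((Runs.assign le_rfl).of_eq ?_)
      (by simp [TreeExpr.cost]; omega)
    simp [prepStore, h]

/-- A clocked loop starts with `prep`, and so does what follows each of its rounds. Removing this
deterministic prefix turns the induction hypothesis on the whole clocked loop into a statement about
the inner loop. -/
theorem Runs.seq_pure_inv {c₁ c₂ : TreeProg F} {s s' : TreeStore F} {t t₁ : ℕ}
    {ν : PMF (TreeStore F)} (h : Runs (.seq c₁ c₂) s t ν) (h₁ : Runs c₁ s t₁ (PMF.pure s')) :
    Runs c₂ s' t ν := by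
  cases h with
  | seq k₁ k₂ ht =>
    cases k₁.unique h₁
    rw [PMF.pure_bind]
    exact (k₂ s' (by simp)).mono (by omega)

/-- After the end of the time the program stops at once. -/
theorem clk_runs_of_stopped {N : ℕ} (c : TreeProg F) (hc : c.bd ≤ N) (s : TreeStore F)
    (hs : ClockOK N s) (h : s (N + 4) = .nil) : Runs (clk N c) s (clkK c) ((clk N c).store s) ∧
      ∀ b ∈ ((clk N c).store s).support, ClockOK N b ∧ b (N + 4) = .nil := by
  induction c generalizing s with
  | assign x e =>
    have hx : x + 1 ≤ N := (le_max_left _ _).trans hc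
    have k : Runs (assign x e) s (e.cost + 1) _ := .assign le_rfl
    refine ⟨k.run_store, fun b hb => ?_⟩
    rw [clk, k.eq_store, PMF.support_pure, Set.mem_singleton_iff] at hb
    subst hb
    exact ⟨hs.congr fun y hy _ => Function.update_of_ne (by omega) _ _,
      (Function.update_of_ne (by omega) _ _).trans h⟩
  | flip x =>
    have hx : x + 1 ≤ N := hc
    have k : Runs (flip x) s 1 _ := .flip le_rfl
    refine ⟨k.run_store, fun b hb => ?_⟩
    rw [clk, k.eq_store] at hb
    obtain ⟨v, -, rfl⟩ := (PMF.mem_support_map_iff _ _ _).1 hb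
    exact ⟨hs.congr fun y hy _ => Function.update_of_ne (by omega) _ _,
      (Function.update_of_ne (by omega) _ _).trans h⟩
  | rand x =>
    have hx : x + 1 ≤ N := hc
    have k : Runs (rand x) s 1 _ := .rand le_rfl
    refine ⟨k.run_store, fun b hb => ?_⟩
    rw [clk, k.eq_store] at hb
    obtain ⟨v, -, rfl⟩ := (PMF.mem_support_map_iff _ _ _).1 hb
    exact ⟨hs.congr fun y hy _ => Function.update_of_ne (by omega) _ _,
      (Function.update_of_ne (by omega) _ _).trans h⟩
  | seq c₁ c₂ ih₁ ih₂ =>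
    obtain ⟨h1, h2⟩ := ih₁ ((le_max_left _ _).trans hc) s hs h
    have h3 := fun b hb => ih₂ ((le_max_right _ _).trans hc) b (h2 b hb).1 (h2 b hb).2
    have k : Runs (clk N (seq c₁ c₂)) s (clkK (seq c₁ c₂)) _ :=
      .seq h1 (fun b hb => (h3 b hb).1) le_rfl
    refine ⟨k.run_store, fun b hb => ?_⟩
    rw [k.eq_store] at hb
    obtain ⟨a, ha, hb⟩ := (PMF.mem_support_bind_iff _ _ _).1 hb
    exact (h3 a ha).2 b hb
  | ite e c₁ c₂ ih₁ ih₂ =>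
    have hc' := (max_le_iff.1 (max_le_iff.1 hc).2)
    by_cases he : (e.eval s).IsTrue
    · obtain ⟨h1, h2⟩ := ih₁ hc'.1 s hs h
      have k : Runs (clk N (ite e c₁ c₂)) s (clkK (ite e c₁ c₂)) _ :=
        .ite_true he h1 (by simp only [clkK]; omega)
      exact ⟨k.run_store, by rw [k.eq_store]; exact h2⟩
    · obtain ⟨h1, h2⟩ := ih₂ hc'.2 s hs h
      have k : Runs (clk N (ite e c₁ c₂)) s (clkK (ite e c₁ c₂)) _ :=
        .ite_false he h1 (by simp only [clkK]; omega)
      exact ⟨k.run_store, by rw [k.eq_store]; exact h2⟩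
  | loop e c ih =>
    have k : Runs (clk N (loop e c)) s (clkK (loop e c)) _ :=
      ((prep_runs N e s).seq_pure (Runs.loop_false (t := 2) (by simp [prepStore, h, IsTrue])
        (by simp [TreeExpr.cost]))).mono (by simp only [clkK]; omega)
    refine ⟨k.run_store, fun b hb => ?_⟩
    rw [k.eq_store, PMF.support_pure, Set.mem_singleton_iff] at hb
    subst hb
    exact ⟨hs.congr fun y _ _ => prepStore_of_ne _ _ _ (by omega),
      (prepStore_of_ne _ _ _ (by omega)).trans h⟩

/-- The relation between the final stores of a program and of its version with a clock. -/
def ClockRel (N r t : ℕ) (a b : TreeStore F) : Prop :=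
  ClockOK N b ∧ r ≤ rem N b + t ∧ (b (N + 4) ≠ .nil → ∀ x < N, b x = a x)

/-- Both programs run on the same coins as long as the clock runs, and then agree on the variables
below `N`. A loop round costs at least one step and one tick, so at most `t` ticks are spent. After
the clock has stopped nothing is claimed about the contents, only that the run ends. -/
theorem Runs.clk {N : ℕ} {c : TreeProg F} {s : TreeStore F} {t : ℕ} {μ : PMF (TreeStore F)}
    (h : Runs c s t μ) : c.bd ≤ N → ∀ s', ClockOK N s' →
      (s' (N + 4) ≠ .nil → ∀ x < N, s' x = s x) →
      Runs (clk N c) s' (clkK c * t) ((clk N c).store s') ∧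
      PMF.Lift (ClockRel N (rem N s') t) μ ((clk N c).store s') := by
  -- With a stopped clock the remaining ticks are zero and agreement is not demanded, so any
  -- coupling will do.
  have hhalt : ∀ {c : TreeProg F} {s : TreeStore F} {t : ℕ} {μ : PMF (TreeStore F)}
      (_ : Runs c s t μ) (_ : c.bd ≤ N) (s' : TreeStore F), ClockOK N s' → s' (N + 4) = .nil →
      Runs (TreeProg.clk N c) s' (clkK c * t) ((TreeProg.clk N c).store s') ∧
      PMF.Lift (ClockRel N (rem N s') t) μ ((TreeProg.clk N c).store s') := by
    intro c s t μ h hc s' hs' h4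
    obtain ⟨h1, h2⟩ := clk_runs_of_stopped c hc s' hs' h4
    refine ⟨h1.mono (Nat.le_mul_of_pos_right _ h.one_le), PMF.Lift.of_right fun a b hb =>
      ⟨(h2 b hb).1, ?_, fun h => absurd (h2 b hb).2 h⟩⟩
    rw [hs' h4]
    exact Nat.zero_le _
  induction h with
  | @assign x e s t ht =>
    intro hc s' hs' hag
    by_cases h4 : s' (N + 4) = .nil
    · exact hhalt (.assign ht) hc s' hs' h4
    replace hag := hag h4
    have hx : x + 1 ≤ N := (le_max_left _ _).trans hc
    have k : Runs (TreeProg.assign x e) s' t _ := .assign ht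
    refine ⟨k.run_store.mono (Nat.le_mul_of_pos_left _ (by simp [clkK])), ?_⟩
    rw [TreeProg.clk, k.eq_store]
    refine PMF.Lift.pure ⟨hs'.congr fun y hy _ => Function.update_of_ne (by omega) _ _, ?_, ?_⟩
    · exact Nat.le_add_right_of_le (rem_update hx _ _).ge
    · intro _ y hy
      rw [e.eval_congr fun z hz => hag z (hz.trans_le ((le_max_right _ _).trans hc))]
      simp only [Function.update_apply, hag y hy]
  | @flip x s t ht =>
    intro hc s' hs' hag
    by_cases h4 : s' (N + 4) = .nil
    · exact hhalt (.flip ht) hc s' hs' h4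
    replace hag := hag h4
    have hx : x + 1 ≤ N := hc
    have k : Runs (TreeProg.flip x) s' t _ := .flip ht
    refine ⟨k.run_store.mono (Nat.le_mul_of_pos_left _ (by simp [clkK])), ?_⟩
    rw [TreeProg.clk, k.eq_store]
    refine PMF.Lift.map_same fun v =>
      ⟨hs'.congr fun y hy _ => Function.update_of_ne (by omega) _ _, ?_, ?_⟩
    · exact Nat.le_add_right_of_le (rem_update hx _ _).ge
    · intro _ y hy
      simp only [Function.update_apply, hag y hy]
  | @rand x s t ht =>
    intro hc s' hs' hag
    by_cases h4 : s' (N + 4) = .nil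
    · exact hhalt (.rand ht) hc s' hs' h4
    replace hag := hag h4
    have hx : x + 1 ≤ N := hc
    have k : Runs (TreeProg.rand x) s' t _ := .rand ht
    refine ⟨k.run_store.mono (Nat.le_mul_of_pos_left _ (by simp [clkK])), ?_⟩
    rw [TreeProg.clk, k.eq_store]
    refine PMF.Lift.map_same fun v =>
      ⟨hs'.congr fun y hy _ => Function.update_of_ne (by omega) _ _, ?_, ?_⟩
    · exact Nat.le_add_right_of_le (rem_update hx _ _).ge
    · intro _ y hy
      simp only [Function.update_apply, hag y hy]
  | @seq c₁ c₂ s t t₁ t₂ μ ν h₁ h₂ ht ih₁ ih₂ =>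
    intro hc s' hs' hag
    obtain ⟨h1, h2⟩ := ih₁ ((le_max_left _ _).trans hc) s' hs' hag
    have h3 := fun a ha b hab => ih₂ a ha ((le_max_right _ _).trans hc) b
      (show ClockRel N (rem N s') t₁ a b from hab).1 hab.2.2
    have k : Runs (TreeProg.clk N (.seq c₁ c₂)) s' (clkK (.seq c₁ c₂) * t) _ :=
      .seq h1 (fun b hb => by
        obtain ⟨a, ha, hab⟩ := h2.exists_left hb
        exact (h3 a ha b hab).1) (by simp only [clkK]; nlinarith)
    refine ⟨k.run_store, ?_⟩
    rw [k.eq_store]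
    refine h2.bind fun a ha b hb hab => ?_
    obtain ⟨-, ρ, e1, e2, h4⟩ := h3 a ha b hab
    refine ⟨ρ, e1, e2, fun p hp => ⟨(h4 p hp).1, ?_, (h4 p hp).2.2⟩⟩
    have := hab.2.1
    have := (h4 p hp).2.1
    omega
  | @ite_true e c₁ c₂ s t t₁ μ he h ht ih =>
    intro hc s' hs' hag
    by_cases h4 : s' (N + 4) = .nil
    · exact hhalt (.ite_true he h ht) hc s' hs' h4
    obtain ⟨h1, ρ, e1, e2, h2⟩ := ih (max_le_iff.1 (max_le_iff.1 hc).2).1 s' hs' hag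
    have k : Runs (TreeProg.clk N (.ite e c₁ c₂)) s' (clkK (.ite e c₁ c₂) * t) _ :=
      .ite_true (by rwa [e.eval_congr fun z hz => hag h4 z (hz.trans_le (max_le_iff.1 hc).1)]) h1
        (by simp only [clkK]; have := h.one_le; nlinarith)
    refine ⟨k.run_store, ?_⟩
    rw [k.eq_store]
    refine ⟨ρ, e1, e2, fun p hp => ⟨(h2 p hp).1, ?_, (h2 p hp).2.2⟩⟩
    have := (h2 p hp).2.1
    omega
  | @ite_false e c₁ c₂ s t t₁ μ he h ht ih =>
    intro hc s' hs' hag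
    by_cases h4 : s' (N + 4) = .nil
    · exact hhalt (.ite_false he h ht) hc s' hs' h4
    obtain ⟨h1, ρ, e1, e2, h2⟩ := ih (max_le_iff.1 (max_le_iff.1 hc).2).2 s' hs' hag
    have k : Runs (TreeProg.clk N (.ite e c₁ c₂)) s' (clkK (.ite e c₁ c₂) * t) _ :=
      .ite_false (by rwa [e.eval_congr fun z hz => hag h4 z (hz.trans_le (max_le_iff.1 hc).1)]) h1
        (by simp only [clkK]; have := h.one_le; nlinarith)
    refine ⟨k.run_store, ?_⟩
    rw [k.eq_store]
    refine ⟨ρ, e1, e2, fun p hp => ⟨(h2 p hp).1, ?_, (h2 p hp).2.2⟩⟩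
    have := (h2 p hp).2.1
    omega
  | @loop_true e c s t t₁ t₂ μ ν he h₁ h₂ ht ih₁ ih₂ =>
    intro hc s' hs' hag
    by_cases h4 : s' (N + 4) = .nil
    · exact hhalt (.loop_true he h₁ h₂ ht) hc s' hs' h4
    have he' : ((prepStore N e s') (N + 5)).IsTrue := by
      rw [prepStore, Function.update_self, if_neg h4,
        e.eval_congr fun z hz => hag h4 z (hz.trans_le (max_le_iff.1 hc).1)]
      exact he
    have hps : ∀ x, N ≤ x → x ≤ N + 4 → prepStore N e s' x = s' x :=
      fun x _ _ => prepStore_of_ne _ _ _ (by omega)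
    obtain ⟨s₁, k1, k2, k3, k4, k5, -⟩ := tick_runs N (prepStore N e s') (hs'.congr hps)
    rw [rem_congr hps] at k4
    obtain ⟨h1, h2⟩ := ih₁ (max_le_iff.1 hc).2 s₁ k3 fun _ x hx => by
      rw [k2 x hx, prepStore_of_ne _ _ _ (by omega), hag h4 x hx]
    have h3 := fun a ha b hab => ih₂ a ha hc b
      (show ClockRel N (rem N s₁) t₁ a b from hab).1 hab.2.2
    have kb : Runs (.seq (tick N) (.seq (TreeProg.clk N c) (prep N e))) (prepStore N e s')
        (20 + (clkK c * t₁ + (e.cost + 4))) (((TreeProg.clk N c).store s₁).map (prepStore N e)) :=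
      k1.seq_pure (Runs.seq h1 (fun b _ => prep_runs N e b) le_rfl)
    have kl := Runs.loop_map (e := .var (N + 5)) he' kb (t₂ := clkK (.loop e c) * t₂)
      (ν := (TreeProg.clk N (.loop e c)).store) fun b hb => by
        obtain ⟨a, ha, hab⟩ := h2.exists_left hb
        exact (h3 a ha b hab).1.seq_pure_inv (prep_runs N e b)
    have k : Runs (TreeProg.clk N (.loop e c)) s' (clkK (.loop e c) * t) _ :=
      ((prep_runs N e s').seq_pure kl).mono (by
        refine le_trans ?_ (Nat.mul_le_mul_left _ ht)
        simp only [clkK, TreeExpr.cost]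
        nlinarith [Nat.zero_le (e.cost * t₁), Nat.zero_le (e.cost * e.cost),
          Nat.zero_le (clkK c * e.cost)])
    refine ⟨k.run_store, ?_⟩
    rw [k.eq_store]
    refine h2.bind fun a ha b hb hab => ?_
    obtain ⟨-, ρ, e1, e2, h4⟩ := h3 a ha b hab
    refine ⟨ρ, e1, e2, fun p hp => ⟨(h4 p hp).1, ?_, (h4 p hp).2.2⟩⟩
    have := hab.2.1
    have := (h4 p hp).2.1
    omega
  | @loop_false e c s t he ht =>
    intro hc s' hs' hag
    by_cases h4 : s' (N + 4) = .nil
    · exact hhalt (.loop_false he ht) hc s' hs' h4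
    have he' : ¬ ((prepStore N e s') (N + 5)).IsTrue := by
      rw [prepStore, Function.update_self, if_neg h4,
        e.eval_congr fun z hz => hag h4 z (hz.trans_le (max_le_iff.1 hc).1)]
      exact he
    have k : Runs (TreeProg.clk N (.loop e c)) s' (clkK (.loop e c) * t) _ :=
      ((prep_runs N e s').seq_pure (Runs.loop_false (e := .var (N + 5)) (t := 2) he'
        (by simp [TreeExpr.cost]))).mono (by
          simp only [clkK]
          have : 1 ≤ t := by omega
          nlinarith)
    refine ⟨k.run_store, ?_⟩
    rw [k.eq_store]
    refine PMF.Lift.pure ⟨hs'.congr fun y _ _ => prepStore_of_ne _ _ _ (by omega), ?_, ?_⟩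
    · rw [rem_congr (s := s') fun y _ _ => prepStore_of_ne _ _ _ (by omega)]
      omega
    · intro _ x hx
      rw [prepStore_of_ne _ _ _ (by omega), hag h4 x hx]

/-- A program with a clock stops after polynomially many steps. -/
theorem clk_runs_poly {N : ℕ} (c : TreeProg F) (hc : c.bd ≤ N) : ∃ K d, ∀ s, ClockOK N s →
    Runs (clk N c) s (K * (rem N s + 1) ^ d) ((clk N c).store s) ∧
      ∀ b ∈ ((clk N c).store s).support, ClockOK N b ∧ rem N b ≤ rem N s ∧
        (s (N + 4) = .nil → b (N + 4) = .nil) := by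
  induction c with
  | assign x e =>
    refine ⟨e.cost + 1, 0, fun s hs => ?_⟩
    have hx : x + 1 ≤ N := (le_max_left _ _).trans hc
    have k : Runs (assign x e) s ((e.cost + 1) * (rem N s + 1) ^ 0) _ := .assign (by simp)
    refine ⟨k.run_store, fun b hb => ?_⟩
    rw [clk, k.eq_store, PMF.support_pure, Set.mem_singleton_iff] at hb
    subst hb
    exact ⟨hs.congr fun y hy _ => Function.update_of_ne (by omega) _ _, (rem_update hx _ _).le,
      (Function.update_of_ne (by omega) _ _).trans⟩
  | flip x =>
    refine ⟨1, 0, fun s hs => ?_⟩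
    have hx : x + 1 ≤ N := hc
    have k : Runs (flip x) s (1 * (rem N s + 1) ^ 0) _ := .flip (by simp)
    refine ⟨k.run_store, fun b hb => ?_⟩
    rw [clk, k.eq_store] at hb
    obtain ⟨v, -, rfl⟩ := (PMF.mem_support_map_iff _ _ _).1 hb
    exact ⟨hs.congr fun y hy _ => Function.update_of_ne (by omega) _ _, (rem_update hx _ _).le,
      (Function.update_of_ne (by omega) _ _).trans⟩
  | rand x =>
    refine ⟨1, 0, fun s hs => ?_⟩
    have hx : x + 1 ≤ N := hc
    have k : Runs (rand x) s (1 * (rem N s + 1) ^ 0) _ := .rand (by simp)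
    refine ⟨k.run_store, fun b hb => ?_⟩
    rw [clk, k.eq_store] at hb
    obtain ⟨v, -, rfl⟩ := (PMF.mem_support_map_iff _ _ _).1 hb
    exact ⟨hs.congr fun y hy _ => Function.update_of_ne (by omega) _ _, (rem_update hx _ _).le,
      (Function.update_of_ne (by omega) _ _).trans⟩
  | seq c₁ c₂ ih₁ ih₂ =>
    obtain ⟨K₁, d₁, h₁⟩ := ih₁ ((le_max_left _ _).trans hc)
    obtain ⟨K₂, d₂, h₂⟩ := ih₂ ((le_max_right _ _).trans hc)
    refine ⟨K₁ + K₂, d₁ + d₂, fun s hs => ?_⟩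
    obtain ⟨h1, h2⟩ := h₁ s hs
    have h3 := fun b hb => h₂ b (h2 b hb).1
    have hp := Nat.succ_pos (rem N s)
    have k : Runs (clk N (seq c₁ c₂)) s ((K₁ + K₂) * (rem N s + 1) ^ (d₁ + d₂)) _ :=
      .seq h1 (t₂ := K₂ * (rem N s + 1) ^ d₂) (fun b hb => (h3 b hb).1.mono (Nat.mul_le_mul_left _
        (Nat.pow_le_pow_left (by have := (h2 b hb).2.1; omega) _)))
        (Nat.add_le_const_mul (Nat.mul_le_mul_left _ (Nat.pow_le_pow_right hp (by omega)))
          (Nat.mul_le_mul_left _ (Nat.pow_le_pow_right hp (by omega))))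
    refine ⟨k.run_store, fun b hb => ?_⟩
    rw [k.eq_store] at hb
    obtain ⟨a, ha, hb⟩ := (PMF.mem_support_bind_iff _ _ _).1 hb
    obtain ⟨g1, g2, g3⟩ := (h3 a ha).2 b hb
    exact ⟨g1, g2.trans (h2 a ha).2.1, fun h => g3 ((h2 a ha).2.2 h)⟩
  | ite e c₁ c₂ ih₁ ih₂ =>
    have hc' := (max_le_iff.1 (max_le_iff.1 hc).2)
    obtain ⟨K₁, d₁, h₁⟩ := ih₁ hc'.1
    obtain ⟨K₂, d₂, h₂⟩ := ih₂ hc'.2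
    refine ⟨e.cost + 1 + K₁ + K₂, d₁ + d₂, fun s hs => ?_⟩
    have hp := Nat.succ_pos (rem N s)
    have hp2 : 1 ≤ (rem N s + 1) ^ (d₁ + d₂) := Nat.one_le_pow _ _ hp
    have e1 : (rem N s + 1) ^ d₁ ≤ (rem N s + 1) ^ (d₁ + d₂) :=
      Nat.pow_le_pow_right hp (by omega)
    have e2 : (rem N s + 1) ^ d₂ ≤ (rem N s + 1) ^ (d₁ + d₂) :=
      Nat.pow_le_pow_right hp (by omega)
    by_cases he : (e.eval s).IsTrue
    · obtain ⟨h1, h2⟩ := h₁ s hs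
      have k : Runs (clk N (ite e c₁ c₂)) s ((e.cost + 1 + K₁ + K₂) * (rem N s + 1) ^ (d₁ + d₂)) _ :=
        .ite_true he h1 (by nlinarith)
      exact ⟨k.run_store, by rw [k.eq_store]; exact h2⟩
    · obtain ⟨h1, h2⟩ := h₂ s hs
      have k : Runs (clk N (ite e c₁ c₂)) s ((e.cost + 1 + K₁ + K₂) * (rem N s + 1) ^ (d₁ + d₂)) _ :=
        .ite_false he h1 (by nlinarith)
      exact ⟨k.run_store, by rw [k.eq_store]; exact h2⟩
  | loop e c ih =>
    obtain ⟨K, d, h⟩ := ih (max_le_iff.1 hc).2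
    let L : TreeProg F := loop (.var (N + 5)) (seq (tick N) (seq (clk N c) (prep N e)))
    have hhalt : ∀ s : TreeStore F, s (N + 5) = .nil → Runs L s 2 (PMF.pure s) := fun s hs =>
      .loop_false (by simp [hs, IsTrue]) (by simp [TreeExpr.cost])
    -- `R` bounds the time of every round and stays fixed, while `r` bounds the ticks left and
    -- decreases. There are at most `r + 1` rounds: the last one starts with no tick left, stops the
    -- clock, runs the body once more and leaves. The condition on `N + 5` says that a stopped clock
    -- makes the loop condition false.
    have key : ∀ R r, r ≤ R → ∀ s, ClockOK N s → (s (N + 4) = .nil → s (N + 5) = .nil) →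
        rem N s ≤ r →
        Runs L s ((r + 1) * (K * (R + 1) ^ d + e.cost + 26) + 2) (L.store s) ∧
          ∀ b ∈ (L.store s).support, ClockOK N b ∧ rem N b ≤ rem N s ∧
            (s (N + 4) = .nil → b (N + 4) = .nil) := by
      intro R r
      induction r with
      | zero =>
        intro _ s hs h45 hr
        by_cases h5 : s (N + 5) = .nil
        · refine ⟨(hhalt s h5).run_store.mono (by omega), fun b hb => ?_⟩
          rw [(hhalt s h5).eq_store, PMF.support_pure, Set.mem_singleton_iff] at hb
          subst hb
          exact ⟨hs, le_rfl, id⟩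
        obtain ⟨s₁, k1, k2, k3, k4, k5, k6⟩ := tick_runs N s hs
        -- No ticks are left, so this tick stops the clock and the next evaluation of the condition
        -- ends the loop.
        have k7 : s₁ (N + 4) = .nil := k5.resolve_left (by omega)
        obtain ⟨h1, h2⟩ := h s₁ k3
        have kl := Runs.loop_map (e := .var (N + 5)) h5 (k1.seq_pure (Runs.seq h1
          (fun b _ => prep_runs N e b) le_rfl)) (t₂ := 2)
          (ν := fun b => PMF.pure (prepStore N e b)) fun b hb => hhalt _ (by
            simp [prepStore, (h2 b hb).2.2 k7])
        refine ⟨(kl.mono ?_).run_store, fun b hb => ?_⟩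
        · have : (rem N s₁ + 1) ^ d ≤ (R + 1) ^ d := Nat.pow_le_pow_left (by omega) _
          have := Nat.mul_le_mul_left K this
          simp only [TreeExpr.cost]
          omega
        · rw [kl.eq_store] at hb
          obtain ⟨a, ha, hb⟩ := (PMF.mem_support_bind_iff _ _ _).1 hb
          rw [PMF.support_pure, Set.mem_singleton_iff] at hb
          subst hb
          have hps : ∀ x, N ≤ x → x ≤ N + 4 → prepStore N e a x = a x :=
            fun x _ _ => prepStore_of_ne _ _ _ (by omega)
          refine ⟨(h2 a ha).1.congr hps, ?_, fun h4 => absurd (h45 h4) h5⟩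
          rw [rem_congr hps]
          exact (h2 a ha).2.1.trans k6
      | succ r ihr =>
        intro hrR s hs h45 hr
        by_cases h5 : s (N + 5) = .nil
        · refine ⟨(hhalt s h5).run_store.mono (by omega), fun b hb => ?_⟩
          rw [(hhalt s h5).eq_store, PMF.support_pure, Set.mem_singleton_iff] at hb
          subst hb
          exact ⟨hs, le_rfl, id⟩
        obtain ⟨s₁, k1, k2, k3, k4, k5, k6⟩ := tick_runs N s hs
        have k7 : rem N s₁ ≤ r := by
          rcases k5 with k5 | k5
          · omega
          · rw [k3 k5]; omega
        obtain ⟨h1, h2⟩ := h s₁ k3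
        have hps : ∀ a x, N ≤ x → x ≤ N + 4 → prepStore N e a x = a x :=
          fun a x _ _ => prepStore_of_ne _ _ _ (by omega)
        have h3 := fun b hb => ihr (by omega) (prepStore N e b) ((h2 b hb).1.congr (hps b))
          (fun h4 => by
            rw [hps b _ (by omega) le_rfl] at h4
            simp [prepStore, h4]) (by rw [rem_congr (hps b)]; exact (h2 b hb).2.1.trans k7)
        have kl := Runs.loop_map (e := .var (N + 5)) h5 (k1.seq_pure (Runs.seq h1
          (fun b _ => prep_runs N e b) le_rfl)) (ν := fun b => L.store (prepStore N e b))
          fun b hb => (h3 b hb).1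
        refine ⟨(kl.mono ?_).run_store, fun b hb => ?_⟩
        · have : (rem N s₁ + 1) ^ d ≤ (R + 1) ^ d := Nat.pow_le_pow_left (by omega) _
          have := Nat.mul_le_mul_left K this
          simp only [TreeExpr.cost]
          rw [add_mul (r + 1) 1]
          omega
        · rw [kl.eq_store] at hb
          obtain ⟨a, ha, hb⟩ := (PMF.mem_support_bind_iff _ _ _).1 hb
          obtain ⟨g1, g2, -⟩ := (h3 a ha).2 b hb
          rw [rem_congr (hps a)] at g2
          exact ⟨g1, g2.trans ((h2 a ha).2.1.trans k6), fun h4 => absurd (h45 h4) h5⟩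
    refine ⟨K + 2 * e.cost + 40, d + 1, fun s hs => ?_⟩
    have hps : ∀ x, N ≤ x → x ≤ N + 4 → prepStore N e s x = s x :=
      fun x _ _ => prepStore_of_ne _ _ _ (by omega)
    obtain ⟨h1, h2⟩ := key (rem N s) (rem N s) le_rfl (prepStore N e s) (hs.congr hps)
      (fun h4 => by
        rw [hps _ (by omega) le_rfl] at h4
        simp [prepStore, h4]) (rem_congr hps).le
    have k : Runs (clk N (loop e c)) s ((K + 2 * e.cost + 40) * (rem N s + 1) ^ (d + 1)) _ :=
      ((prep_runs N e s).seq_pure h1).mono (by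
        have hp2 : 1 ≤ (rem N s + 1) ^ d := Nat.one_le_pow _ _ (Nat.succ_pos _)
        generalize rem N s = r at *
        rw [pow_succ]
        generalize (r + 1) ^ d = p at *
        nlinarith [Nat.mul_le_mul_left (r + 1) hp2, Nat.zero_le (e.cost * r),
          Nat.mul_le_mul_left ((r + 1) * e.cost) hp2, Nat.zero_le (p * r),
          Nat.zero_le (e.cost * p)])
    refine ⟨k.run_store, fun b hb => ?_⟩
    rw [k.eq_store] at hb
    obtain ⟨g1, g2, g3⟩ := h2 b hb
    rw [rem_congr hps] at g2
    exact ⟨g1, g2, fun h4 => g3 ((hps _ (by omega) le_rfl).trans h4)⟩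

/-- On the input `(l, d)`: run `c` on `d` with a clock that stops after `(n + 1) ^ 3 - 1` ticks,
where `n` is the length of `l`.  The output consists of a flag that tells whether the clock is
still running, and of the output of `c`. -/
def clocked (c : TreeProg F) : TreeProg F :=
  seq (assign (c.bd + 1 + 3) (.hd (.var 0))) (seq (assign (c.bd + 1) (.hd (.var 0)))
    (seq (assign (c.bd + 1 + 1) (.hd (.var 0))) (seq (assign (c.bd + 1 + 2) (.hd (.var 0)))
    (seq (assign (c.bd + 1 + 4) (.cons .nil .nil)) (seq (assign 0 (.tl (.var 0)))
    (seq (clk (c.bd + 1) c) (assign 0 (.cons (.var (c.bd + 1 + 4)) (.var 0)))))))))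

/-- All digits are set to the list `l` itself, so a clock with cubic range is wound up in a constant
number of steps; a unary counter of cubic length would be too expensive. Starting the clock
variables at `c.bd + 1` keeps them apart from the variable 0 holding the output, even if `c` uses no
variable. -/
theorem clocked_init (c : TreeProg F) (l : List (TreeData F)) (d : TreeData F) :
    ∃ s : TreeStore F, (∀ x < c.bd + 1, s x = initStore d x) ∧ ClockOK (c.bd + 1) s ∧
      rem (c.bd + 1) s + 1 = (l.length + 1) ^ 3 ∧
      ∀ t, Runs (clk (c.bd + 1) c) s t ((clk (c.bd + 1) c).store s) →
        (clocked c).RunsOn (.pair (.ofList l) d) (t + 30)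
          (((clk (c.bd + 1) c).store s).map fun b => .pair (b (c.bd + 1 + 4)) (b 0)) := by
  set N := c.bd + 1 with hN
  have h0 : ∀ i, N + i ≠ 0 := fun i => by omega
  have h0' : N ≠ 0 := by omega
  refine ⟨fun x => if x = 0 then d else if x = N ∨ x = N + 1 ∨ x = N + 2 ∨ x = N + 3 then .ofList l
    else if x = N + 4 then .pair .nil .nil else .nil, ?_, ?_, ?_, fun t h => ?_⟩
  · intro x hx
    by_cases hx0 : x = 0
    · simp [hx0, initStore]
    · simp only [initStore, if_neg hx0]
      rw [if_neg (by omega), if_neg (by omega)]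
  · intro h
    simp at h
  · simp [rem, len_ofList, h0']
    ring
  · have k1 : ∀ (s : TreeStore F), Runs (assign (N + 3) (.hd (.var 0))) s 3
      (PMF.pure (Function.update s (N + 3) (s 0).hd)) := fun s => .assign (by simp [TreeExpr.cost])
    have k2 : ∀ (s : TreeStore F), Runs (assign N (.hd (.var 0))) s 3
      (PMF.pure (Function.update s N (s 0).hd)) := fun s => .assign (by simp [TreeExpr.cost])
    have k3 : ∀ (s : TreeStore F), Runs (assign (N + 1) (.hd (.var 0))) s 3
      (PMF.pure (Function.update s (N + 1) (s 0).hd)) := fun s => .assign (by simp [TreeExpr.cost])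
    have k4 : ∀ (s : TreeStore F), Runs (assign (N + 2) (.hd (.var 0))) s 3
      (PMF.pure (Function.update s (N + 2) (s 0).hd)) := fun s => .assign (by simp [TreeExpr.cost])
    have k5 : ∀ (s : TreeStore F), Runs (assign (N + 4) (.cons .nil .nil)) s 4
      (PMF.pure (Function.update s (N + 4) (.pair .nil .nil))) :=
      fun s => .assign (by simp [TreeExpr.cost])
    have k6 : ∀ (s : TreeStore F), Runs (assign 0 (.tl (.var 0))) s 3
      (PMF.pure (Function.update s 0 (s 0).tl)) := fun s => .assign (by simp [TreeExpr.cost])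
    refine ⟨_, ((k1 _).seq_pure ((k2 _).seq_pure ((k3 _).seq_pure ((k4 _).seq_pure
      ((k5 _).seq_pure (((k6 _).of_eq ?_).seq_pure (Runs.seq_map (f := id)
      (h.of_eq (PMF.map_id _).symm) fun b _ => Runs.assign (t := 4) ?_))))))).mono ?_, ?_⟩
    · congr 1
      funext x
      by_cases hx0 : x = 0
      · subst hx0
        simp [initStore, h0'.symm]
      · clear k1 k2 k3 k4 k5 k6 h
        simp only [Function.update_apply, initStore, if_neg hx0, hd_pair, if_false, if_true,
          h0'.symm, (h0 _).symm]
        grind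
    · simp [TreeExpr.cost]
    · omega
    · rw [PMF.map_bind]
      simp only [PMF.pure_map]
      simp
      rfl

/-- While the clock runs, the output is the original one. If it has stopped, all `(l.length + 1) ^ 3
- 1` ticks have been spent, and at most `t` could be. -/
theorem clocked_runs (c : TreeProg F) : ∃ K, ∀ {l : List (TreeData F)} {d : TreeData F} {t : ℕ}
    {μ : PMF (TreeData F)}, c.RunsOn d t μ →
    (clocked c).RunsOn (.pair (.ofList l) d) (K * t) ((clocked c).output (.pair (.ofList l) d)) ∧
    PMF.Lift (fun a b => (b.hd ≠ .nil → b.tl = a) ∧ (b.hd = .nil → (l.length + 1) ^ 3 ≤ t + 1))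
      μ ((clocked c).output (.pair (.ofList l) d)) := by
  refine ⟨clkK c + 30, fun {l d t μ} h => ?_⟩
  obtain ⟨s, h1, h2, h3, h4⟩ := clocked_init c l d
  obtain ⟨ν, hν, rfl⟩ := h
  obtain ⟨k1, k2⟩ := hν.clk (Nat.le_succ _) s h2 fun _ => h1
  have k3 := h4 _ k1
  have ht := hν.one_le
  refine ⟨(k3.mono (by nlinarith)).run_output, ?_⟩
  rw [k3.eq_output]
  refine k2.map fun a ha b hb hab => ⟨fun h => hab.2.2 h 0 (Nat.succ_pos _), fun h => ?_⟩
  have := hab.2.1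
  rw [hab.1 h] at this
  rw [← h3]
  exact Nat.add_le_add_right (this.trans (Nat.zero_add t).le) 1

/-- Independent of the running time of `c`, and valid for every input; the exponent depends on the
text of `c` only. This makes the distinguisher polynomial although `T` may not be. -/
theorem clocked_runs_poly (c : TreeProg F) : ∃ K d, ∀ (l : List (TreeData F)) (x : TreeData F),
    (clocked c).RunsOn (.pair (.ofList l) x) (K * (l.length + 1) ^ d)
      ((clocked c).output (.pair (.ofList l) x)) := by
  obtain ⟨K, d, h⟩ := clk_runs_poly c (Nat.le_succ _)
  refine ⟨K + 30, 3 * d, fun l x => ?_⟩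
  obtain ⟨s, -, h2, h3, h4⟩ := clocked_init c l x
  have k1 := (h s h2).1
  rw [h3, ← pow_mul] at k1
  refine ((h4 _ k1).mono ?_).run_output
  have : 1 ≤ (l.length + 1) ^ (3 * d) := Nat.one_le_pow _ _ (Nat.succ_pos _)
  nlinarith

/-! ### Checking a solution -/

/-- The verified answer `x` to the system `A x = b`: the answer is preceded by a mark. -/
def verified {n : ℕ} (A : Matrix (Fin n) (Fin n) F) (b x : Fin n → F) : TreeData F :=
  if A *ᵥ x = b then .pair .nil (encVec x) else .nil

/-- On the input `(A, (x, b))`: the verified answer. -/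
def check : TreeProg F :=
  bnd matVec (.cons (.hd (.var 0)) (.hd (.tl (.var 0))))
    (bnd vecEq (.cons (.hd (.var 0)) (.tl (.tl (.tl (.var 0)))))
      (cond (.hd (.var 0)) (expr (.cons .nil (.hd (.tl (.tl (.tl (.var 0))))))) (expr .nil)))

theorem check_runs : ∃ K, ∀ {n : ℕ} (A : Matrix (Fin n) (Fin n) F) (x b : Fin n → F),
    check.RunsOn (.pair (encMat A) (.pair (encVec x) (encVec b))) (K * (n + 1) ^ 2)
      (PMF.pure (verified A b x)) := by
  obtain ⟨K₁, h₁⟩ := matVec_runs (F := F)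
  obtain ⟨K₂, h₂⟩ := vecEq_runs (F := F)
  refine ⟨?_, fun {n} A x b => ?_⟩
  rotate_left
  · have k₁ := h₁ A (encVec x)
    rw [dec_encVec] at k₁
    have k₃ : (cond (.hd (.var 0)) (expr (.cons .nil (.hd (.tl (.tl (.tl (.var 0)))))))
        (expr .nil)).RunsOn (.pair (if A *ᵥ x = b then .atom 1 else .nil)
        (.pair (encVec (A *ᵥ x)) (.pair (encMat A) (.pair (encVec x) (encVec b))))) 20
        (PMF.pure (verified A b x)) := by
      unfold verified
      split_ifs
      · exact (cond_true _ (by simp) (expr_runs (by simp))).mono (by simp [TreeExpr.cost])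
      · exact (cond_false _ (by simp) (expr_runs (by simp))).mono (by simp [TreeExpr.cost])
    refine (bnd_pure (d' := .pair (encMat A) (encVec x)) rfl k₁
      (bnd_pure (d' := .pair (encVec (A *ᵥ x)) (encVec b)) rfl (h₂ _ _) k₃)).mono ?_
    have h1 : 1 ≤ (n + 1) ^ 2 := Nat.one_le_pow _ _ (Nat.succ_pos n)
    have h2 : n + 1 ≤ (n + 1) ^ 2 := Nat.le_self_pow (by norm_num) _
    exact Nat.add_le_const_mul (Nat.add_le_const_mul le_rfl (Nat.add_le_const_mul
      (Nat.add_le_const_mul (Nat.mul_le_mul_left _ h2) (Nat.le_const_mul h1 _))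
      (Nat.le_const_mul h1 _))) (Nat.le_const_mul h1 _)

/-- On the input `(A, b)`: the verified answer found by elimination. -/
def gaussCheck : TreeProg F :=
  bnd gauss (.var 0) (pre (.cons (.hd (.tl (.var 0))) (.cons (.hd (.var 0)) (.tl (.tl (.var 0)))))
    check)

theorem gaussCheck_runs : ∃ K, ∀ {n : ℕ} (A : Matrix (Fin n) (Fin n) F) (b : Fin n → F),
    ∃ x : Fin n → F, gaussCheck.RunsOn (.pair (encMat A) (encVec b)) (K * (n + 1) ^ 3)
      (PMF.pure (verified A b x)) ∧
      ∀ A' : Matrix.GeneralLinearGroup (Fin n) F, A'.1 = A → x = A'⁻¹.1 *ᵥ b := by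
  obtain ⟨K₁, h₁⟩ := gauss_runs (F := F)
  obtain ⟨K₂, h₂⟩ := check_runs (F := F)
  refine ⟨?_, fun {n} A b => ?_⟩
  rotate_left
  · obtain ⟨x, hx, hx'⟩ := h₁ A b
    refine ⟨x, (bnd_pure rfl hx (pre_runs (d' := .pair (encMat A) (.pair (encVec x) (encVec b))) rfl
      (h₂ A x b))).mono ?_, hx'⟩
    have h1 : 1 ≤ (n + 1) ^ 3 := Nat.one_le_pow _ _ (Nat.succ_pos n)
    have h2 : (n + 1) ^ 2 ≤ (n + 1) ^ 3 := Nat.pow_le_pow_right (Nat.succ_pos n) (by norm_num)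
    exact Nat.add_le_const_mul (Nat.add_le_const_mul le_rfl (Nat.add_le_const_mul
      (Nat.mul_le_mul_left _ h2) (Nat.le_const_mul h1 _))) (Nat.le_const_mul h1 _)

/-! ### Using the given algorithm on a randomized system -/

/-- The variable of the input after `i` results have been put in front of it. -/
def up : ℕ → TreeExpr F
  | 0 => .var 0
  | i + 1 => .tl (up i)

/-- The second part of `core`. -/
def finish : TreeProg F :=
  bnd matVec (.cons (.hd (.tl (up 4))) (.tl (.hd (.var 0))))
    (bnd axpy (.cons (.const 1) (.cons (.hd (up 4)) (.cons (.hd (.var 0)) (.tl (.hd (up 5))))))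
      (pre (.cons (.hd (.hd (up 6))) (.cons (.hd (.var 0)) (.tl (.hd (up 6))))) check))

theorem finish_runs : ∃ K, ∀ {n : ℕ} (A X Y : Matrix (Fin n) (Fin n) F) (b y : Fin n → F)
    (r e₁ e₂ : TreeData F),
    finish.RunsOn (.pair r (.pair e₁ (.pair e₂ (.pair (encVec y)
      (.pair (.pair (encMat A) (encVec b)) (.pair (encMat X) (encMat Y))))))) (K * (n + 1) ^ 2)
      (PMF.pure (verified A b (X *ᵥ dec n r.tl - y))) := by
  obtain ⟨K₁, h₁⟩ := matVec_runs (F := F)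
  obtain ⟨K₂, h₂⟩ := axpy_runs (F := F)
  obtain ⟨K₃, h₃⟩ := check_runs (F := F)
  refine ⟨?_, fun {n} A X Y b y r e₁ e₂ => ?_⟩
  rotate_left
  · have k₂ := h₂ (n := n) (.atom 1) (encVec y) (encVec (X *ᵥ dec n r.tl))
      (List.ofFn fun i => .atom (b i)) (by simp)
    rw [dec_encVec, dec_encVec, val_atom, one_smul] at k₂
    refine (bnd_pure (d' := .pair (encMat X) r.tl) rfl (h₁ X r.tl) (bnd_pure rfl k₂
      (pre_runs rfl (h₃ A _ b)))).mono ?_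
    have h1 : 1 ≤ (n + 1) ^ 2 := Nat.one_le_pow _ _ (Nat.succ_pos n)
    have h2 : n + 1 ≤ (n + 1) ^ 2 := Nat.le_self_pow (by norm_num) _
    exact Nat.add_le_const_mul (Nat.add_le_const_mul le_rfl (Nat.add_le_const_mul
      (Nat.add_le_const_mul (Nat.mul_le_mul_left _ h2) (Nat.add_le_const_mul le_rfl
      (Nat.le_const_mul h1 _))) (Nat.le_const_mul h1 _))) (Nat.le_const_mul h1 _)

/-- On the input `((A, b), (X, Y))` where `Y = A X`: try to solve `A x = b` by running the program
`M` with a clock on `(Y, b + A y)` where `y` is a random vector.  The output is the verified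
answer, or `1` if the time was not sufficient. -/
def core (M : TreeProg F) : TreeProg F :=
  bnd randVec (.tl (.hd (.var 0)))
    (bnd matVec (.cons (.hd (.hd (up 1))) (.hd (.var 0)))
      (bnd axpy (.cons (.const (-1)) (.cons (.hd (.var 0)) (.cons (.tl (.hd (up 2)))
          (.tl (.hd (up 2))))))
        (bnd (clocked M) (.cons (.hd (.hd (up 3))) (.cons (.tl (.tl (up 3))) (.hd (.var 0))))
          (cond (.hd (.hd (.var 0))) finish (expr (.const 1))))))

open Classical in
/-- The output of `core` if `r` is the output of the program with the clock. -/
noncomputable def coreOut {n : ℕ} (A X : Matrix (Fin n) (Fin n) F) (b y : Fin n → F)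
    (r : TreeData F) : TreeData F :=
  if r.hd = .nil then .atom 1 else verified A b (X *ᵥ dec n r.tl - y)

/-- The output of the program with the clock in `core`. -/
noncomputable def coreRun (M : TreeProg F) {n : ℕ} (A Y : Matrix (Fin n) (Fin n) F)
    (b y : Fin n → F) : PMF (TreeData F) :=
  (clocked M).output (.pair (encMat A) (.pair (encMat Y) (encVec (b + A *ᵥ y))))

/-- The output of `core`. -/
noncomputable def coreDist (M : TreeProg F) {n : ℕ} (A X Y : Matrix (Fin n) (Fin n) F)
    (b : Fin n → F) : PMF (TreeData F) :=
  (PMF.uniformOfFintype (Fin n → F)).bind fun y => (coreRun M A Y b y).map (coreOut A X b y)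

/-- The time `t` of the clocked run is a parameter because it is estimated in two ways: by the
running time of `M` in `trial`, and by a polynomial in the distinguisher. -/
theorem core_runs (M : TreeProg F) : ∃ K, ∀ {n : ℕ} {t : ℕ} (A X Y : Matrix (Fin n) (Fin n) F)
    (b : Fin n → F), (∀ y, (clocked M).RunsOn (.pair (encMat A) (.pair (encMat Y)
      (encVec (b + A *ᵥ y)))) t (coreRun M A Y b y)) →
    (core M).RunsOn (.pair (.pair (encMat A) (encVec b)) (.pair (encMat X) (encMat Y)))
      (K * ((n + 1) ^ 2 + t)) (coreDist M A X Y b) := by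
  obtain ⟨K₁, h₁⟩ := randVec_runs (F := F)
  obtain ⟨K₂, h₂⟩ := matVec_runs (F := F)
  obtain ⟨K₃, h₃⟩ := axpy_runs (F := F)
  obtain ⟨K₄, h₄⟩ := finish_runs (F := F)
  refine ⟨?_, fun {n t} A X Y b h => ?_⟩
  rotate_left
  · have k := bnd_runs (c := randVec) (e := .tl (.hd (.var 0)))
      (d := .pair (.pair (encMat A) (encVec b)) (.pair (encMat X) (encMat Y)))
      (c' := bnd matVec (.cons (.hd (.hd (up 1))) (.hd (.var 0)))
        (bnd axpy (.cons (.const (-1)) (.cons (.hd (.var 0)) (.cons (.tl (.hd (up 2)))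
            (.tl (.hd (up 2))))))
          (bnd (clocked M) (.cons (.hd (.hd (up 3))) (.cons (.tl (.tl (up 3))) (.hd (.var 0))))
            (cond (.hd (.hd (.var 0))) finish (expr (.const 1))))))
      (ν := fun v => (coreRun M A Y b (dec n v)).map (coreOut A X b (dec n v))) rfl
      (h₁ (n := n) (List.ofFn fun i => .atom (b i)) (by simp)) fun v hv => by
        obtain ⟨y, -, rfl⟩ := (PMF.mem_support_map_iff _ _ _).1 hv
        rw [dec_encVec]
        have k₂ := h₂ A (encVec y)
        have k₃ := h₃ (n := n) (.atom (-1)) (encVec (A *ᵥ y)) (encVec b)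
          (List.ofFn fun i => .atom (b i)) (by simp)
        rw [dec_encVec] at k₂
        rw [dec_encVec, dec_encVec, val_atom, neg_smul, one_smul, sub_neg_eq_add] at k₃
        refine bnd_pure rfl k₂ (bnd_pure rfl k₃ (bnd_runs (t₂ := K₄ * (n + 1) ^ 2 + 20) rfl (h y)
          (ν := fun r => PMF.pure (coreOut A X b y r)) fun r hr => ?_))
        by_cases hr : r.hd = .nil
        · exact (cond_false _ (by simpa using hr) (expr_runs (by simp [coreOut, hr]))).mono
            (by simp [TreeExpr.cost])
        · refine (cond_true _ (by simpa using hr) ((h₄ A X Y b y r _ _).of_eq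
            (by rw [coreOut, if_neg hr]))).mono (by simp [TreeExpr.cost])
    refine (k.mono ?_).of_eq ?_
    · have h1 : 1 ≤ (n + 1) ^ 2 + t :=
        (Nat.one_le_pow _ _ (Nat.succ_pos n)).trans (Nat.le_add_right _ _)
      have h2 : (n + 1) ^ 2 ≤ (n + 1) ^ 2 + t := Nat.le_add_right _ _
      have h3 : n + 1 ≤ (n + 1) ^ 2 + t := (Nat.le_self_pow (by norm_num) _).trans h2
      have h4 : t ≤ 1 * ((n + 1) ^ 2 + t) := (Nat.le_add_left _ _).trans (one_mul _).ge
      have h5 := Nat.mul_le_mul_left K₂ h2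
      exact Nat.add_le_const_mul (Nat.add_le_const_mul (Nat.mul_le_mul_left _ h3)
        (Nat.add_le_const_mul (Nat.add_le_const_mul h5
          (Nat.add_le_const_mul (Nat.add_le_const_mul (Nat.mul_le_mul_left _ h3)
          (Nat.add_le_const_mul (Nat.add_le_const_mul h4 (Nat.add_le_const_mul
            (Nat.mul_le_mul_left _ h2) (Nat.le_const_mul h1 _))) (Nat.le_const_mul h1 _)))
            (Nat.le_const_mul h1 _))) (Nat.le_const_mul h1 _))) (Nat.le_const_mul h1 _)
    · rw [PMF.bind_map, coreDist]
      refine congrArg _ (funext fun y => ?_)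
      simp [dec_encVec]

end TreeProg

/-- The size of a list whose entries have bounded size. -/
theorem TreeData.size_ofList_le {F : Type*} {k : ℕ} (l : List (TreeData F))
    (h : ∀ e ∈ l, e.size ≤ k) : (ofList l).size ≤ l.length * (k + 1) + 1 := by
  induction l with
  | nil => simp [ofList, size]
  | cons e l ih =>
    have h1 := h e (by simp)
    have h2 := ih fun e he => h e (List.mem_cons_of_mem _ he)
    simp only [ofList, size, List.length_cons, add_mul, one_mul]
    omega

theorem TreeData.size_encVec_le {F : Type*} {n : ℕ} (v : Fin n → F) :
    (encVec v).size ≤ n * 2 + 1 := by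
  refine (size_ofList_le (k := 1) _ fun e he => ?_).trans (by simp)
  obtain ⟨i, rfl⟩ := List.mem_ofFn.1 he
  exact le_rfl

theorem TreeData.size_encMat_le {F : Type*} {n : ℕ} (A : Matrix (Fin n) (Fin n) F) :
    (encMat A).size ≤ n * (n * 2 + 2) + 1 := by
  refine (size_ofList_le (k := n * 2 + 1) _ fun e he => ?_).trans (by simp)
  obtain ⟨i, rfl⟩ := List.mem_ofFn.1 he
  exact size_encVec_le _

theorem PMF.toOuterMeasure_univ {α : Type*} (μ : PMF α) : μ.toOuterMeasure Set.univ = 1 := by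
  rw [PMF.toOuterMeasure_apply_eq_one_iff]
  exact Set.subset_univ _

theorem PMF.toOuterMeasure_le_one {α : Type*} (μ : PMF α) (s : Set α) : μ.toOuterMeasure s ≤ 1 :=
  (MeasureTheory.measure_mono (Set.subset_univ s)).trans μ.toOuterMeasure_univ.le

theorem prob_mono_of_le {α β : Type*} {μ : PMF α} {ν : PMF β} {s : Set α} {t : Set β}
    (h : μ.toOuterMeasure s ≤ ν.toOuterMeasure t) : prob μ s ≤ prob ν t :=
  ENNReal.toReal_mono (((ν.toOuterMeasure_le_one t).trans_lt ENNReal.one_lt_top).ne) h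

/-! ### Success probability for a uniformly random matrix -/

namespace TreeProg

open TreeData

variable {F : Type*} [Field F] [Fintype F] [DecidableEq F]

/-- Vectors that solve the system. -/
def solutions {n : ℕ} (A : Matrix (Fin n) (Fin n) F) (b : Fin n → F) : Set (TreeData F) :=
  {d | ∃ x : Fin n → F, d = encVec x ∧ A *ᵥ x = b}

omit [Fintype F] in
-- The mark in front of the answer matters for `n = 0`, where `encVec x` is itself `nil` and could
-- not be told from failure.
theorem verified_ne_nil {n : ℕ} {A : Matrix (Fin n) (Fin n) F} {b x : Fin n → F}
    (h : A *ᵥ x = b) : verified A b x ≠ .nil := by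
  rw [verified, if_pos h]
  nofun

omit [Fintype F] in
-- If `A X x' = b + A y`, then `A (X x' - y) = b`, so the check passes. A timeout yields `1`, which
-- is not `nil` either; hence the clock can only help.
theorem coreOut_ne_nil {n : ℕ} {A X : Matrix (Fin n) (Fin n) F} {b y : Fin n → F}
    {a r : TreeData F} (h : r.hd ≠ .nil → r.tl = a) (ha : a ∈ solutions (A * X) (b + A *ᵥ y)) :
    coreOut A X b y r ≠ .nil := by
  unfold coreOut
  split_ifs with hr
  · nofun
  · obtain ⟨x, rfl, hx⟩ := ha
    rw [h hr, dec_encVec]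
    refine verified_ne_nil ?_
    rw [Matrix.mulVec_sub, Matrix.mulVec_mulVec, hx, add_sub_cancel_right]

theorem exists_of_mem_support_coreDist {M : TreeProg F} {n : ℕ} {A X Y : Matrix (Fin n) (Fin n) F}
    {b : Fin n → F} {r : TreeData F} (hr : r ∈ (coreDist M A X Y b).support) :
    ∃ y, ∃ d ∈ (coreRun M A Y b y).support, coreOut A X b y d = r := by
  obtain ⟨y, -, hr⟩ := (PMF.mem_support_bind_iff _ _ _).1 hr
  obtain ⟨d, hd, rfl⟩ := (PMF.mem_support_map_iff _ _ _).1 hr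
  exact ⟨y, d, hd, rfl⟩

omit [Fintype F] in
theorem isAtom_verified {n : ℕ} (A : Matrix (Fin n) (Fin n) F) (b x : Fin n → F) :
    (verified A b x).isAtom = false := by
  unfold verified
  split_ifs <;> rfl

/-- `core` outputs a verified answer unless the time was not sufficient. -/
theorem coreDist_cases {M : TreeProg F} {n t : ℕ} {A X Y : Matrix (Fin n) (Fin n) F}
    {b : Fin n → F} {μ : (Fin n → F) → PMF (TreeData F)}
    (h : ∀ b', M.RunsOn (.pair (encMat Y) (encVec b')) t (μ b')) {r : TreeData F}
    (hr : r ∈ (coreDist M A X Y b).support) :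
    (r.isAtom = true ∧ (n + 1) ^ 3 ≤ t + 1) ∨ (r.isAtom = false ∧ ∃ x, r = verified A b x) := by
  obtain ⟨K, hK⟩ := clocked_runs M
  obtain ⟨y, d, hd, rfl⟩ := exists_of_mem_support_coreDist hr
  obtain ⟨-, h2⟩ := hK (l := List.ofFn fun i => encVec (A i)) (h (b + A *ᵥ y))
  rw [List.length_ofFn] at h2
  by_cases hr : d.hd = .nil
  · obtain ⟨a, -, -, h3⟩ := h2.exists_left hd
    exact .inl ⟨by rw [coreOut, if_pos hr]; rfl, h3 hr⟩
  · rw [coreOut, if_neg hr]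
    exact .inr ⟨isAtom_verified _ _ _, _, rfl⟩

/-- The probability of success of `core` on a uniformly random matrix. -/
theorem le_core_uniform {M : TreeProg F} {n t : ℕ}
    {out : Matrix (Fin n) (Fin n) F → (Fin n → F) → PMF (TreeData F)}
    (hM : ∀ A b, M.RunsOn (.pair (encMat A) (encVec b)) t (out A b))
    (A : Matrix.GeneralLinearGroup (Fin n) F) (b : Fin n → F) :
    (Fintype.card (Matrix.GeneralLinearGroup (Fin n) F) : ℝ) /
      Fintype.card (Matrix (Fin n) (Fin n) F) * averageSuccess out ≤
    prob ((PMF.uniformOfFintype (Matrix (Fin n) (Fin n) F)).bind fun X =>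
      coreDist M A.1 X (A.1 * X) b) {.nil}ᶜ := by
  obtain ⟨K, hK⟩ := clocked_runs M
  let g : Matrix (Fin n) (Fin n) F × (Fin n → F) → ENNReal := fun p =>
    (out p.1 p.2).toOuterMeasure (solutions p.1 p.2)
  -- The change of variables that turns uniform `(X, y)` into a uniform system. Its inverse uses
  -- `A⁻¹`.
  let e : Matrix (Fin n) (Fin n) F × (Fin n → F) ≃ Matrix (Fin n) (Fin n) F × (Fin n → F) :=
    { toFun := fun p => (A.1 * p.1, b + A.1 *ᵥ p.2)
      invFun := fun p => (A⁻¹.1 * p.1, A⁻¹.1 *ᵥ (p.2 - b))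
      left_inv := fun p => by
        simp [← Matrix.mul_assoc]
      right_inv := fun p => by
        simp [← Matrix.mul_assoc] }
  -- Successes on singular systems are discarded. The different normalisation of the two sums
  -- produces the ratio of cardinalities in the statement.
  have h1 : (∑' p : Matrix.GeneralLinearGroup (Fin n) F × (Fin n → F), g (p.1.1, p.2))
      ≤ ∑' p, g (e p) := by
    rw [e.tsum_eq]
    exact ENNReal.tsum_comp_le_tsum_of_injective
      (f := fun p : Matrix.GeneralLinearGroup (Fin n) F × (Fin n → F) => (p.1.1, p.2))
      (fun p q h => Prod.ext (Units.ext (Prod.ext_iff.1 h).1) (Prod.ext_iff.1 h).2) g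
  have h2 : ((PMF.uniformOfFintype (Matrix (Fin n) (Fin n) F)).bind fun X =>
      coreDist M A.1 X (A.1 * X) b).toOuterMeasure {.nil}ᶜ ≥
      (Fintype.card (Matrix (Fin n) (Fin n) F) * Fintype.card (Fin n → F) : ENNReal)⁻¹ *
        ∑' p, g (e p) := by
    have : ((PMF.uniformOfFintype (Matrix (Fin n) (Fin n) F)).bind fun X =>
        coreDist M A.1 X (A.1 * X) b) = (PMF.uniformOfFintype (Matrix (Fin n) (Fin n) F ×
          (Fin n → F))).bind fun p =>
            (coreRun M A.1 (A.1 * p.1) b p.2).map (coreOut A.1 p.1 b p.2) := by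
      rw [uniform_prod_eq, PMF.bind_bind]
      simp only [PMF.bind_map]
      rfl
    rw [this, PMF.toOuterMeasure_bind_apply, ← ENNReal.tsum_mul_left]
    refine ENNReal.tsum_le_tsum fun p => ?_
    rw [PMF.uniformOfFintype_apply, Fintype.card_prod, Nat.cast_mul]
    refine mul_le_mul_right ?_ _
    rw [PMF.toOuterMeasure_map_apply]
    obtain ⟨-, h2⟩ := hK (l := List.ofFn fun i => encVec (A.1 i)) (hM (A.1 * p.1) (b + A.1 *ᵥ p.2))
    -- By the coupling, every successful outcome of `M` is matched with a clocked outcome that is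
    -- the same or a timeout; both count as success of `core`.
    exact h2.measure_le fun a r har ha => coreOut_ne_nil har.1 ha
  have h3 : averageSuccess out = ((Fintype.card (Matrix.GeneralLinearGroup (Fin n) F) *
      Fintype.card (Fin n → F) : ENNReal)⁻¹ *
      ∑' p : Matrix.GeneralLinearGroup (Fin n) F × (Fin n → F), g (p.1.1, p.2)).toReal := by
    rw [averageSuccess, prob, PMF.toOuterMeasure_bind_apply, ← ENNReal.tsum_mul_left]
    congr 1
    refine tsum_congr fun p => ?_
    rw [PMF.uniformOfFintype_apply, Fintype.card_prod, Nat.cast_mul, PMF.toOuterMeasure_map_apply]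
    rfl
  have h4 := (mul_le_mul_right h1 (Fintype.card (Matrix (Fin n) (Fin n) F) *
    Fintype.card (Fin n → F) : ENNReal)⁻¹).trans h2
  refine le_trans (le_of_eq ?_) (ENNReal.toReal_mono (((PMF.toOuterMeasure_le_one _ _).trans_lt
    ENNReal.one_lt_top).ne) h4)
  rw [h3]
  simp only [ENNReal.toReal_mul, ENNReal.toReal_inv, ENNReal.toReal_natCast]
  have c1 : (Fintype.card (Matrix.GeneralLinearGroup (Fin n) F) : ℝ) ≠ 0 :=
    Nat.cast_ne_zero.2 Fintype.card_ne_zero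
  have c2 : (Fintype.card (Matrix (Fin n) (Fin n) F) : ℝ) ≠ 0 :=
    Nat.cast_ne_zero.2 Fintype.card_ne_zero
  have c3 : (Fintype.card (Fin n → F) : ℝ) ≠ 0 :=
    Nat.cast_ne_zero.2 Fintype.card_ne_zero
  field_simp

/-! ### The distinguisher -/

/-- On the input `((A, b), X)`: does `core` give an answer with `Y = A X`? -/
def distinguisher (M : TreeProg F) : TreeProg F :=
  bnd matMul (.cons (.hd (.hd (.var 0))) (.tl (.var 0)))
    (bnd (core M) (.cons (.hd (up 1)) (.cons (.tl (up 1)) (.hd (.var 0))))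
      (cond (.hd (.var 0)) (expr (.const 1)) (expr .nil)))

open Classical in
/-- The answer of the distinguisher if `r` is the output of `core`. -/
noncomputable def answer (r : TreeData F) : TreeData F := if r = .nil then .nil else .atom 1

/-- Without a trapdoor, `A X` is computed by the cubic product. The clocked run is bounded by
`clocked_runs_poly`, so no bound on the running time of `M` enters. -/
theorem distinguisher_runs (M : TreeProg F) : ∃ K d, ∀ {n : ℕ} (A X : Matrix (Fin n) (Fin n) F)
    (b : Fin n → F), (distinguisher M).RunsOn (.pair (.pair (encMat A) (encVec b)) (encMat X))
      (K * (n + 1) ^ d)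
      ((coreDist M A X (A * X) b).map answer) := by
  obtain ⟨K₁, h₁⟩ := matMul_runs (F := F)
  obtain ⟨K₂, h₂⟩ := core_runs M
  obtain ⟨K₃, d, h₃⟩ := clocked_runs_poly M
  refine ⟨?_, d + 3, fun {n} A X b => ?_⟩
  rotate_left
  · have k₃ := h₂ A X (A * X) b fun y => h₃ (List.ofFn fun i => encVec (A i)) _
    rw [List.length_ofFn] at k₃
    refine ((bnd_pure (d' := .pair (encMat A) (encMat X)) rfl
      (h₁ A X) (bnd_runs (d' := .pair (.pair (encMat A) (encVec b)) (.pair (encMat X)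
        (encMat (A * X)))) rfl k₃ (t₂ := 10) (ν := fun r => PMF.pure (answer r)) fun r _ => by
          unfold answer
          split_ifs with hr
          · exact (cond_false _ (by simpa using hr) (expr_runs (by simp))).mono
              (by simp [TreeExpr.cost])
          · exact (cond_true _ (by simpa using hr) (expr_runs (by simp))).mono
              (by simp [TreeExpr.cost]))).mono ?_).of_eq rfl
    have hp := Nat.succ_pos n
    have h1 : 1 ≤ (n + 1) ^ (d + 3) := Nat.one_le_pow _ _ hp
    have h2 : (n + 1) ^ 2 ≤ 1 * (n + 1) ^ (d + 3) :=
      (Nat.pow_le_pow_right hp (by omega)).trans (one_mul _).ge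
    have h3 : (n + 1) ^ 3 ≤ (n + 1) ^ (d + 3) := Nat.pow_le_pow_right hp (by omega)
    have h4 : (n + 1) ^ d ≤ (n + 1) ^ (d + 3) := Nat.pow_le_pow_right hp (by omega)
    exact Nat.add_le_const_mul (Nat.add_le_const_mul (Nat.mul_le_mul_left _ h3)
      (Nat.add_le_const_mul (Nat.add_le_const_mul (Nat.const_mul_le_const_mul _
        (Nat.add_le_const_mul h2 (Nat.mul_le_mul_left _ h4))) (Nat.le_const_mul h1 _))
        (Nat.le_const_mul h1 _))) (Nat.le_const_mul h1 _)

omit [Fintype F] [DecidableEq F] in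
theorem prob_bind_map_answer {α : Type*} (μ : PMF α) (f : α → PMF (TreeData F)) :
    prob (μ.bind fun a => (f a).map answer) {.atom 1} = prob (μ.bind f) {.nil}ᶜ := by
  have hset : (answer : TreeData F → TreeData F) ⁻¹' {.atom 1} = {.nil}ᶜ := by
    ext r
    by_cases hr : r = .nil <;> simp [answer, hr]
  rw [prob, prob, ← hset, ← PMF.toOuterMeasure_map_apply, PMF.map_bind]

/-- The matrices of the family are as good for `core` as random matrices. -/
theorem eventually_le_core {D : TrapdooredFamily F} (hind : D.Indistinguishable) {M : TreeProg F}
    {δ η : ℝ} (hδ : η < δ) (h : ∀ᶠ n in atTop, ∀ (A : Matrix.GeneralLinearGroup (Fin n) F)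
      (b : Fin n → F), δ ≤ prob ((PMF.uniformOfFintype (Matrix (Fin n) (Fin n) F)).bind fun X =>
        coreDist M A.1 X (A.1 * X) b) {.nil}ᶜ) :
    ∀ᶠ n in atTop, ∀ (A : Matrix.GeneralLinearGroup (Fin n) F) (b : Fin n → F),
      η ≤ prob ((D.dist n).bind fun z => coreDist M A.1 z.1 (A.1 * z.1) b) {.nil}ᶜ := by
  classical
  -- For each `n` there are finitely many systems; the advice is one with the smallest success
  -- probability over the family. A bound for it is a bound for all.
  choose w hw using fun n => Finite.exists_min
    fun p : Matrix.GeneralLinearGroup (Fin n) F × (Fin n → F) =>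
      prob ((D.dist n).bind fun z => coreDist M p.1.1 z.1 (p.1.1 * z.1) p.2) {.nil}ᶜ
  obtain ⟨K, d, hK⟩ := distinguisher_runs M
  have key := hind (distinguisher M) (fun n => .pair (encMat (w n).1.1) (encVec (w n).2))
    (fun n => K * (n + 1) ^ d) _ ?_ ?_ fun n X => hK (w n).1.1 X (w n).2
  -- Exponent 0 of the decay: the advantage tends to 0, so it is eventually below the gap `δ - η`.
  · have key0 := key 0
    simp only [pow_zero, one_mul] at key0
    filter_upwards [h, key0.eventually (gt_mem_nhds (sub_pos.2 hδ))] with n h1 h2 A b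
    rw [prob_bind_map_answer, prob_bind_map_answer, abs_lt] at h2
    have h3 := h1 (w n).1 (w n).2
    exact le_trans (by linarith [h2.2]) (hw n (A, b))
  · refine ⟨9, 2, fun n => ?_⟩
    have h1 := size_encMat_le (w n).1.1
    have h2 := size_encVec_le (w n).2
    simp only [size]
    nlinarith
  · refine ⟨K * 2 ^ d, d, fun n => ?_⟩
    rcases Nat.eq_zero_or_pos n with rfl | hn
    · simp only [zero_add, one_pow, mul_one]
      exact (Nat.le_mul_of_pos_right _ (by positivity)).trans (Nat.le_add_left _ _)
    · refine le_trans ?_ (Nat.le_add_right _ _)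
      rw [mul_assoc, ← mul_pow]
      exact Nat.mul_le_mul_left _ (Nat.pow_le_pow_left (by omega) _)

/-! ### One attempt with a trapdoored matrix -/

/-- The length of a list as a unary number. -/
def natOf : TreeProg F := pre (.cons .nil (.var 0)) (fold (expr (.cons .nil (.hd (.var 0)))))

theorem natOf_runs : ∃ K, ∀ l : List (TreeData F),
    natOf.RunsOn (.ofList l) (K * (l.length + 1)) (PMF.pure (encNat l.length)) := by
  have key : ∀ (l : List (TreeData F)) (k : ℕ),
      foldE (.cons .nil (.hd (.var 0))) l (encNat k) = encNat (l.length + k) := by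
    intro l
    induction l with
    | nil => intro k; simp
    | cons e l ih =>
      intro k
      rw [foldE_cons]
      refine Eq.trans ?_ ((ih (k + 1)).trans ?_)
      · simp [encNat, List.replicate_succ, ofList]
      · rw [List.length_cons, add_assoc, add_comm k 1]
  refine ⟨?_, fun l => ?_⟩
  rotate_left
  · refine (pre_runs (d' := .pair .nil (.ofList l)) rfl (fold_expr (key l 0))).mono ?_
    exact Nat.add_le_const_mul le_rfl (Nat.le_const_mul (Nat.le_add_left _ _) _)

/-- One attempt to solve the system `(A, b)`: run `core` for a random trapdoored matrix, and use
elimination if the time was not sufficient. -/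
def trial (D : TrapdooredFamily F) (M : TreeProg F) : TreeProg F :=
  bnd natOf (.hd (.var 0))
    (bnd D.sample (.hd (.var 0))
      (bnd (mapL D.vecMul) (.cons (.tl (.hd (.var 0))) (.hd (up 2)))
        (bnd (core M) (.cons (up 3) (.cons (.hd (.hd (up 1))) (.hd (.var 0))))
          (cond (.isAtom (.hd (.var 0))) (pre (up 4) gaussCheck) (expr (.hd (.var 0)))))))

/-- The running time of `trial` if `M` takes time `t`. -/
def trialTime (D : TrapdooredFamily F) (t n : ℕ) : ℕ :=
  (n + 1) ^ 2 + D.sampleTime n + (n + 1) * (D.mulTime n + 1) + t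

/-- The output of `trial`, if `x` is the vector found by elimination and `r` the output of `core`. -/
def trialOut {n : ℕ} (A : Matrix (Fin n) (Fin n) F) (b x : Fin n → F) (r : TreeData F) :
    TreeData F :=
  if r.isAtom then verified A b x else r

/-- The output of `trial`, if `x` is the vector found by elimination. -/
noncomputable def trialDist (D : TrapdooredFamily F) (M : TreeProg F) {n : ℕ}
    (A : Matrix (Fin n) (Fin n) F) (b x : Fin n → F) : PMF (TreeData F) :=
  (D.dist n).bind fun z => (coreDist M A z.1 (A * z.1) b).map (trialOut A b x)

/-- The continuation may depend on `a` itself and not only on `enc a`, as it does for a sampled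
matrix with its trapdoor. No injectivity of `enc` is needed, since the output of `c'` is determined
by its input. -/
theorem bnd_map {α : Type*} {c : TreeProg F} {e : TreeExpr F} {c' : TreeProg F} {d d' : TreeData F}
    {t₁ t₂ : ℕ} {μ : PMF α} {enc : α → TreeData F} {ν : α → PMF (TreeData F)}
    (he : e.eval (initStore d) = d') (h : c.RunsOn d' t₁ (μ.map enc))
    (k : ∀ a ∈ μ.support, c'.RunsOn (.pair (enc a) d) t₂ (ν a)) :
    (bnd c e c').RunsOn d (t₁ + t₂ + bndK c e c') (μ.bind ν) := by
  refine (bnd_runs (ν := fun r => c'.output (.pair r d)) he h fun r hr => ?_).of_eq ?_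
  · obtain ⟨a, ha, rfl⟩ := (PMF.mem_support_map_iff _ _ _).1 hr
    exact (k a ha).run_output
  · rw [PMF.bind_map]
    exact PMF.bind_congr_support _ fun a ha => (k a ha).eq_output

/-- The rows of `A X` are the rows of `A` multiplied by `X` from the right, so `vecMul` applied
through the trapdoor to each of them gives the product in nearly quadratic time. -/
theorem trial_runs (D : TrapdooredFamily F) (M : TreeProg F) : ∃ K, ∀ {n t : ℕ}
    {out : Matrix (Fin n) (Fin n) F → (Fin n → F) → PMF (TreeData F)},
    (∀ A b, M.RunsOn (.pair (encMat A) (encVec b)) t (out A b)) →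
    ∀ (A : Matrix (Fin n) (Fin n) F) (b : Fin n → F), ∃ x : Fin n → F,
    (trial D M).RunsOn (.pair (encMat A) (encVec b)) (K * trialTime D t n) (trialDist D M A b x) ∧
      ∀ A' : Matrix.GeneralLinearGroup (Fin n) F, A'.1 = A → x = A'⁻¹.1 *ᵥ b := by
  obtain ⟨K₁, h₁⟩ := natOf_runs (F := F)
  obtain ⟨K₂, h₂⟩ := mapL_runs D.vecMul
  obtain ⟨K₃, h₃⟩ := core_runs M
  obtain ⟨K₄, h₄⟩ := gaussCheck_runs (F := F)
  obtain ⟨K₅, h₅⟩ := clocked_runs M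
  refine ⟨?_, fun {n t out} hM A b => ?_⟩
  rotate_left
  · obtain ⟨x, hx, hx'⟩ := h₄ A b
    have k₁ := h₁ (List.ofFn fun i => encVec (A i))
    rw [List.length_ofFn] at k₁
    have k₂ : ∀ z ∈ (D.dist n).support, (mapL D.vecMul).RunsOn (.pair z.2 (encMat A))
        (K₂ * ((n + 1) * (D.mulTime n + 1))) (PMF.pure (encMat (A * z.1))) := fun z hz => by
      have k := h₂ (ctx := z.2) (g := fun e => encVec (dec n e ᵥ* z.1))
        (l := List.ofFn fun i => encVec (A i)) (t := D.mulTime n) fun e he => by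
          obtain ⟨i, rfl⟩ := List.mem_ofFn.1 he
          rw [dec_encVec]
          exact D.vecMul_runs n z hz (A i)
      rw [List.length_ofFn] at k
      refine k.of_eq ?_
      simp only [encMat, List.map_ofFn, Function.comp_def, dec_encVec]
      rfl
    have k₃ := fun X : Matrix (Fin n) (Fin n) F => h₃ (t := K₅ * t) A X (A * X) b fun y => by
      have k := (h₅ (l := List.ofFn fun i => encVec (A i)) (hM (A * X) (b + A *ᵥ y))).1
      exact k
    -- Elimination is started only after a timeout, and then `(n + 1) ^ 3 ≤ t + 1` by
    -- `coreDist_cases`; its cubic cost is thus charged to the running time of `M`.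
    have k₄ : ∀ (X : Matrix (Fin n) (Fin n) F) (e₁ e₂ e₃ : TreeData F),
        ∀ r ∈ (coreDist M A X (A * X) b).support,
        (cond (.isAtom (.hd (.var 0))) (pre (up 4) gaussCheck) (expr (.hd (.var 0)))).RunsOn
        (.pair r (.pair e₁ (.pair e₂ (.pair e₃ (.pair (encMat A) (encVec b))))))
        (K₄ * (t + 1) + preK (up 4) (gaussCheck (F := F)) + 20)
        (PMF.pure (trialOut A b x r)) := by
      intro X e₁ e₂ e₃ r hr
      rcases coreDist_cases (fun b' => hM (A * X) b') hr with ⟨h, ht⟩ | ⟨h, -⟩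
      · refine (cond_true _ (by simp [h, ofBool, tt]) ((pre_runs rfl hx).of_eq ?_)).mono ?_
        · simp only [trialOut, h, if_true]
        · have := Nat.mul_le_mul_left K₄ ht
          simp [TreeExpr.cost]
          omega
      · exact (cond_false _ (by simp [h, ofBool]) (expr_runs (by simp [trialOut, h]))).mono
          (by simp [TreeExpr.cost])
    refine ⟨x, (bnd_pure (d' := encMat A) rfl k₁ (bnd_map (d' := encNat n) rfl (D.sample_runs n)
      fun z hz => bnd_pure (d' := .pair z.2 (encMat A)) rfl (k₂ z hz)
        (bnd_runs (d' := .pair (.pair (encMat A) (encVec b)) (.pair (encMat z.1)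
          (encMat (A * z.1)))) rfl (k₃ z.1) (k₄ z.1 _ _ _)))).mono ?_, hx'⟩
    have hp := Nat.succ_pos n
    have h1 : 1 ≤ (n + 1) ^ 2 := Nat.one_le_pow _ _ hp
    have h2 : n + 1 ≤ (n + 1) ^ 2 := Nat.le_self_pow (by norm_num) _
    have g0 : ∀ a, a ≤ a * trialTime D t n := Nat.le_const_mul (by unfold trialTime; omega)
    have g1 : n + 1 ≤ trialTime D t n := by unfold trialTime; omega
    have g2 : D.sampleTime n ≤ 1 * trialTime D t n := by unfold trialTime; omega
    have g3 : (n + 1) * (D.mulTime n + 1) ≤ trialTime D t n := by unfold trialTime; omega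
    have g4 : (n + 1) ^ 2 ≤ 1 * trialTime D t n := by unfold trialTime; omega
    have g5 : t ≤ trialTime D t n := by unfold trialTime; omega
    have g6 : t + 1 ≤ trialTime D t n := by unfold trialTime; omega
    exact Nat.add_le_const_mul (Nat.add_le_const_mul (Nat.mul_le_mul_left _ g1)
      (Nat.add_le_const_mul (Nat.add_le_const_mul g2 (Nat.add_le_const_mul (Nat.add_le_const_mul
        (Nat.mul_le_mul_left _ g3) (Nat.add_le_const_mul (Nat.add_le_const_mul
          (Nat.const_mul_le_const_mul _ (Nat.add_le_const_mul g4 (Nat.mul_le_mul_left _ g5)))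
          (Nat.add_le_const_mul (Nat.add_le_const_mul (Nat.mul_le_mul_left _ g6) (g0 _)) (g0 _)))
          (g0 _))) (g0 _))) (g0 _))) (g0 _)

theorem exists_of_mem_support_trialDist {D : TrapdooredFamily F} {M : TreeProg F} {n t : ℕ}
    {out : Matrix (Fin n) (Fin n) F → (Fin n → F) → PMF (TreeData F)}
    (hM : ∀ A b, M.RunsOn (.pair (encMat A) (encVec b)) t (out A b))
    {A : Matrix (Fin n) (Fin n) F} {b x : Fin n → F} {r : TreeData F}
    (hr : r ∈ (trialDist D M A b x).support) : ∃ x, r = verified A b x := by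
  obtain ⟨z, -, hr⟩ := (PMF.mem_support_bind_iff _ _ _).1 hr
  obtain ⟨r', hr', rfl⟩ := (PMF.mem_support_map_iff _ _ _).1 hr
  rcases coreDist_cases (fun b' => hM (A * z.1) b') hr' with ⟨h, -⟩ | ⟨-, y, rfl⟩
  · exact ⟨x, by simp [trialOut, h]⟩
  · exact ⟨y, by simp [trialOut, isAtom_verified]⟩

/-- A timeout, counted as success in `core`, becomes a real success because elimination then
supplies the solution `x`. -/
theorem prob_core_le_prob_trial (D : TrapdooredFamily F) (M : TreeProg F) {n : ℕ}
    {A : Matrix (Fin n) (Fin n) F} {b x : Fin n → F} (hx : A *ᵥ x = b) :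
    prob ((D.dist n).bind fun z => coreDist M A z.1 (A * z.1) b) {.nil}ᶜ ≤
      prob (trialDist D M A b x) {.nil}ᶜ := by
  refine prob_mono_of_le ?_
  rw [trialDist, ← PMF.map_bind, PMF.toOuterMeasure_map_apply]
  refine MeasureTheory.measure_mono fun r hr => ?_
  change trialOut A b x r ≠ .nil
  unfold trialOut
  split_ifs
  · exact verified_ne_nil hx
  · exact hr

/-! ### Lists of logarithmic length -/

/-- A list of half the length, rounded down. -/
def halve : TreeProg F :=
  pre (.cons (.cons .nil .nil) (.var 0))
    (post (fold (expr (.cons (.tl (.hd (.var 0))) (.cons .nil (.hd (.hd (.var 0)))))))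
      (.hd (.var 0)))

omit [Field F] [Fintype F] [DecidableEq F] in
theorem encNat_succ (n : ℕ) : (encNat (n + 1) : TreeData F) = .pair .nil (encNat n) := rfl

/-- Each element of the list turns the pair of counters `(i, j)` into `(j, i + 1)`, so the two
counters grow alternately. -/
theorem halve_runs : ∃ K, ∀ m : ℕ, (halve (F := F)).RunsOn (encNat m) (K * (m + 1))
    (PMF.pure (encNat (m / 2))) := by
  have key : ∀ m i j : ℕ, foldE (F := F) (.cons (.tl (.hd (.var 0))) (.cons .nil (.hd (.hd (.var 0)))))
      (List.replicate m .nil) (.pair (encNat i) (encNat j)) =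
      .pair (encNat (if m % 2 = 0 then i + m / 2 else j + m / 2))
        (encNat (if m % 2 = 0 then j + m / 2 else i + m / 2 + 1)) := by
    intro m
    induction m with
    | zero => intro i j; simp
    | succ m ih =>
      intro i j
      rw [List.replicate_succ, foldE_cons]
      refine Eq.trans (b := foldE (F := F) (.cons (.tl (.hd (.var 0)))
        (.cons .nil (.hd (.hd (.var 0))))) (List.replicate m .nil) (.pair (encNat j) (encNat (i + 1)))) (by simp [encNat_succ]) ?_
      rw [ih]
      rcases Nat.mod_two_eq_zero_or_one m with h | h
      · rw [if_pos h, if_pos h, if_neg (by omega), if_neg (by omega)]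
        congr 2 <;> omega
      · rw [if_neg (by omega), if_neg (by omega), if_pos (by omega), if_pos (by omega)]
        congr 2 <;> omega
  refine ⟨?_, fun m => ?_⟩
  rotate_left
  · refine (pre_runs (d' := .pair (.pair .nil .nil) (encNat m)) rfl (post_pure (fold_expr (key m 0 0))
      (d'' := encNat (m / 2)) ?_)).mono ?_
    · simp
    · rw [List.length_replicate]
      have h1 : 1 ≤ m + 1 := Nat.le_add_left _ _
      exact Nat.add_le_const_mul (Nat.add_le_const_mul le_rfl (Nat.le_const_mul h1 _))
        (Nat.le_const_mul h1 _)

/-- Put `k` times `nil` in front of a list. -/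
def padE : ℕ → TreeExpr F → TreeExpr F
  | 0, e => e
  | k + 1, e => .cons .nil (padE k e)

omit [Fintype F] in
theorem eval_padE (k : ℕ) (e : TreeExpr F) (s : TreeStore F) {m : ℕ} (h : e.eval s = encNat m) :
    (padE k e).eval s = encNat (m + k) := by
  induction k with
  | zero => exact h
  | succ k ih => simp [padE, ih, ← add_assoc, encNat_succ]

/-- One step of `logList`. -/
def logStep (k : ℕ) : TreeProg F :=
  cond (.hd (.hd (.var 0)))
    (bnd halve (.hd (.hd (.var 0))) (expr (.cons (.hd (.var 0)) (padE k (.tl (.hd (up 1)))))))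
    (expr (.hd (.var 0)))

/-- The effect of `logStep` on the lengths of the lists. -/
def logNext (k : ℕ) (s : ℕ × ℕ) (_ : Unit) : ℕ × ℕ := if s.1 = 0 then s else (s.1 / 2, s.2 + k)

/-- A positive `m` reaches zero after `log₂ m + 1 = log₂ (2 m)` halvings, each of which adds `k`;
the remaining rounds do nothing. Looping `n` times is enough when `m < 2 ^ n`, in particular for `m
= n`. -/
theorem foldl_logNext (k n : ℕ) : ∀ m j, m < 2 ^ n →
    ((List.replicate n ()).foldl (logNext k) (m, j)).2 = j + k * Nat.log 2 (2 * m) := by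
  induction n with
  | zero => intro m j h; simp [show m = 0 by simpa using h]
  | succ n ih =>
    intro m j h
    rw [List.replicate_succ, List.foldl_cons, logNext]
    rcases Nat.eq_zero_or_pos m with rfl | hm
    · rw [if_pos rfl]
      exact ih 0 j (by positivity)
    · rw [if_neg hm.ne']
      refine (ih (m / 2) (j + k) (by rw [pow_succ] at h; omega)).trans ?_
      rw [mul_comm 2 m, Nat.log_mul_base (by norm_num) hm.ne']
      rcases Nat.eq_zero_or_pos (m / 2) with h0 | h0
      · have : m = 1 := by omega
        subst this
        simp
      · rw [mul_comm 2 (m / 2), Nat.log_mul_base (by norm_num) h0.ne', Nat.log_of_one_lt_of_le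
          (n := m) (by norm_num) (by omega)]
        ring

/-- On an input of length `n`: a list of length `k (log n + 1)`. -/
def logList (k : ℕ) : TreeProg F :=
  bnd natOf (.var 0) (pre (.cons (.cons (.hd (.var 0)) .nil) (.hd (.var 0)))
    (post (fold (logStep k)) (.tl (.var 0))))

theorem logList_runs (k : ℕ) : ∃ K, ∀ l : List (TreeData F), (logList k).RunsOn (.ofList l)
    (K * (l.length + 1) ^ 2) (PMF.pure (encNat (k * Nat.log 2 (2 * l.length)))) := by
  obtain ⟨K₁, h₁⟩ := natOf_runs (F := F)
  obtain ⟨K₂, h₂⟩ := halve_runs (F := F)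
  let enc : ℕ × ℕ → TreeData F := fun s => .pair (encNat s.1) (encNat s.2)
  let C := (TreeExpr.hd (F := F) (.hd (.var 0))).cost + 1
  let e : TreeExpr F := .cons (.hd (.var 0)) (padE k (.tl (.hd (up 1))))
  let B := bndK halve (.hd (.hd (.var 0))) (expr e)
  refine ⟨?_, fun l => ?_⟩
  rotate_left
  · have hfold := fold_state (c := logStep k) enc (fun _ : Unit => .nil) (logNext k)
      (fun s => s.1 ≤ l.length) (t := K₂ * (l.length + 1) + (e.cost + 1 + B + C + 10))
      (fun s _ hs => ⟨by
        unfold logNext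
        split_ifs with h0
        · refine (cond_false _ (by simp [enc, h0]; rfl) (expr_runs (by simp))).mono ?_
          simp [TreeExpr.cost]
          omega
        · obtain ⟨m, hm⟩ := Nat.exists_eq_succ_of_ne_zero h0
          refine (cond_true _ (by simp [enc, hm, encNat_succ]) (bnd_pure (d' := encNat s.1)
            (by simp [enc]) (h₂ s.1) (expr_runs (e := e) ?_))).mono ?_
          · simp only [e, TreeExpr.eval, initStore_zero, hd_pair, enc]
            rw [eval_padE k _ _ (m := s.2) (by simp [up])]
          · have : K₂ * (s.1 + 1) ≤ K₂ * (l.length + 1) := Nat.mul_le_mul_left _ (by omega)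
            simp only [B, C, e]
            omega, by
        unfold logNext
        split_ifs
        · exact hs
        · exact (Nat.div_le_self _ _).trans hs⟩)
      (List.replicate l.length ()) (l.length, 0) le_rfl
    rw [List.map_replicate, List.length_replicate] at hfold
    refine (bnd_pure rfl (h₁ l) (pre_runs (d' := .pair (enc (l.length, 0)) (encNat l.length)) rfl
      (post_pure hfold ?_))).mono ?_
    · simp only [TreeExpr.eval, initStore_zero, enc, tl_pair]
      rw [foldl_logNext k _ _ _ l.length.lt_two_pow_self, zero_add]
    · have h1 : 1 ≤ (l.length + 1) ^ 2 := Nat.one_le_pow _ _ (Nat.succ_pos _)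
      have h2 : 1 ≤ l.length + 1 := Nat.le_add_left _ _
      have h3 : l.length + 1 ≤ (l.length + 1) ^ 2 := Nat.le_self_pow (by norm_num) _
      have h4 : l.length ≤ 1 * (l.length + 1) := by omega
      rw [pow_two] at h1 h3 ⊢
      exact Nat.add_le_const_mul (Nat.add_le_const_mul (Nat.mul_le_mul_left _ h3)
        (Nat.add_le_const_mul (Nat.add_le_const_mul (Nat.add_le_const_mul (Nat.mul_le_const_mul h4
          (Nat.add_le_const_mul (Nat.add_le_const_mul le_rfl (Nat.le_const_mul h2 _))
          (Nat.le_const_mul h2 _))) (Nat.le_const_mul h1 _)) (Nat.le_const_mul h1 _))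
          (Nat.le_const_mul h1 _))) (Nat.le_const_mul h1 _)

end TreeProg

/-! ### Repeated attempts and their success probability -/

theorem prob_compl {α : Type*} (μ : PMF α) (s : Set α) : prob μ sᶜ = 1 - prob μ s := by
  have h : μ.toOuterMeasure s + μ.toOuterMeasure sᶜ = 1 := by
    rw [PMF.toOuterMeasure_apply, PMF.toOuterMeasure_apply, ← ENNReal.tsum_add, ← μ.tsum_coe]
    refine tsum_congr fun a => ?_
    exact congrFun (Set.indicator_self_add_compl s μ) a
  have h1 := congrArg ENNReal.toReal h
  rw [ENNReal.toReal_add ((μ.toOuterMeasure_le_one s).trans_lt ENNReal.one_lt_top).ne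
    ((μ.toOuterMeasure_le_one _).trans_lt ENNReal.one_lt_top).ne, ENNReal.toReal_one] at h1
  unfold prob
  linarith

theorem prob_singleton {α : Type*} (μ : PMF α) (a : α) : prob μ {a} = (μ a).toReal := by
  rw [prob, PMF.toOuterMeasure_apply_singleton]

namespace TreeProg

open TreeData

variable {F : Type*} [Field F] [Fintype F] [DecidableEq F]

open Classical in
/-- Up to `k` attempts to get an answer different from `nil`. -/
noncomputable def attempts (μ : PMF (TreeData F)) : ℕ → PMF (TreeData F)
  | 0 => PMF.pure .nil
  | k + 1 => μ.bind fun r => if r = .nil then attempts μ k else PMF.pure r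

omit [Field F] [Fintype F] [DecidableEq F] in
-- The attempts use independent coins, and failure of all of them is the only way to end with `nil`.
theorem attempts_nil (μ : PMF (TreeData F)) (k : ℕ) : attempts μ k .nil = μ .nil ^ k := by
  induction k with
  | zero => simp [attempts]
  | succ k ih =>
    rw [attempts, PMF.bind_apply, tsum_eq_single .nil]
    · rw [if_pos rfl, ih, pow_succ']
    · intro r hr
      rw [if_neg hr, PMF.pure_apply, if_neg hr.symm, mul_zero]

omit [Field F] [Fintype F] [DecidableEq F] in
theorem support_attempts_subset (μ : PMF (TreeData F)) (k : ℕ) :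
    (attempts μ k).support ⊆ insert .nil μ.support := by
  induction k with
  | zero => simp [attempts]
  | succ k ih =>
    intro r hr
    obtain ⟨a, ha, hr⟩ := (PMF.mem_support_bind_iff _ _ _).1 hr
    split_ifs at hr with h
    · exact ih hr
    · rw [PMF.support_pure, Set.mem_singleton_iff] at hr
      exact .inr (hr ▸ ha)

/-- One more attempt, if there is no answer so far. -/
def retry (c : TreeProg F) : TreeProg F :=
  cond (.hd (.hd (.var 0))) (expr (.hd (.var 0)))
    (bnd c (.tl (.hd (.var 0))) (expr (.cons (.hd (.var 0)) (.tl (.hd (up 1))))))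

/-- The accumulator holds the current answer together with the input `d`, so that `d` is available
for the next attempt. Once an answer is found the remaining rounds leave it unchanged. -/
theorem fold_retry_runs (c : TreeProg F) : ∃ K, ∀ {d : TreeData F} {t : ℕ} {μ : PMF (TreeData F)},
    c.RunsOn d t μ → ∀ k : ℕ, (fold (retry c)).RunsOn (.pair (.pair .nil d) (encNat k))
      (K * ((k + 1) * (t + 1))) ((attempts μ k).map fun r => .pair r d) := by
  classical
  refine ⟨?_, fun {d t μ} h k => ?_⟩
  rotate_left
  · let f : TreeData F → TreeData F → PMF (TreeData F) := fun acc _ =>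
      if acc.hd = .nil then μ.map fun r => .pair r d else PMF.pure acc
    have h1 := fold_runs (c := retry c) (f := f) (t := t + ((TreeExpr.cons (F := F) (.hd (.var 0))
        (.tl (.hd (up 1)))).cost + 1 + bndK c (.tl (.hd (.var 0))) (expr (.cons (.hd (.var 0))
        (.tl (.hd (up 1))))) + 20))
      (fun _ acc => acc.tl = d) (fun e l acc hacc => by
        by_cases h0 : acc.hd = .nil
        · simp only [f, if_pos h0]
          refine ⟨(cond_false _ (by simpa using h0) ((bnd_runs (d' := d) (by simpa using hacc) h
            fun r _ => expr_runs (d' := .pair r d) (by simpa [up] using hacc)).of_eq rfl)).mono ?_,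
            fun a ha => ?_⟩
          · simp [TreeExpr.cost]
            omega
          · obtain ⟨r, -, rfl⟩ := (PMF.mem_support_map_iff _ _ _).1 ha
            rfl
        · simp only [f, if_neg h0]
          refine ⟨(cond_true _ (by simpa using h0) (expr_runs (by simp))).mono ?_, fun a ha => ?_⟩
          · simp [TreeExpr.cost]
            omega
          · rw [PMF.support_pure, Set.mem_singleton_iff] at ha
            rwa [ha])
      (List.replicate k .nil) (.pair .nil d) rfl
    rw [List.length_replicate] at h1
    refine (h1.mono ?_).of_eq ?_
    · have h2 : 1 ≤ t + 1 := Nat.le_add_left _ _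
      have h3 : k ≤ 1 * (k + 1) := by omega
      have h4 : t ≤ 1 * (t + 1) := by omega
      have h5 : 1 ≤ (k + 1) * (t + 1) := Nat.mul_pos (Nat.succ_pos _) (Nat.succ_pos _)
      exact Nat.add_le_const_mul (Nat.mul_le_const_mul h3 (Nat.add_le_const_mul
        (Nat.add_le_const_mul h4 (Nat.le_const_mul h2 _)) (Nat.le_const_mul h2 _)))
        (Nat.le_const_mul h5 _)
    · clear h1
      have hf : ∀ (l : List (TreeData F)) (acc : TreeData F), acc.hd ≠ .nil →
          foldDist f acc l = PMF.pure acc := by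
        intro l
        induction l with
        | nil => intro acc _; rfl
        | cons e l ih =>
          intro acc h0
          simp only [foldDist, f, if_neg h0, PMF.pure_bind]
          exact ih acc h0
      induction k with
      | zero => simp [attempts, foldDist, PMF.pure_map]
      | succ k ih =>
        rw [List.replicate_succ, foldDist, attempts, PMF.map_bind]
        simp only [f, hd_pair, if_true, PMF.bind_map]
        refine congrArg _ (funext fun r => ?_)
        simp only [Function.comp_apply]
        split_ifs with hr
        · rw [hr]
          exact ih
        · rw [PMF.pure_map]
          exact hf _ _ hr

/-- On the input `(A, b)` where `A` has `n` rows: at most `k (log n + 1)` attempts with `c`. -/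
def solver (k : ℕ) (c : TreeProg F) : TreeProg F :=
  bnd (logList k) (.hd (.var 0)) (pre (.cons (.cons .nil (up 1)) (.hd (.var 0)))
    (post (fold (retry c)) (.tl (.hd (.var 0)))))

theorem solver_runs (k : ℕ) (c : TreeProg F) : ∃ K, ∀ {n t : ℕ} (A : Matrix (Fin n) (Fin n) F)
    {v : TreeData F} {μ : PMF (TreeData F)}, c.RunsOn (.pair (encMat A) v) t μ →
    (solver k c).RunsOn (.pair (encMat A) v)
      (K * ((n + 1) ^ 2 + (k * Nat.log 2 (2 * n) + 1) * (t + 1)))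
      ((attempts μ (k * Nat.log 2 (2 * n))).map tl) := by
  obtain ⟨K₁, h₁⟩ := logList_runs (F := F) k
  obtain ⟨K₂, h₂⟩ := fold_retry_runs c
  refine ⟨?_, fun {n t} A v μ h => ?_⟩
  rotate_left
  · have k₁ := h₁ (List.ofFn fun i => encVec (A i))
    rw [List.length_ofFn] at k₁
    refine ((bnd_pure (d' := encMat A) rfl k₁ (pre_runs rfl
      (post_runs (h₂ h (k * Nat.log 2 (2 * n)))))).mono ?_).of_eq ?_
    · have h1 : 1 ≤ (n + 1) ^ 2 := Nat.one_le_pow _ _ (Nat.succ_pos _)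
      generalize (k * Nat.log 2 (2 * n) + 1) * (t + 1) = T
      have g0 : ∀ a, a ≤ a * ((n + 1) ^ 2 + T) := Nat.le_const_mul (h1.trans (Nat.le_add_right _ _))
      exact Nat.add_le_const_mul (Nat.add_le_const_mul (Nat.mul_le_mul_left _ (Nat.le_add_right _ _))
        (Nat.add_le_const_mul (Nat.add_le_const_mul (Nat.mul_le_mul_left _ (Nat.le_add_left _ _))
        (g0 _)) (g0 _))) (g0 _)
    · rw [PMF.map_comp]
      rfl

omit [Fintype F] in
/-- The answer after several attempts is a solution or `nil`. -/
theorem support_map_attempts_subset {n : ℕ} (A : Matrix.GeneralLinearGroup (Fin n) F)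
    (b : Fin n → F) {μ : PMF (TreeData F)} (hμ : ∀ r ∈ μ.support, ∃ x, r = verified A.1 b x)
    (k : ℕ) : ((attempts μ k).map tl).support ⊆ {encVec (A⁻¹.1 *ᵥ b), .nil} := by
  intro d hd
  obtain ⟨r, hr, rfl⟩ := (PMF.mem_support_map_iff _ _ _).1 hd
  rcases support_attempts_subset μ k hr with rfl | hr
  · exact .inr rfl
  · obtain ⟨x, rfl⟩ := hμ r hr
    unfold verified
    split_ifs with hx
    · left
      rw [← hx, Matrix.mulVec_mulVec, ← Units.val_mul, inv_mul_cancel]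
      simp
    · exact .inr rfl

omit [Fintype F] in
-- A verified answer different from `nil` must be the unique solution, so the probability of success
-- is that of not failing `k` times in a row. Taking the tail removes the mark.
theorem one_sub_le_prob_attempts {n : ℕ} (A : Matrix.GeneralLinearGroup (Fin n) F)
    (b : Fin n → F) {μ : PMF (TreeData F)} (hμ : ∀ r ∈ μ.support, ∃ x, r = verified A.1 b x)
    (k : ℕ) : 1 - (1 - prob μ {.nil}ᶜ) ^ k ≤
      prob ((attempts μ k).map tl) {encVec (A⁻¹.1 *ᵥ b)} := by
  have h1 : prob (attempts μ k) {.nil}ᶜ = 1 - (1 - prob μ {.nil}ᶜ) ^ k := by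
    rw [prob_compl, prob_compl, prob_singleton, prob_singleton, attempts_nil, ENNReal.toReal_pow]
    ring
  rw [← h1]
  refine prob_mono_of_le ?_
  rw [PMF.toOuterMeasure_map_apply]
  refine PMF.toOuterMeasure_mono _ fun r hr => ?_
  rcases support_attempts_subset μ k hr.2 with h | h
  · exact absurd h hr.1
  · obtain ⟨x, rfl⟩ := hμ r h
    have hr1 : verified A.1 b x ≠ .nil := hr.1
    unfold verified at hr1 ⊢
    split_ifs at hr1 ⊢ with hx
    · change encVec x = encVec _
      rw [← hx, Matrix.mulVec_mulVec, ← Units.val_mul, inv_mul_cancel]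
      simp
    · exact absurd rfl hr1

end TreeProg

/-! ### The proportion of invertible matrices -/

/-- The bound 1/4 alone is not inductive. With `e = (1 / 2) ^ (n + 2) ≤ 1 / 4` the strengthened
bound passes on, since `(1 / 4 + e) (1 - e) ≥ 1 / 4 + e / 2`. For `q = 2` it is an equality at the
start. -/
theorem quarter_le_prod (q : ℝ) (hq : 2 ≤ q) (n : ℕ) :
    1 / 4 ≤ ∏ i ∈ Finset.range n, (1 - (q ^ (i + 1))⁻¹) := by
  have key : ∀ n : ℕ, 1 / 4 + (1 / 2) ^ (n + 2) ≤ ∏ i ∈ Finset.range (n + 1), (1 - (q ^ (i + 1))⁻¹) := by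
    intro n
    induction n with
    | zero =>
      have : q⁻¹ ≤ 2⁻¹ := inv_anti₀ (by norm_num) hq
      norm_num at this ⊢
      linarith
    | succ n ih =>
      rw [Finset.prod_range_succ]
      have h1 : (q ^ (n + 1 + 1))⁻¹ ≤ (1 / 2) ^ (n + 2) := by
        rw [one_div, inv_pow]
        exact inv_anti₀ (by positivity) (pow_le_pow_left₀ (by norm_num) hq _)
      have h2 : (1 / 2 : ℝ) ^ (n + 2) ≤ 1 / 4 := by
        calc (1 / 2 : ℝ) ^ (n + 2) ≤ (1 / 2) ^ 2 :=
              pow_le_pow_of_le_one (by norm_num) (by norm_num) (by omega)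
          _ = 1 / 4 := by norm_num
      have h3 : (0 : ℝ) < (1 / 2) ^ (n + 2) := by positivity
      have h4 : (1 / 2 : ℝ) ^ (n + 1 + 2) = (1 / 2) ^ (n + 2) / 2 := by
        rw [show n + 1 + 2 = n + 2 + 1 by ring, pow_succ]
        ring
      rw [h4]
      nlinarith
  cases n with
  | zero => norm_num
  | succ n => exact le_trans (by simp) (key n)

/-- A random matrix is invertible with probability at least `1 / 4`. -/
theorem quarter_le_card_GL_div (F : Type*) [Field F] [Fintype F] [DecidableEq F] (n : ℕ) :
    (1 / 4 : ℝ) ≤ (Fintype.card (Matrix.GeneralLinearGroup (Fin n) F) : ℝ) /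
      Fintype.card (Matrix (Fin n) (Fin n) F) := by
  have hq : (2 : ℝ) ≤ Fintype.card F := by exact_mod_cast Fintype.one_lt_card (α := F)
  have hq0 : (0 : ℝ) < Fintype.card F := by linarith
  have h1 := Matrix.card_GL_field (𝔽 := F) n
  rw [Nat.card_eq_fintype_card] at h1
  have h2 : Fintype.card (Matrix (Fin n) (Fin n) F) = ∏ _i : Fin n, Fintype.card F ^ n := by
    rw [show Fintype.card (Matrix (Fin n) (Fin n) F) = Fintype.card (Fin n → Fin n → F) from
      Fintype.card_congr (Equiv.refl _)]
    simp
  rw [h1, h2, Nat.cast_prod, Nat.cast_prod, ← Finset.prod_div_distrib]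
  refine (quarter_le_prod (Fintype.card F) hq n).trans (le_of_eq ?_)
  -- The factor `(q ^ n - q ^ i) / q ^ n` equals `1 - q ^ (-(n - i))`, so the product appears with
  -- its order reversed.
  rw [← Finset.prod_range_reflect, ← Fin.prod_univ_eq_prod_range]
  refine Finset.prod_congr rfl fun i _ => ?_
  rw [Nat.cast_sub (Nat.pow_le_pow_right (by have := Fintype.card_pos (α := F); omega) i.2.le)]
  push_cast
  have h3 : (Fintype.card F : ℝ) ^ n = Fintype.card F ^ (i : ℕ) * Fintype.card F ^ (n - 1 - i + 1) := by
    rw [← pow_add]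
    congr 1
    have := i.2
    omega
  rw [h3]
  field_simp

/-! ### Calculus of bounds up to logarithmic factors -/

namespace SoftO

variable {f g h : ℕ → ℕ}

theorem of_le {C : ℕ} (hfg : ∀ᶠ n in atTop, f n ≤ C * g n) : SoftO f g :=
  ⟨C, 0, hfg.mono fun n hn => by simpa using hn⟩

theorem eventually_one_le_log : ∀ᶠ n in atTop, 1 ≤ Nat.log 2 n :=
  (eventually_ge_atTop 2).mono fun _ hn => Nat.log_pos (by norm_num) hn

theorem trans (hfg : SoftO f g) (hgh : SoftO g h) : SoftO f h := by
  obtain ⟨C₁, k₁, h₁⟩ := hfg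
  obtain ⟨C₂, k₂, h₂⟩ := hgh
  refine ⟨C₁ * C₂, k₂ + k₁, ?_⟩
  filter_upwards [h₁, h₂] with n h1 h2
  calc f n ≤ C₁ * g n * Nat.log 2 n ^ k₁ := h1
    _ ≤ C₁ * (C₂ * h n * Nat.log 2 n ^ k₂) * Nat.log 2 n ^ k₁ := by gcongr
    _ = C₁ * C₂ * h n * Nat.log 2 n ^ (k₂ + k₁) := by ring

theorem add (hf : SoftO f h) (hg : SoftO g h) : SoftO (fun n => f n + g n) h := by
  obtain ⟨C₁, k₁, h₁⟩ := hf
  obtain ⟨C₂, k₂, h₂⟩ := hg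
  refine ⟨C₁ + C₂, k₁ + k₂, ?_⟩
  filter_upwards [h₁, h₂, eventually_one_le_log] with n h1 h2 h3
  have e1 : Nat.log 2 n ^ k₁ ≤ Nat.log 2 n ^ (k₁ + k₂) := Nat.pow_le_pow_right h3 (by omega)
  have e2 : Nat.log 2 n ^ k₂ ≤ Nat.log 2 n ^ (k₁ + k₂) := Nat.pow_le_pow_right h3 (by omega)
  calc f n + g n ≤ C₁ * h n * Nat.log 2 n ^ k₁ + C₂ * h n * Nat.log 2 n ^ k₂ := add_le_add h1 h2
    _ ≤ C₁ * h n * Nat.log 2 n ^ (k₁ + k₂) + C₂ * h n * Nat.log 2 n ^ (k₁ + k₂) := by gcongr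
    _ = (C₁ + C₂) * h n * Nat.log 2 n ^ (k₁ + k₂) := by ring

theorem const_mul (C : ℕ) (hf : SoftO f g) : SoftO (fun n => C * f n) g :=
  (of_le (C := C) (Eventually.of_forall fun _ => le_rfl)).trans hf

theorem mul_left (h : ℕ → ℕ) (hf : SoftO f g) : SoftO (fun n => h n * f n) fun n => h n * g n := by
  obtain ⟨C, k, h₁⟩ := hf
  refine ⟨C, k, h₁.mono fun n hn => (Nat.mul_le_mul_left (h n) hn).trans (le_of_eq ?_)⟩
  ring

theorem log_mul (k : ℕ) (hf : SoftO f g) :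
    SoftO (fun n => (k * Nat.log 2 (2 * n) + 1) * f n) g := by
  refine SoftO.trans (g := f) ⟨2 * k + 1, 1, ?_⟩ hf
  filter_upwards [eventually_one_le_log, eventually_ge_atTop 1] with n h1 h2
  rw [mul_comm 2 n, Nat.log_mul_base (by norm_num) (by omega), pow_one, mul_right_comm]
  refine Nat.mul_le_mul_right _ ?_
  nlinarith

end SoftO

/-! ### Choice of parameters and conclusion -/

/-- The number of repetitions is a multiple of `Nat.log 2 (2 * n)` because `2` to this power exceeds
`n` in spite of the rounding. -/
theorem inv_two_pow_log_le {n : ℕ} (hn : 1 ≤ n) (c : ℕ) :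
    ((1 / 2 : ℝ) ^ c) ^ Nat.log 2 (2 * n) ≤ 1 / (n : ℝ) ^ c := by
  have h1 : n < 2 ^ Nat.log 2 (2 * n) := by
    have := Nat.lt_pow_succ_log_self (b := 2) (by norm_num) (2 * n)
    rw [pow_succ] at this
    omega
  have h2 : (n : ℝ) ≤ 2 ^ Nat.log 2 (2 * n) := by exact_mod_cast h1.le
  rw [← pow_mul, mul_comm c, pow_mul, one_div_pow, one_div_pow]
  exact one_div_le_one_div_of_le (by positivity) (pow_le_pow_left₀ (by positivity) h2 c)

/-- Everything except the run of `M` is Õ(n²), including the `n` products of nearly linear cost, and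
n² = Õ(T). -/
theorem softO_trialTime {F : Type*} [Field F] [Fintype F] [DecidableEq F] {D : TrapdooredFamily F}
    (hsample : D.EfficientlySamplable) (hmul : D.EfficientMul) {T : ℕ → ℕ}
    (hT : SoftO (fun n => n ^ 2) T) : SoftO (fun n => TreeProg.trialTime D (T n) n) T := by
  have h1 : SoftO (fun n => (n + 1) ^ 2) fun n => n ^ 2 :=
    .of_le (C := 4) <| (eventually_ge_atTop 1).mono fun n hn => by nlinarith
  have h2 : SoftO (fun n => D.mulTime n + 1) fun n => n :=
    hmul.add (.of_le (C := 1) <| (eventually_ge_atTop 1).mono fun n hn => by omega)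
  have h3 : SoftO (fun n => (n + 1) * n) fun n => n ^ 2 :=
    .of_le (C := 2) <| (eventually_ge_atTop 1).mono fun n hn => by nlinarith
  exact (((h1.add hsample).add ((h2.mul_left fun n => n + 1).trans h3)).trans hT).add
    (.of_le (C := 1) <| Eventually.of_forall fun n => (one_mul _).ge)

theorem mainTheorem7 {F : Type*} [Field F] [Fintype F] [DecidableEq F]
    (D : TrapdooredFamily F) (hsample : D.EfficientlySamplable) (hmul : D.EfficientMul)
    (hind : D.Indistinguishable)
    (ε : ℝ) (hε : 0 < ε)
    (M : TreeProg F) (T : ℕ → ℕ) (hT : SoftO (fun n => n ^ 2) T)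
    (out : (n : ℕ) → Matrix (Fin n) (Fin n) F → (Fin n → F) → PMF (TreeData F))
    (hM : ∀ n A b, M.RunsOn (.pair (.encMat A) (.encVec b)) (T n) (out n A b))
    (hsucc : ∀ᶠ n in atTop, ε ≤ averageSuccess (out n)) :
    ∀ c : ℕ, ∃ (W : TreeProg F) (t : ℕ → ℕ)
      (res : (n : ℕ) → Matrix (Fin n) (Fin n) F → (Fin n → F) → PMF (TreeData F)),
      SoftO t T ∧
      (∀ n A b, W.RunsOn (.pair (.encMat A) (.encVec b)) (t n) (res n A b)) ∧
      (∀ n (A : Matrix.GeneralLinearGroup (Fin n) F) (b : Fin n → F),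
        (res n A.1 b).support ⊆ {.encVec (A⁻¹.1 *ᵥ b), .nil}) ∧
      ∀ᶠ n : ℕ in atTop, ∀ (A : Matrix.GeneralLinearGroup (Fin n) F) (b : Fin n → F),
        1 - 1 / (n : ℝ) ^ c ≤ prob (res n A.1 b) {.encVec (A⁻¹.1 *ᵥ b)} := by
  intro c
  -- A lower bound for the success of one attempt: strictly below `ε / 4` to leave a gap for the
  -- advantage of the distinguisher, and at most 1 so that powers of `1 - p` are monotone.
  obtain ⟨p, hp0, hp1, hp⟩ : ∃ p : ℝ, 0 < p ∧ p ≤ 1 ∧ p < ε / 4 :=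
    ⟨min 1 (ε / 8), by positivity, min_le_left _ _, (min_le_right _ _).trans_lt (by linarith)⟩
  -- Each block of `k` attempts fails with probability below `2 ^ (-c)`, and there are `log₂ (2 n)`
  -- blocks.
  obtain ⟨k, hk⟩ := exists_pow_lt_of_lt_one (show (0 : ℝ) < (1 / 2) ^ c by positivity)
    (show 1 - p < 1 by linarith)
  obtain ⟨K₁, h₁⟩ := TreeProg.trial_runs D M
  obtain ⟨K₂, h₂⟩ := TreeProg.solver_runs k (TreeProg.trial D M)
  choose x hx hx' using fun n => h₁ (hM n)
  refine ⟨TreeProg.solver k (TreeProg.trial D M), _, _, ?_, fun n A b => h₂ A (hx n A b),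
    fun n A b => TreeProg.support_map_attempts_subset A b
      (fun r => TreeProg.exists_of_mem_support_trialDist (hM n)) _, ?_⟩
  · have h1 : SoftO (fun n => (n + 1) ^ 2) fun n => n ^ 2 :=
      .of_le (C := 4) <| (eventually_ge_atTop 1).mono fun n hn => by nlinarith
    have h2 : SoftO (fun _ => 1) fun n => n ^ 2 :=
      .of_le (C := 1) <| (eventually_ge_atTop 1).mono fun n hn => by nlinarith
    exact ((h1.trans hT).add ((((softO_trialTime hsample hmul hT).const_mul K₁).add
      (h2.trans hT)).log_mul k)).const_mul K₂
  · have hcore := TreeProg.eventually_le_core hind (M := M) hp (hsucc.mono fun n hn A b => by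
      refine le_trans ?_ (TreeProg.le_core_uniform (hM n) A b)
      have h1 := quarter_le_card_GL_div F n
      nlinarith)
    filter_upwards [hcore, eventually_ge_atTop 1] with n h1 hn A b
    have hxA : A.1 *ᵥ x n A.1 b = b := by
      rw [hx' n A.1 b A rfl, Matrix.mulVec_mulVec, ← Units.val_mul, mul_inv_cancel]
      simp
    have h3 := (h1 A b).trans (TreeProg.prob_core_le_prob_trial D M hxA)
    refine le_trans ?_ (TreeProg.one_sub_le_prob_attempts A b
      (fun r => TreeProg.exists_of_mem_support_trialDist (hM n)) _)
    have h4 : prob (TreeProg.trialDist D M A.1 b (x n A.1 b)) {.nil}ᶜ ≤ 1 :=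
      ENNReal.toReal_mono ENNReal.one_ne_top (PMF.toOuterMeasure_le_one _ _)
    refine sub_le_sub_left (le_trans ?_ (inv_two_pow_log_le hn c)) 1
    calc _ ≤ (1 - p) ^ (k * Nat.log 2 (2 * n)) :=
          pow_le_pow_left₀ (by linarith) (by linarith) _
      _ = ((1 - p) ^ k) ^ Nat.log 2 (2 * n) := pow_mul _ _ _
      _ ≤ _ := pow_le_pow_left₀ (pow_nonneg (by linarith) _) hk.le _
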